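/- Let $d\in\mathbb N$, let $B=\frac12\sum_{j,k}B_{jk}\,dx_j\wedge dx_k$ be a magnetic field on $\mathbb R^d$, i.e. a closed $2$-form with $B_{jk}=-B_{kj}$ smooth, real and bounded together with all derivatives, and let $A=\sum_jA_j\,dx_j$ be a vector potential, $dA=B$, whose real coefficients are smooth with all derivatives of at most polynomial growth. Put $\langle\xi\rangle=(1+|\xi|^2)^{1/2}$, $D_x=-i\partial_x$ and $$\omega^A(x,y)=\exp\Big(-i\int_{[x,y]}A\Big)=\exp\Big(i\Big\langle x-y,\int_0^1A\big((1-s)x+sy\big)\,ds\Big\rangle\Big).$$ For $m\in\mathbb R$ let $S^m$ be the set of $f\in C^\infty(\mathbb R^d\times\mathbb R^d;\mathbb C)$ such that $\sup_{x,\xi}\langle\xi\rangle^{|\beta|-m}|\partial_x^\alpha\partial_\xi^\beta f(x,\xi)|<\infty$ for all $\alpha,\beta\in\mathbb N^d$. For $a,b\in S^m$ let $\mathfrak{Op}^A(a)$ and $b^A(x,D)$ be the continuous linear maps $\mathcal S(\mathbb R^d)\to\mathcal S(\mathbb R^d)$ given by the oscillating integrals $$[\mathfrak{Op}^A(a)u](x)=(2\pi)^{-d}\int\!\!\int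 e^{i\langle x-y,\eta\rangle}\,\omega^A(x,y)\,a\big(\tfrac{x+y}2,\eta\big)\,u(y)\,dy\,d\eta,$$ $$[b^A(x,D)u](x)=(2\pi)^{-d}\int\!\!\int e^{i\langle x-y,\eta\rangle}\,\omega^A(x,y)\,b(x,\eta)\,u(y)\,dy\,d\eta.$$ Here an oscillating integral $\int\!\!\int f(y,\eta)\,dy\,d\eta$ means $\lim_{\varepsilon\to0+}\int\!\!\int\chi(\varepsilon y,\varepsilon\eta)f(y,\eta)\,dy\,d\eta$, the limit existing and being the same for every $\chi\in\mathcal S(\mathbb R^d\times\mathbb R^d)$ with $\chi(0)=1$. 1. For every $a\in S^m$ there is $b\in S^m$ with $\mathfrak{Op}^A(a)=b^A(x,D)$ and $$b\sim\sum_{\alpha\in\mathbb N^d}\frac1{\alpha!}\Big(\frac12\Big)^{|\alpha|}D_x^\alpha\partial_\eta^\alpha a .$$ 2. Conversely, for every $b\in S^m$ there is $a\in S^m$ with $b^A(x,D)=\mathfrak{Op}^A(a)$ and $$a\sim\sum_{\alpha\in\mathbb N^d}\frac1{\alpha!}\Big(-\frac12\Big)^{|\alpha|}D_x^\alpha\partial_\eta^\alpha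 b .$$ Here $f\sim\sum_\alpha f_\alpha$, with $\sum_{|\alpha|=j}f_\alpha\in S^{m-j}$ for every $j\ge0$, means that $f-\sum_{|\alpha|<k}f_\alpha\in S^{m-k}$ for every $k\ge1$. -/

import Mathlib

open scoped SchwartzMap ContDiff

noncomputable section

namespace MagneticPsiDO

/-- The configuration space `ℝ^d` with its Euclidean scalar product. -/
abbrev Conf (d : ℕ) : Type := EuclideanSpace ℝ (Fin d)

/-- The phase space `ℝ^d × ℝ^d`, with points `(x, ξ)`. -/
abbrev Phase (d : ℕ) : Type := Conf d × Conf d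

/-- The Japanese bracket `<ξ> = √(1 + |ξ|²)`. -/
def bracket {d : ℕ} (ξ : Conf d) : ℝ := Real.sqrt (1 + ‖ξ‖ ^ 2)

/-! ### Partial derivatives and symbols -/

/-- The partial derivative `∂_{x_j} f` of a function on phase space. -/
def partialX {d : ℕ} (j : Fin d) (f : Phase d → ℂ) : Phase d → ℂ :=
  fun p => fderiv ℝ f p (EuclideanSpace.single j 1, 0)

/-- The partial derivative `∂_{ξ_j} f` of a function on phase space. -/
def partialXi {d : ℕ} (j : Fin d) (f : Phase d → ℂ) : Phase d → ℂ :=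
  fun p => fderiv ℝ f p (0, EuclideanSpace.single j 1)

/-- `D_{x_j} = -i ∂_{x_j}`. -/
def dX {d : ℕ} (j : Fin d) (f : Phase d → ℂ) : Phase d → ℂ :=
  fun p => -Complex.I * partialX j f p

/-- `P^α = P_1^{α_1} ⋯ P_d^{α_d}` for operators `P_1, …, P_d` and a multi-index `α ∈ ℕ^d`. -/
def multiPow {d : ℕ} {F : Type} (P : Fin d → F → F) (α : Fin d → ℕ) (f : F) : F :=
  (List.finRange d).foldr (fun j g => (P j)^[α j] g) f

/-- The length `|α|` of a multi-index. -/
def len {d : ℕ} (α : Fin d → ℕ) : ℕ := ∑ j, α j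

/-- `α! = α_1! ⋯ α_d!`. -/
def multiFactorial {d : ℕ} (α : Fin d → ℕ) : ℕ := ∏ j, (α j).factorial

/-- The symbol class `S^m(ℝ^d)`: smooth `f` on phase space such that every
`<ξ>^{|β| - m} |∂_x^α ∂_ξ^β f(x, ξ)|` is bounded. -/
def IsSymbol {d : ℕ} (m : ℝ) (f : Phase d → ℂ) : Prop :=
  ContDiff ℝ ∞ f ∧
    ∀ α β : Fin d → ℕ, ∃ C : ℝ, ∀ x ξ : Conf d,
      bracket ξ ^ ((len β : ℝ) - m) *
        ‖multiPow partialX α (multiPow partialXi β f) (x, ξ)‖ ≤ C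

/-- `f ∼ ∑_j f_j` with `f_j ∈ S^{μ_j}` and `μ_j ↘ -∞`. -/
def IsAsymptoticSum {d : ℕ} (μ : ℕ → ℝ) (fs : ℕ → Phase d → ℂ) (f : Phase d → ℂ) : Prop :=
  Antitone μ ∧ Filter.Tendsto μ Filter.atTop Filter.atBot ∧
    (∀ j, IsSymbol (μ j) (fs j)) ∧ IsSymbol (μ 0) f ∧
    ∀ k : ℕ, 1 ≤ k → IsSymbol (μ k) (fun p => f p - ∑ j ∈ Finset.range k, fs j p)

/-- The term of degree `j` of the series `∑_α (1/α!) c^{|α|} D_x^α ∂_ξ^α f`,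
that is, the sum over all multi-indices with `|α| = j`. -/
def seriesTerm {d : ℕ} (c : ℝ) (f : Phase d → ℂ) (j : ℕ) : Phase d → ℂ :=
  fun p => ∑ α ∈ Finset.piAntidiag (Finset.univ : Finset (Fin d)) j,
    (1 / (multiFactorial α : ℂ)) * (c : ℂ) ^ len α *
      multiPow dX α (multiPow partialXi α f) p

/-! ### Magnetic fields and vector potentials -/

/-- `BC^∞(ℝ^d)`: smooth functions that are bounded together with all their derivatives. -/
def IsBCInfty {d : ℕ} (f : Conf d → ℝ) : Prop :=
  ContDiff ℝ ∞ f ∧ ∀ n : ℕ, ∃ C : ℝ, ∀ x, ‖iteratedFDeriv ℝ n f x‖ ≤ C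

/-- The partial derivative `∂_j f` on configuration space. -/
def partialConf {d : ℕ} (j : Fin d) (f : Conf d → ℝ) : Conf d → ℝ :=
  fun x => fderiv ℝ f x (EuclideanSpace.single j 1)

/-- The matrix `(B_{jk})` of coefficients of a magnetic field: a closed two-form
`½ ∑ B_{jk} dx_j ∧ dx_k` with antisymmetric coefficients in `BC^∞`. -/
structure IsMagneticField {d : ℕ} (B : Fin d → Fin d → Conf d → ℝ) : Prop where
  bcInfty : ∀ j k, IsBCInfty (B j k)
  antisymm : ∀ j k x, B j k x = -B k j x
  closed : ∀ i j k x,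
    partialConf i (B j k) x + partialConf j (B k i) x + partialConf k (B i j) x = 0

/-- `A = ∑ A_j dx_j` is a vector potential for `B`: its coefficients are smooth with
polynomially bounded derivatives of all orders, and `dA = B`. -/
structure IsVectorPotential {d : ℕ} (A : Conf d → Conf d)
    (B : Fin d → Fin d → Conf d → ℝ) : Prop where
  temperate : Function.HasTemperateGrowth A
  dA_eq : ∀ j k x,
    partialConf j (fun y => A y k) x - partialConf k (fun y => A y j) x = B j k x

/-- `Γ^A(x, y) = ∫_0^1 A((1 - s)x + sy) ds`. -/
def gammaA {d : ℕ} (A : Conf d → Conf d) (x y : Conf d) : Conf d :=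
  ∫ s in (0 : ℝ)..1, A ((1 - s) • x + s • y)

/-- The circulation `∫_{[x,y]} A = -<x - y, Γ^A(x, y)>` of `A` along the segment from `x` to `y`. -/
def circulation {d : ℕ} (A : Conf d → Conf d) (x y : Conf d) : ℝ :=
  -inner ℝ (x - y) (gammaA A x y)

/-- `ω^A(x, y) = exp(-i ∫_{[x,y]} A)`. -/
def omegaA {d : ℕ} (A : Conf d → Conf d) (x y : Conf d) : ℂ :=
  Complex.exp (-Complex.I * (circulation A x y : ℂ))

/-! ### Oscillating integrals and the two quantizations -/

/-- `I` is the oscillating integral `∫∫ f(y, η) dy dη`: for every Schwartz cut-off `χ` with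
`χ(0) = 1` the functions `χ(εy, εη) f(y, η)` are integrable and their integrals tend to `I`
as `ε → 0+`. -/
def HasOscIntegral {d : ℕ} (f : Phase d → ℂ) (I : ℂ) : Prop :=
  ∀ χ : 𝓢(Phase d, ℂ), χ 0 = 1 →
    (∀ ε : ℝ, 0 < ε → MeasureTheory.Integrable (fun p => χ (ε • p) * f p)) ∧
    Filter.Tendsto (fun ε : ℝ => ∫ p, χ (ε • p) * f p)
      (nhdsWithin 0 (Set.Ioi 0)) (nhds I)

/-- `T` is the operator
`(Tu)(x) = ∫∫ e^{i<x-y,η>} ω^A(x,y) c(x,y,η) u(y) dy (2π)^{-d} dη` on the Schwartz space,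
with an oscillating integral. -/
def HasAmplitude {d : ℕ} (A : Conf d → Conf d) (c : Conf d → Conf d → Conf d → ℂ)
    (T : 𝓢(Conf d, ℂ) →L[ℂ] 𝓢(Conf d, ℂ)) : Prop :=
  ∀ (u : 𝓢(Conf d, ℂ)) (x : Conf d),
    HasOscIntegral (fun p : Phase d =>
      (((2 * Real.pi) ^ d)⁻¹ : ℝ) *
        (Complex.exp (Complex.I * (inner ℝ (x - p.1) p.2 : ℝ)) *
          omegaA A x p.1 * c x p.1 p.2 * u p.1)) (T u x)

/-- `T = Op^A(a)`, the magnetic Weyl quantization of `a`. -/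
def IsMagneticWeyl {d : ℕ} (A : Conf d → Conf d) (a : Phase d → ℂ)
    (T : 𝓢(Conf d, ℂ) →L[ℂ] 𝓢(Conf d, ℂ)) : Prop :=
  HasAmplitude A (fun x y η => a ((1 / 2 : ℝ) • (x + y), η)) T

/-- `T = b^A(x, D)`, the magnetic left quantization of `b`. -/
def IsMagneticLeft {d : ℕ} (A : Conf d → Conf d) (b : Phase d → ℂ)
    (T : 𝓢(Conf d, ℂ) →L[ℂ] 𝓢(Conf d, ℂ)) : Prop :=
  HasAmplitude A (fun x _ η => b (x, η)) T

end MagneticPsiDO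

end

noncomputable section
namespace MagneticPsiDO

open MeasureTheory Filter Topology

/-! ### Bounds on iterated derivatives -/

section DerivBound

variable {E E' V W X : Type*} [NormedAddCommGroup E] [NormedSpace ℝ E]
  [NormedAddCommGroup E'] [NormedSpace ℝ E'] [NormedAddCommGroup V] [NormedSpace ℝ V]
  [NormedAddCommGroup W] [NormedSpace ℝ W] [NormedAddCommGroup X] [NormedSpace ℝ X]

/-! The factor ω^A(x,y) does not involve η. For fixed x it can therefore be absorbed into the test
function: with v = ω^A(x,·)u, both quantizations become non-magnetic ones with amplitude a(x + τ(y -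
x), η), evaluated at x. The Weyl case is τ = 1/2 and the left case is τ = 0. What remains is the
classical change of τ: lowering τ by c replaces a by exp(c D_x·∂_ξ) a.

With y = x + z, this exponential is the shear (2π)^{-d} ∫∫ exp(-i⟨z,ζ⟩) a(x + sz, ξ + ζ) dz dζ.
Differentiating in s produces factors z_j, and integration by parts turns each of them into
-i∂_{ζ_j}. Hence ∂_s (`shear s a`) = `shear s (mixedOp a)` (`hasDerivAt_shear`), while `shear 0 a =
a` by Fourier inversion (`osc_snd`, `shear_zero`). Two consequences carry the theorem.

The integral defined by `quantAmp x v (τ - s) (shear s a)` has zero derivative in s: moving the base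
point creates -∑ z_j ∂_{x_j}, which after integration by parts cancels the generator of the shear
(`osc_quantAmpDeriv`, `osc_quantAmp_shear`). So the two quantizations agree.

Taylor's formula at s = 0 bounds the remainder after k terms by shears of the k-th power of D_x·∂_ξ
applied to a, which has order m - k (`exists_norm_shearRem_le`). The shear commutes with all
derivatives, so the same estimate gives every symbol seminorm (`symbolBound_shear_sub_taylorPart`).
The multinomial theorem rewrites the powers of D_x·∂_ξ as the series in the statement
(`seriesTerm_coe`).

The analytic base is an absolutely convergent definition of the oscillatory integral. The product of
exp(-i⟨z,ζ⟩) and F is convolved with a compactly supported window of mass one. At w the result is,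
up to a phase, a Fourier transform of a localized smooth function at a frequency comparable to w, so
it decays like any power of ‖w‖ that the derivatives of F pay for (`exists_norm_oscConv_le`). The
integral of the convolution depends continuously on F under pointwise limits with uniform bounds,
and equals the usual integral when F is integrable. Hence it is the limit of the regularizations by
every Schwartz cut-off (`tendsto_integral_cutoff`).

Continuity on the Schwartz space is proved only for left quantizations, whose x-derivatives and
products with x_j are again sums of left quantizations (`leftOpCLM`). The Weyl operator is the same
map. -/

/-- `F` is smooth and its derivatives of order at most `N` are bounded by the weight `ρ`. -/
def DerivBound (N : ℕ) (ρ : E → ℝ) (F : E → V) : Prop :=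
  ContDiff ℝ ∞ F ∧ ∀ n ≤ N, ∀ w, ‖iteratedFDeriv ℝ n F w‖ ≤ ρ w

lemma DerivBound.norm_le {N : ℕ} {ρ : E → ℝ} {F : E → V} (h : DerivBound N ρ F) (w : E) :
    ‖F w‖ ≤ ρ w := by
  simpa using h.2 0 (Nat.zero_le _) w

lemma DerivBound.nonneg {N : ℕ} {ρ : E → ℝ} {F : E → V} (h : DerivBound N ρ F) (w : E) :
    0 ≤ ρ w := (norm_nonneg _).trans (h.norm_le w)

lemma DerivBound.mono {N : ℕ} {ρ ρ' : E → ℝ} {F : E → V} (h : DerivBound N ρ F)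
    (hρ : ∀ w, ρ w ≤ ρ' w) : DerivBound N ρ' F :=
  ⟨h.1, fun n hn w => (h.2 n hn w).trans (hρ w)⟩

lemma DerivBound.mono_order {N N' : ℕ} {ρ : E → ℝ} {F : E → V} (h : DerivBound N ρ F)
    (hN : N' ≤ N) : DerivBound N' ρ F :=
  ⟨h.1, fun n hn w => h.2 n (hn.trans hN) w⟩

lemma DerivBound.add {N : ℕ} {ρ ρ' : E → ℝ} {F G : E → V} (h : DerivBound N ρ F)
    (h' : DerivBound N ρ' G) : DerivBound N (fun w => ρ w + ρ' w) (fun w => F w + G w) := by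
  refine ⟨h.1.add h'.1, fun n hn w => ?_⟩
  have e : iteratedFDeriv ℝ n (fun w => F w + G w) w =
      iteratedFDeriv ℝ n F w + iteratedFDeriv ℝ n G w :=
    congrFun (iteratedFDeriv_add (h.1.of_le (mod_cast le_top)) (h'.1.of_le (mod_cast le_top))) w
  rw [e]
  exact (norm_add_le _ _).trans (add_le_add (h.2 n hn w) (h'.2 n hn w))

lemma DerivBound.sum {ι : Type*} (s : Finset ι) {N : ℕ} {ρ : ι → E → ℝ} {F : ι → E → V}
    (h : ∀ i ∈ s, DerivBound N (ρ i) (F i)) :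
    DerivBound N (fun w => ∑ i ∈ s, ρ i w) (fun w => ∑ i ∈ s, F i w) := by
  classical
  induction s using Finset.induction_on with
  | empty =>
    simp only [Finset.sum_empty]
    refine ⟨contDiff_const, fun n _ w => ?_⟩
    have : iteratedFDeriv ℝ n (fun _ : E => (0 : V)) w = 0 := by
      have := iteratedFDeriv_fun_zero (𝕜 := ℝ) (E := E) (F := V) (n := n)
      exact congrFun this w
    simp [this]
  | insert a s ha ih =>
    simp only [Finset.sum_insert ha]
    exact (h a (by simp)).add (ih fun i hi => h i (by simp [hi]))

lemma DerivBound.bilin {N : ℕ} {ρ ρ' : E → ℝ} {F : E → V} {G : E → W}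
    (B : V →L[ℝ] W →L[ℝ] X) (h : DerivBound N ρ F) (h' : DerivBound N ρ' G) :
    DerivBound N (fun w => ‖B‖ * (2 ^ N * (ρ w * ρ' w))) (fun w => B (F w) (G w)) := by
  refine ⟨B.isBoundedBilinearMap.contDiff.comp (h.1.prodMk h'.1), fun n hn w => ?_⟩
  refine (B.norm_iteratedFDeriv_le_of_bilinear h.1 h'.1 w (n := n) (mod_cast le_top)).trans ?_
  refine mul_le_mul_of_nonneg_left ?_ (norm_nonneg B)
  calc _ ≤ ∑ i ∈ Finset.range (n + 1), (n.choose i : ℝ) * (ρ w * ρ' w) := by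
        refine Finset.sum_le_sum fun i hi => ?_
        rw [mul_assoc]
        have hi' : i ≤ n := by simpa [Nat.lt_succ_iff] using hi
        gcongr
        · exact h.nonneg w
        · exact h.2 i (hi'.trans hn) w
        · exact h'.2 _ ((Nat.sub_le _ _).trans hn) w
    _ = 2 ^ n * (ρ w * ρ' w) := by
        rw [← Finset.sum_mul, ← Nat.cast_sum, Nat.sum_range_choose]; simp
    _ ≤ _ := by
        gcongr
        · exact mul_nonneg (h.nonneg w) (h'.nonneg w)
        · norm_num

lemma DerivBound.clm {N : ℕ} {ρ : E → ℝ} {F : E → V} (L : V →L[ℝ] W) (h : DerivBound N ρ F) :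
    DerivBound N (fun w => ‖L‖ * ρ w) (fun w => L (F w)) := by
  refine ⟨L.contDiff.comp h.1, fun n hn w => ?_⟩
  refine (L.norm_iteratedFDeriv_comp_left (h.1.contDiffAt) (n := n) (mod_cast le_top)).trans ?_
  exact mul_le_mul_of_nonneg_left (h.2 n hn w) (norm_nonneg L)

/-- Each derivative costs a factor ‖L‖, so contractions cost nothing. This is what makes later
bounds uniform in the parameters s and ε. -/
lemma DerivBound.comp_affine {N : ℕ} {ρ : E → ℝ} {F : E → V} (h : DerivBound N ρ F)
    (p : E) (L : E' →L[ℝ] E) (hL : ‖L‖ ≤ 1) :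
    DerivBound N (fun w => ρ (p + L w)) (fun w => F (p + L w)) := by
  have hs : ContDiff ℝ ∞ (fun y => F (p + y)) := h.1.comp (contDiff_const.add contDiff_id)
  refine ⟨hs.comp L.contDiff, fun n hn w => ?_⟩
  have e := L.iteratedFDeriv_comp_right (f := fun y => F (p + y)) hs w (i := n) (mod_cast le_top)
  change ‖iteratedFDeriv ℝ n ((fun y => F (p + y)) ∘ L) w‖ ≤ _
  rw [e, iteratedFDeriv_comp_add_left]
  refine (ContinuousMultilinearMap.norm_compContinuousLinearMap_le _ _).trans ?_
  have h1 : ∏ _i : Fin n, ‖L‖ ≤ 1 := Finset.prod_le_one (fun _ _ => norm_nonneg _) fun _ _ => hL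
  calc _ ≤ ‖iteratedFDeriv ℝ n F (p + L w)‖ * 1 := by gcongr
    _ ≤ _ := by rw [mul_one]; exact h.2 n hn _

lemma DerivBound.fderiv {N : ℕ} {ρ : E → ℝ} {F : E → V} (h : DerivBound (N + 1) ρ F) :
    DerivBound N ρ (fderiv ℝ F) := by
  refine ⟨h.1.fderiv_right (by simp), fun n hn w => ?_⟩
  rw [norm_iteratedFDeriv_fderiv]
  exact h.2 _ (by omega) w

lemma derivBound_const (N : ℕ) (c : V) : DerivBound N (fun _ : E => ‖c‖) (fun _ => c) := by
  refine ⟨contDiff_const, fun n _ w => ?_⟩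
  rcases n with _ | n
  · simp
  · rw [iteratedFDeriv_const_of_ne (by omega)]; simp

lemma derivBound_clm (N : ℕ) (L : E →L[ℝ] V) :
    DerivBound N (fun w => ‖L‖ * (1 + ‖w‖)) L := by
  refine ⟨L.contDiff, fun n _ w => ?_⟩
  have h1 : ‖L‖ ≤ ‖L‖ * (1 + ‖w‖) :=
    le_mul_of_one_le_right (norm_nonneg _) (by linarith [norm_nonneg w])
  rcases n with _ | n
  · simp only [norm_iteratedFDeriv_zero]
    refine (L.le_opNorm w).trans ?_
    gcongr; linarith
  · rw [← norm_iteratedFDeriv_fderiv]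
    have : _root_.fderiv ℝ L = fun _ => L := by ext1 v; exact L.fderiv
    rw [this]
    exact ((derivBound_const n L).2 n le_rfl w).trans h1

lemma schwartz_derivBound (k N : ℕ) (u : 𝓢(E, V)) :
    DerivBound N (fun y => (2 ^ k * (Finset.Iic (k, N)).sup
      (fun m => SchwartzMap.seminorm ℝ m.1 m.2) u) * ((1 + ‖y‖) ^ k)⁻¹) u := by
  refine ⟨u.smooth ⊤, fun n hn y => ?_⟩
  beta_reduce
  rw [← div_eq_mul_inv, le_div_iff₀ (by positivity), mul_comm]
  exact SchwartzMap.one_add_le_sup_seminorm_apply (𝕜 := ℝ) (m := (k, N)) le_rfl hn u y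

end DerivBound

lemma one_add_norm_add_le {E : Type*} [NormedAddCommGroup E] (x y : E) :
    1 + ‖x + y‖ ≤ (1 + ‖x‖) * (1 + ‖y‖) := by
  nlinarith [norm_add_le x y, mul_nonneg (norm_nonneg x) (norm_nonneg y)]

/-! ### Oscillatory integrals with phase `-⟨z, ζ⟩` -/

variable {d : ℕ}

/-- The unimodular factor `exp (-i ⟨z, ζ⟩)`. -/
def phase (w : Phase d) : ℂ := Complex.exp (-(Complex.I * (inner ℝ w.1 w.2 : ℝ)))

lemma norm_phase (w : Phase d) : ‖phase w‖ = 1 := by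
  simp [phase, Complex.norm_exp]

lemma phase_contDiff : ContDiff ℝ ∞ (phase : Phase d → ℂ) := by
  unfold phase
  refine Complex.contDiff_exp.comp ?_
  refine ContDiff.neg (contDiff_const.mul (Complex.ofRealCLM.contDiff.comp ?_))
  exact contDiff_fst.inner ℝ contDiff_snd

lemma phase_continuous : Continuous (phase : Phase d → ℂ) := phase_contDiff.continuous

/-- A bump function on phase space. -/
def bump (d : ℕ) : ContDiffBump (0 : Phase d) := ⟨1, 2, one_pos, one_lt_two⟩

/-- A nonnegative, smooth, compactly supported function on phase space of integral one. -/
def window (w : Phase d) : ℝ := (bump d).normed volume w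

lemma window_contDiff : ContDiff ℝ ∞ (window : Phase d → ℝ) := (bump d).contDiff_normed

lemma window_hasCompactSupport : HasCompactSupport (window : Phase d → ℝ) :=
  (bump d).hasCompactSupport_normed

lemma integral_window : ∫ w : Phase d, window w = 1 := (bump d).integral_normed

lemma window_integrable : Integrable (window : Phase d → ℝ) := (bump d).integrable_normed

/-- The Schwartz function `window · phase`. -/
def windowPhase (d : ℕ) : 𝓢(Phase d, ℂ) :=
  HasCompactSupport.toSchwartzMap (f := fun w : Phase d => window w • phase w)
    (window_hasCompactSupport.smul_right) (window_contDiff.smul phase_contDiff)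

lemma windowPhase_apply (w : Phase d) : windowPhase d w = window w • phase w := rfl

variable {V W : Type*} [NormedAddCommGroup V] [NormedSpace ℂ V] [NormedAddCommGroup W]
  [NormedSpace ℂ W]

/-- The convolution of `phase • F` with the window. -/
def oscConv (F : Phase d → V) (w : Phase d) : V :=
  ∫ v, window v • (phase (w - v) • F (w - v))

/-- The oscillatory integral `∫∫ exp (-i ⟨z, ζ⟩) F (z, ζ) dz dζ`. -/
def osc (F : Phase d → V) : V := ∫ w, oscConv F w

/-- The bilinear form governing the first order part of the phase. -/
def phaseForm (d : ℕ) : Phase d →L[ℝ] Phase d →L[ℝ] ℝ :=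
  (-(2 * Real.pi)⁻¹ : ℝ) •
    ((innerSL ℝ).bilinearComp (ContinuousLinearMap.fst ℝ (Conf d) (Conf d))
        (ContinuousLinearMap.snd ℝ (Conf d) (Conf d)) +
      (innerSL ℝ).bilinearComp (ContinuousLinearMap.snd ℝ (Conf d) (Conf d))
        (ContinuousLinearMap.fst ℝ (Conf d) (Conf d)))

lemma phaseForm_apply (v w : Phase d) : phaseForm d v w =
    -(2 * Real.pi)⁻¹ * (inner ℝ v.1 w.2 + inner ℝ v.2 w.1) := by
  simp [phaseForm]
  ring

/-- The phase is quadratic: the diagonal terms of ⟨z - z', ζ - ζ'⟩ split off and the cross terms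
form a character in v with frequency w. The factor (2π)⁻¹ in `phaseForm` matches the normalization
of `Real.fourierChar`. -/
lemma phase_sub (w v : Phase d) : phase (w - v) =
    phase w * ((Real.fourierChar (-(phaseForm d v w)) : ℂ) * phase v) := by
  rw [phase, phase, phase, Real.fourierChar_apply, phaseForm_apply, ← Complex.exp_add,
    ← Complex.exp_add]
  congr 1
  have hpi : (Real.pi : ℂ) ≠ 0 := by exact_mod_cast Real.pi_ne_zero
  simp only [Prod.fst_sub, Prod.snd_sub, inner_sub_left, inner_sub_right]
  rw [real_inner_comm w.1 v.2]
  push_cast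
  field_simp
  ring

/-- Through `phase_sub` the convolution becomes a Fourier transform at frequency w of F localized
near w, so smoothness of F yields decay in w. -/
lemma oscConv_eq_fourier (F : Phase d → V) (w : Phase d) : oscConv F w =
    phase w • VectorFourier.fourierIntegral Real.fourierChar volume
      (phaseForm d).toLinearMap₁₂ (fun v => windowPhase d v • F (w - v)) w := by
  rw [VectorFourier.fourierIntegral, ← integral_smul, oscConv]
  congr 1 with v
  rw [phase_sub, windowPhase_apply, Circle.smul_def, ← Complex.coe_smul (window v),
    ← Complex.coe_smul (window v)]
  simp only [smul_smul, smul_eq_mul]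
  congr 1
  change _ = phase w * ((Real.fourierChar (-(phaseForm d v w)) : ℂ) * (window v * phase v))
  ring

instance : (volume : Measure (Phase d)).IsAddHaarMeasure :=
  inferInstanceAs ((volume : Measure (Conf d)).prod (volume : Measure (Conf d))).IsAddHaarMeasure

lemma finrank_phase : Module.finrank ℝ (Phase d) = 2 * d := by
  simp [two_mul]

lemma integrable_one_add_norm_pow (k : ℕ) (hk : 2 * d < k) :
    Integrable (fun v : Phase d => ((1 + ‖v‖) ^ k)⁻¹) := by
  have := integrable_one_add_norm (E := Phase d) (μ := volume) (r := k)
    (by rw [finrank_phase]; exact_mod_cast hk)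
  refine this.congr (Eventually.of_forall fun v => ?_)
  simp [Real.rpow_neg (by positivity : 0 ≤ 1 + ‖v‖)]

/-- The order of derivatives needed to define the oscillatory integral of a function with
growth of order `p`. -/
def oscOrder (d p : ℕ) : ℕ := p + (2 * d + 1)

/-- The weight `C (1 + ‖w‖) ^ p`. -/
def growth (p : ℕ) (C : ℝ) (w : Phase d) : ℝ := C * (1 + ‖w‖) ^ p

/-- The growth of F at w - v splits as (1 + ‖w‖)^p (1 + ‖v‖)^p. The rapid decay of `windowPhase`
absorbs the second factor and leaves an integrable weight. The constant depends neither on F nor on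
w. -/
lemma derivBound_smul_shift (p N : ℕ) : ∃ C₀ : ℝ, 0 ≤ C₀ ∧ ∀ (C : ℝ) (F : Phase d → V),
    DerivBound N (growth p C) F → ∀ w : Phase d,
    DerivBound N (fun v => C₀ * (C * (1 + ‖w‖) ^ p) * ((1 + ‖v‖) ^ (2 * d + 1))⁻¹)
      (fun v => windowPhase d v • F (w - v)) := by
  obtain ⟨S, hS⟩ : ∃ S, S = 2 ^ (p + (2 * d + 1)) * (Finset.Iic (p + (2 * d + 1), N)).sup
      (fun m => SchwartzMap.seminorm ℝ m.1 m.2) (windowPhase d) := ⟨_, rfl⟩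
  have hψ := schwartz_derivBound (p + (2 * d + 1)) N (windowPhase d)
  rw [← hS] at hψ
  have hS0 : 0 ≤ S := by
    have := hψ.nonneg 0
    simpa using this
  set B : ℂ →L[ℝ] V →L[ℝ] V := ContinuousLinearMap.lsmul ℝ ℂ with hB
  refine ⟨‖B‖ * (2 ^ N * S), by positivity, fun C F hF w => ?_⟩
  have h1 := hF.comp_affine w (-(ContinuousLinearMap.id ℝ (Phase d)))
    (by rw [norm_neg]; exact ContinuousLinearMap.norm_id_le)
  have h2 := hψ.bilin B h1
  have hC : 0 ≤ C := by
    have := hF.nonneg 0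
    simpa [growth] using this
  have h3 := h2.mono (ρ' := fun v => ‖B‖ * (2 ^ N * S) * (C * (1 + ‖w‖) ^ p) *
      ((1 + ‖v‖) ^ (2 * d + 1))⁻¹) (fun v => by
    simp only [growth]
    have e : (1 + ‖w + (-(ContinuousLinearMap.id ℝ (Phase d))) v‖) ^ p ≤
        (1 + ‖w‖) ^ p * (1 + ‖v‖) ^ p := by
      rw [← mul_pow]
      gcongr
      have := one_add_norm_add_le w (-v)
      simpa using this
    calc _ ≤ ‖B‖ * (2 ^ N * (S * ((1 + ‖v‖) ^ (p + (2 * d + 1)))⁻¹ *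
          (C * ((1 + ‖w‖) ^ p * (1 + ‖v‖) ^ p)))) := by gcongr
      _ = _ := by
        rw [pow_add]
        have : (1 + ‖v‖) ^ p ≠ 0 := by positivity
        field_simp)
  simpa [hB, sub_eq_add_neg] using h3

/-- Nondegeneracy of the form: pairing w = (z, ζ) with the swapped vector (ζ, z) gives |z|² + |ζ|²
up to the factor. The swapped vector is the direction of differentiation in the decay estimate. -/
lemma norm_sq_le_phaseForm (w : Phase d) :
    ‖w‖ ^ 2 * (2 * Real.pi)⁻¹ ≤ |phaseForm d (w.2, w.1) w| := by
  rw [phaseForm_apply]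
  simp only [real_inner_self_eq_norm_sq]
  rw [abs_mul, abs_neg, abs_of_nonneg (by positivity : (0 : ℝ) ≤ (2 * Real.pi)⁻¹),
    abs_of_nonneg (by positivity), mul_comm]
  gcongr
  rw [Prod.norm_def]
  rcases max_cases ‖w.1‖ ‖w.2‖ with h | h <;> rw [h.1] <;> nlinarith [sq_nonneg ‖w.1‖, sq_nonneg ‖w.2‖]

lemma one_add_pow_le (x : ℝ) (hx : 0 ≤ x) (n : ℕ) : (1 + x) ^ n ≤ 2 ^ n * (1 + x ^ n) := by
  rcases le_total x 1 with h | h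
  · calc (1 + x) ^ n ≤ 2 ^ n := by gcongr; linarith
      _ ≤ _ := le_mul_of_one_le_right (by positivity) (by linarith [pow_nonneg hx n])
  · calc (1 + x) ^ n ≤ (2 * x) ^ n := by gcongr; linarith
      _ = 2 ^ n * x ^ n := mul_pow _ _ _
      _ ≤ _ := by gcongr; linarith

/-- The Fourier estimate yields ‖w‖^{2N} on the left and ‖w‖^N on the right; one power ‖w‖^N
cancels. The cases N = 0 and x = 0, where cancellation is unavailable, are treated apart. -/
lemma pow_mul_le_of_sq_le {x t q R : ℝ} {N : ℕ} (hx : 0 ≤ x) (ht : 0 ≤ t) (hR : 0 ≤ R)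
    (hq : x ^ 2 * (2 * Real.pi)⁻¹ ≤ q) (key : q ^ N * t ≤ x ^ N * R) (h0 : N = 0 → t ≤ R) :
    x ^ N * t ≤ (2 * Real.pi) ^ N * R := by
  rcases Nat.eq_zero_or_pos N with hN0 | hN0
  · subst hN0; simpa using h0 rfl
  rcases eq_or_lt_of_le hx with hx0 | hx0
  · rw [← hx0, zero_pow hN0.ne', zero_mul]; positivity
  · have h2 : x ^ N * (x ^ N * t) ≤ x ^ N * ((2 * Real.pi) ^ N * R) := by
      calc x ^ N * (x ^ N * t) = (2 * Real.pi) ^ N * ((x ^ 2 * (2 * Real.pi)⁻¹) ^ N * t) := by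
            rw [mul_pow (x ^ 2), inv_pow, ← pow_mul, mul_comm 2 N, pow_mul]
            have : (2 * Real.pi) ^ N ≠ 0 := by positivity
            field_simp
        _ ≤ (2 * Real.pi) ^ N * (q ^ N * t) := by gcongr
        _ ≤ (2 * Real.pi) ^ N * (x ^ N * R) := by gcongr
        _ = _ := by ring
    exact le_of_mul_le_mul_left h2 (by positivity)

lemma DerivBound.integrable_iteratedFDeriv {N : ℕ} {M : ℝ} {Φ : Phase d → V}
    (hb : DerivBound N (fun v => M * ((1 + ‖v‖) ^ (2 * d + 1))⁻¹) Φ) {n : ℕ} (hn : n ≤ N) :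
    Integrable (fun v => ‖iteratedFDeriv ℝ n Φ v‖) := by
  refine ((integrable_one_add_norm_pow (d := d) (2 * d + 1) (by omega)).const_mul M).mono'
    (hb.1.continuous_iteratedFDeriv (m := n) (mod_cast le_top)).norm.aestronglyMeasurable
    (Eventually.of_forall fun v => ?_)
  rw [norm_norm]
  exact hb.2 n hn v

/-- The integral of `(1 + ‖v‖) ^ (-2d - 1)` over phase space. -/
def bracketIntegral (d : ℕ) : ℝ := ∫ v : Phase d, ((1 + ‖v‖) ^ (2 * d + 1))⁻¹

lemma bracketIntegral_nonneg : 0 ≤ bracketIntegral d := integral_nonneg fun v => by positivity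

lemma DerivBound.integral_iteratedFDeriv_le {N : ℕ} {M : ℝ} {Φ : Phase d → V}
    (hb : DerivBound N (fun v => M * ((1 + ‖v‖) ^ (2 * d + 1))⁻¹) Φ) {n : ℕ} (hn : n ≤ N) :
    ∫ v, ‖iteratedFDeriv ℝ n Φ v‖ ≤ M * bracketIntegral d := by
  rw [bracketIntegral, ← integral_const_mul]
  exact integral_mono (hb.integrable_iteratedFDeriv hn)
    ((integrable_one_add_norm_pow (d := d) (2 * d + 1) (by omega)).const_mul M)
    fun v => hb.2 n hn v

lemma DerivBound.pow_mul_norm_fourier_le {N : ℕ} {M : ℝ} {Φ : Phase d → V}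
    (hb : DerivBound N (fun v => M * ((1 + ‖v‖) ^ (2 * d + 1))⁻¹) Φ) (w : Phase d) :
    |phaseForm d (w.2, w.1) w| ^ N * ‖VectorFourier.fourierIntegral Real.fourierChar volume
      (phaseForm d).toLinearMap₁₂ Φ w‖ ≤
      ‖w‖ ^ N * (2 ^ N * ((N + 1) * (M * bracketIntegral d))) := by
  -- With K = 0 and k = 0 nothing is differentiated on the Fourier side: only the N integrations by
  -- parts in the direction (w.2, w.1) are used.
  have key := VectorFourier.pow_mul_norm_iteratedFDeriv_fourierIntegral_le (phaseForm d)
    (μ := volume) (f := Φ) (K := 0) (N := N) (k := 0) (n := N)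
    (hb.1.of_le (mod_cast le_top)) (fun k n hk hn => by
      have hk0 : k = 0 := by simpa using hk
      subst hk0
      simpa using hb.integrable_iteratedFDeriv (by exact_mod_cast hn)) le_rfl le_rfl (w.2, w.1) w
  rw [norm_iteratedFDeriv_zero] at key
  refine key.trans ?_
  have hsw : ‖((w.2, w.1) : Phase d)‖ = ‖w‖ := by simp [Prod.norm_def, max_comm]
  rw [hsw, mul_assoc, mul_assoc, pow_zero, one_mul, Nat.cast_zero, mul_zero, zero_add]
  refine mul_le_mul_of_nonneg_left (mul_le_mul_of_nonneg_left ?_ (by positivity)) (by positivity)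
  calc _ ≤ ∑ q ∈ Finset.range (0 + 1) ×ˢ Finset.range (N + 1), M * bracketIntegral d := by
        refine Finset.sum_le_sum fun q hq => ?_
        simp only [Finset.mem_product, Finset.mem_range, Nat.lt_one_iff, zero_add] at hq
        simp only [hq.1, pow_zero, one_mul]
        exact hb.integral_iteratedFDeriv_le (by omega)
    _ = _ := by simp

lemma DerivBound.norm_fourier_le {N : ℕ} {M : ℝ} {Φ : Phase d → V}
    (hb : DerivBound N (fun v => M * ((1 + ‖v‖) ^ (2 * d + 1))⁻¹) Φ) (w : Phase d) :
    ‖VectorFourier.fourierIntegral Real.fourierChar volume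
      (phaseForm d).toLinearMap₁₂ Φ w‖ * (1 + ‖w‖) ^ N ≤
      2 ^ N * (1 + (2 * Real.pi) ^ N * (2 ^ N * (N + 1))) * (M * bracketIntegral d) := by
  have hzero : ‖VectorFourier.fourierIntegral Real.fourierChar volume
      (phaseForm d).toLinearMap₁₂ Φ w‖ ≤ M * bracketIntegral d := by
    refine (VectorFourier.norm_fourierIntegral_le_integral_norm _ _ _ _ _).trans ?_
    simpa using hb.integral_iteratedFDeriv_le (Nat.zero_le _)
  have key := hb.pow_mul_norm_fourier_le w
  have ht := norm_nonneg (VectorFourier.fourierIntegral Real.fourierChar volume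
      (phaseForm d).toLinearMap₁₂ Φ w)
  generalize ‖VectorFourier.fourierIntegral Real.fourierChar volume
      (phaseForm d).toLinearMap₁₂ Φ w‖ = t at *
  generalize M * bracketIntegral d = S at *
  have hS := ht.trans hzero
  have h2 := pow_mul_le_of_sq_le (norm_nonneg w) ht (by positivity)
    (norm_sq_le_phaseForm w) key (by rintro rfl; simpa using hzero)
  calc t * (1 + ‖w‖) ^ N ≤ t * (2 ^ N * (1 + ‖w‖ ^ N)) := by
        gcongr; exact one_add_pow_le _ (norm_nonneg _) _
    _ = 2 ^ N * (t + ‖w‖ ^ N * t) := by ring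
    _ ≤ 2 ^ N * (S + (2 * Real.pi) ^ N * (2 ^ N * ((N + 1) * S))) := by gcongr
    _ = _ := by ring

/-- Decay of the convolution `oscConv F`. -/
lemma exists_norm_oscConv_le (d p N : ℕ) (V : Type*) [NormedAddCommGroup V] [NormedSpace ℂ V] :
    ∃ C₀ : ℝ, 0 ≤ C₀ ∧ ∀ (C : ℝ) (F : Phase d → V),
    DerivBound N (growth p C) F → ∀ w : Phase d,
      ‖oscConv F w‖ * (1 + ‖w‖) ^ N ≤ C₀ * (C * (1 + ‖w‖) ^ p) := by
  obtain ⟨C₁, hC₁, h₁⟩ := derivBound_smul_shift (d := d) (V := V) p N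
  have hI := bracketIntegral_nonneg (d := d)
  refine ⟨2 ^ N * (1 + (2 * Real.pi) ^ N * (2 ^ N * (N + 1))) * (C₁ * bracketIntegral d),
    by positivity, fun C F hF w => ?_⟩
  have hosc := oscConv_eq_fourier F w
  rw [hosc, norm_smul, norm_phase, one_mul]
  refine ((h₁ C F hF w).norm_fourier_le w).trans (le_of_eq ?_)
  ring

end MagneticPsiDO
end

/-! ### Bounds, linearity, limits and parameter derivatives of oscillatory integrals -/

noncomputable section
namespace MagneticPsiDO

open MeasureTheory Filter Topology

variable {d : ℕ} {V W : Type*} [NormedAddCommGroup V] [NormedSpace ℂ V] [NormedAddCommGroup W]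
  [NormedSpace ℂ W]

lemma DerivBound.const_nonneg {N p : ℕ} {C : ℝ} {F : Phase d → V}
    (h : DerivBound N (growth p C) F) : 0 ≤ C := by
  have := h.nonneg 0
  simpa [growth] using this

/-- This explains `oscOrder`: p derivatives compensate the growth of F, and 2d + 1 more give a
weight integrable over the 2d-dimensional phase space. -/
lemma exists_norm_oscConv_le_bracket (d p : ℕ) (V : Type*) [NormedAddCommGroup V]
    [NormedSpace ℂ V] :
    ∃ C₀ : ℝ, 0 ≤ C₀ ∧ ∀ (C : ℝ) (F : Phase d → V),
    DerivBound (oscOrder d p) (growth p C) F → ∀ w : Phase d,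
      ‖oscConv F w‖ ≤ C₀ * C * ((1 + ‖w‖) ^ (2 * d + 1))⁻¹ := by
  obtain ⟨C₀, hC₀, h⟩ := exists_norm_oscConv_le d p (oscOrder d p) V
  refine ⟨C₀, hC₀, fun C F hF w => ?_⟩
  have h1 := h C F hF w
  rw [oscOrder, pow_add] at h1
  rw [← div_eq_mul_inv, le_div_iff₀ (by positivity)]
  have hp : 0 < (1 + ‖w‖) ^ p := by positivity
  refine le_of_mul_le_mul_right ?_ hp
  calc _ = ‖oscConv F w‖ * ((1 + ‖w‖) ^ p * (1 + ‖w‖) ^ (2 * d + 1)) := by ring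
    _ ≤ _ := h1
    _ = _ := by ring

lemma integrable_bracket : Integrable (fun w : Phase d => ((1 + ‖w‖) ^ (2 * d + 1))⁻¹) :=
  integrable_one_add_norm_pow _ (by omega)

lemma continuous_oscConv_integrand {F : Phase d → V} (hF : Continuous F) :
    Continuous (fun q : Phase d × Phase d =>
      window q.2 • (phase (q.1 - q.2) • F (q.1 - q.2))) := by
  have h1 : Continuous (window : Phase d → ℝ) := window_contDiff.continuous
  have h2 : Continuous (phase : Phase d → ℂ) := phase_continuous
  fun_prop

lemma aestronglyMeasurable_oscConv {F : Phase d → V} (hF : Continuous F) :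
    AEStronglyMeasurable (oscConv F) (volume : Measure (Phase d)) :=
  ((continuous_oscConv_integrand hF).aestronglyMeasurable
    (μ := (volume : Measure (Phase d)).prod volume)).integral_prod_right'

lemma integrable_oscConv_integrand {F : Phase d → V} (hF : Continuous F) (w : Phase d) :
    Integrable (fun v => window v • (phase (w - v) • F (w - v))) := by
  refine Continuous.integrable_of_hasCompactSupport ?_ window_hasCompactSupport.smul_right
  have h1 : Continuous (window : Phase d → ℝ) := window_contDiff.continuous
  have h2 : Continuous (phase : Phase d → ℂ) := phase_continuous
  fun_prop

lemma integrable_oscConv {p : ℕ} {C : ℝ} {F : Phase d → V}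
    (hF : DerivBound (oscOrder d p) (growth p C) F) : Integrable (oscConv F) := by
  obtain ⟨C₀, -, h⟩ := exists_norm_oscConv_le_bracket d p V
  exact (integrable_bracket.const_mul (C₀ * C)).mono'
    (aestronglyMeasurable_oscConv hF.1.continuous) (Eventually.of_forall (h C F hF))

lemma exists_norm_osc_le (d p : ℕ) (V : Type*) [NormedAddCommGroup V] [NormedSpace ℂ V] :
    ∃ C₀ : ℝ, 0 ≤ C₀ ∧ ∀ (C : ℝ) (F : Phase d → V),
    DerivBound (oscOrder d p) (growth p C) F → ‖osc F‖ ≤ C₀ * C := by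
  obtain ⟨C₀, hC₀, h⟩ := exists_norm_oscConv_le_bracket d p V
  have hI := bracketIntegral_nonneg (d := d)
  refine ⟨C₀ * bracketIntegral d, by positivity, fun C F hF => ?_⟩
  have := norm_integral_le_of_norm_le (integrable_bracket.const_mul (C₀ * C))
    (Eventually.of_forall (h C F hF))
  rw [integral_const_mul] at this
  refine this.trans (le_of_eq ?_)
  rw [bracketIntegral]; ring

lemma oscConv_add {F G : Phase d → V} (hF : Continuous F) (hG : Continuous G) (w : Phase d) :
    oscConv (fun w => F w + G w) w = oscConv F w + oscConv G w := by
  simp only [oscConv, smul_add]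
  exact integral_add (integrable_oscConv_integrand hF w) (integrable_oscConv_integrand hG w)

lemma osc_add {p : ℕ} {C C' : ℝ} {F G : Phase d → V}
    (hF : DerivBound (oscOrder d p) (growth p C) F)
    (hG : DerivBound (oscOrder d p) (growth p C') G) :
    osc (fun w => F w + G w) = osc F + osc G := by
  simp only [osc, oscConv_add hF.1.continuous hG.1.continuous]
  exact integral_add (integrable_oscConv hF) (integrable_oscConv hG)

lemma osc_clm [CompleteSpace V] [CompleteSpace W] {p : ℕ} {C : ℝ} {F : Phase d → V}
    (L : V →L[ℂ] W) (hF : DerivBound (oscOrder d p) (growth p C) F) :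
    osc (fun w => L (F w)) = L (osc F) := by
  have h1 : oscConv (fun w => L (F w)) = fun w => L (oscConv F w) := by
    ext w
    rw [oscConv, oscConv, ← L.integral_comp_comm (integrable_oscConv_integrand hF.1.continuous w)]
    congr 1 with v
    rw [← Complex.coe_smul, ← Complex.coe_smul, map_smul, map_smul]
  rw [osc, h1, osc, L.integral_comp_comm (integrable_oscConv hF)]

lemma osc_smul [CompleteSpace V] {p : ℕ} {C : ℝ} {F : Phase d → V} (c : ℂ)
    (hF : DerivBound (oscOrder d p) (growth p C) F) :
    osc (fun w => c • F w) = c • osc F := by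
  simpa using osc_clm (c • ContinuousLinearMap.id ℂ V) hF

/-- Dominated convergence is used twice, inside the window convolution and in the outer integral.
Uniform derivative bounds dominate, so pointwise convergence of the amplitudes themselves suffices.
-/
lemma tendsto_osc {ι : Type*} {l : Filter ι} [l.IsCountablyGenerated] {p : ℕ} {C : ℝ}
    {F : ι → Phase d → V} {G : Phase d → V}
    (hF : ∀ᶠ i in l, DerivBound (oscOrder d p) (growth p C) (F i))
    (hlim : ∀ w, Tendsto (fun i => F i w) l (𝓝 (G w))) :
    Tendsto (fun i => osc (F i)) l (𝓝 (osc G)) := by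
  obtain ⟨C₀, -, h⟩ := exists_norm_oscConv_le_bracket d p V
  refine tendsto_integral_filter_of_dominated_convergence
    (fun w => C₀ * C * ((1 + ‖w‖) ^ (2 * d + 1))⁻¹) ?_ ?_ (integrable_bracket.const_mul _) ?_
  · filter_upwards [hF] with i hi using aestronglyMeasurable_oscConv hi.1.continuous
  · filter_upwards [hF] with i hi using Eventually.of_forall (h C _ hi)
  · refine Eventually.of_forall fun w => ?_
    refine tendsto_integral_filter_of_dominated_convergence
      (fun v => window v * growth p C (w - v)) ?_ ?_ ?_ ?_
    · filter_upwards [hF] with i hi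
      exact (integrable_oscConv_integrand hi.1.continuous w).1
    · filter_upwards [hF] with i hi
      refine Eventually.of_forall fun v => ?_
      have hw : 0 ≤ window v := (bump d).nonneg_normed v
      rw [norm_smul, norm_smul, norm_phase, one_mul, Real.norm_of_nonneg hw]
      gcongr
      exact hi.norm_le _
    · refine Continuous.integrable_of_hasCompactSupport ?_ window_hasCompactSupport.mul_right
      have h1 : Continuous (window : Phase d → ℝ) := window_contDiff.continuous
      unfold growth
      fun_prop
    · exact Eventually.of_forall fun v => ((hlim _).const_smul _).const_smul _

/-- Differentiation of an oscillatory integral with respect to a parameter. -/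
lemma hasFDerivAt_osc {H : Type*} [NormedAddCommGroup H] [NormedSpace ℝ H] {p : ℕ} {C : ℝ}
    {F : H → Phase d → V} {F' : H → Phase d → H →L[ℝ] V} {s : Set H} {θ : H} (hs : s ∈ 𝓝 θ)
    (hF : ∀ t ∈ s, DerivBound (oscOrder d p) (growth p C) (F t))
    (hF' : ∀ t ∈ s, DerivBound (oscOrder d p) (growth p C) (F' t))
    (hd : ∀ t ∈ s, ∀ w, HasFDerivAt (fun t => F t w) (F' t w) t) :
    HasFDerivAt (fun t => osc (F t)) (osc (F' θ)) θ := by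
  obtain ⟨C₀, -, h⟩ := exists_norm_oscConv_le_bracket d p (H →L[ℝ] V)
  have hθ : θ ∈ s := mem_of_mem_nhds hs
  -- The outer differentiation needs the inner derivative at all t near θ, not only at θ; every
  -- point of the interior has s as a neighbourhood.
  have hopen : ∀ t ∈ interior s, ∀ w,
      HasFDerivAt (fun t => oscConv (F t) w) (oscConv (F' t) w) t := by
    intro t ht w
    have hs' : s ∈ 𝓝 t := mem_interior_iff_mem_nhds.mp ht
    have hts : t ∈ s := interior_subset ht
    refine hasFDerivAt_integral_of_dominated_of_fderiv_le (𝕜 := ℝ)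
      (F := fun t v => window v • (phase (w - v) • F t (w - v)))
      (F' := fun t v => window v • (phase (w - v) • F' t (w - v)))
      (bound := fun v => window v * growth p C (w - v)) hs' ?_ ?_ ?_ ?_ ?_ ?_
    · filter_upwards [hs'] with t' ht'
      exact (integrable_oscConv_integrand (hF t' ht').1.continuous w).1
    · exact integrable_oscConv_integrand (hF t hts).1.continuous w
    · exact (integrable_oscConv_integrand (hF' t hts).1.continuous w).1
    · refine Eventually.of_forall fun v t' ht' => ?_
      have hw : 0 ≤ window v := (bump d).nonneg_normed v
      rw [norm_smul, norm_smul, norm_phase, one_mul, Real.norm_of_nonneg hw]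
      gcongr
      exact (hF' t' ht').norm_le _
    · refine Continuous.integrable_of_hasCompactSupport ?_ window_hasCompactSupport.mul_right
      have h1 : Continuous (window : Phase d → ℝ) := window_contDiff.continuous
      unfold growth
      fun_prop
    · exact Eventually.of_forall fun v t' ht' =>
        ((hd t' ht' _).const_smul _).const_smul _
  refine hasFDerivAt_integral_of_dominated_of_fderiv_le (𝕜 := ℝ)
      (F := fun t => oscConv (F t)) (F' := fun t => oscConv (F' t))
      (bound := fun w => C₀ * C * ((1 + ‖w‖) ^ (2 * d + 1))⁻¹)
      (interior_mem_nhds.mpr hs) ?_ ?_ ?_ ?_ ?_ ?_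
  · filter_upwards [hs] with t ht using aestronglyMeasurable_oscConv (hF t ht).1.continuous
  · exact integrable_oscConv (hF θ hθ)
  · exact aestronglyMeasurable_oscConv (hF' θ hθ).1.continuous
  · exact Eventually.of_forall fun w t ht => h C _ (hF' t (interior_subset ht)) w
  · exact integrable_bracket.const_mul _
  · exact Eventually.of_forall fun w t ht => hopen t ht w

/-- The integral of a convolution is the product of the integrals, and the window has mass one. -/
lemma osc_eq_integral [CompleteSpace V] {F : Phase d → V} (hF : Integrable F) :
    osc F = ∫ w, phase w • F w := by
  have hint : Integrable (fun w => phase w • F w) := by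
    refine hF.bdd_smul 1 phase_continuous.aestronglyMeasurable
      (Eventually.of_forall fun w => (norm_phase w).le)
  have := integral_convolution (ContinuousLinearMap.lsmul ℝ ℝ)
    (window_integrable (d := d)) hint
  simp only [ContinuousLinearMap.lsmul_apply, integral_window, one_smul] at this
  exact this

end MagneticPsiDO
end

/-! ### Amplitudes, regularization by cut-offs and integration by parts -/

noncomputable section
namespace MagneticPsiDO

open MeasureTheory Filter Topology

variable {d : ℕ} {V W : Type*} [NormedAddCommGroup V] [NormedSpace ℂ V] [NormedAddCommGroup W]
  [NormedSpace ℂ W]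

/-- Smooth functions all of whose derivatives grow at most like `(1 + ‖w‖) ^ p`. -/
def IsOscAmp (p : ℕ) (F : Phase d → V) : Prop := ∀ N, ∃ C, DerivBound N (growth p C) F

lemma IsOscAmp.contDiff {p : ℕ} {F : Phase d → V} (h : IsOscAmp p F) : ContDiff ℝ ∞ F :=
  let ⟨_, hC⟩ := h 0; hC.1

lemma growth_le_growth {p q : ℕ} (hpq : p ≤ q) {C : ℝ} (hC : 0 ≤ C) (w : Phase d) :
    growth p C w ≤ growth q C w := by
  unfold growth
  gcongr
  linarith [norm_nonneg w]

lemma DerivBound.growth_mono {N p q : ℕ} {C : ℝ} {F : Phase d → V}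
    (h : DerivBound N (growth p C) F) (hpq : p ≤ q) : DerivBound N (growth q C) F :=
  h.mono (growth_le_growth hpq h.const_nonneg)

lemma IsOscAmp.mono {p q : ℕ} {F : Phase d → V} (h : IsOscAmp p F) (hpq : p ≤ q) :
    IsOscAmp q F := fun N => let ⟨C, hC⟩ := h N; ⟨C, hC.growth_mono hpq⟩

lemma IsOscAmp.add {p : ℕ} {F G : Phase d → V} (h : IsOscAmp p F) (h' : IsOscAmp p G) :
    IsOscAmp p (fun w => F w + G w) := fun N => by
  obtain ⟨C, hC⟩ := h N
  obtain ⟨C', hC'⟩ := h' N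
  exact ⟨C + C', (hC.add hC').mono fun w => by simp only [growth]; rw [add_mul]⟩

lemma osc_add' {p : ℕ} {F G : Phase d → V} (h : IsOscAmp p F) (h' : IsOscAmp p G) :
    osc (fun w => F w + G w) = osc F + osc G := by
  obtain ⟨C, hC⟩ := h (oscOrder d p)
  obtain ⟨C', hC'⟩ := h' (oscOrder d p)
  exact osc_add hC hC'

lemma IsOscAmp.clm {p : ℕ} {F : Phase d → V} (h : IsOscAmp p F) (L : V →L[ℝ] W) :
    IsOscAmp p (fun w => L (F w)) := fun N => by
  obtain ⟨C, hC⟩ := h N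
  exact ⟨‖L‖ * C, (hC.clm L).mono fun w => by simp only [growth]; rw [mul_assoc]⟩

lemma osc_clm' [CompleteSpace V] [CompleteSpace W] {p : ℕ} {F : Phase d → V} (L : V →L[ℂ] W)
    (h : IsOscAmp p F) : osc (fun w => L (F w)) = L (osc F) := by
  obtain ⟨C, hC⟩ := h (oscOrder d p)
  exact osc_clm L hC

lemma osc_smul' [CompleteSpace V] {p : ℕ} {F : Phase d → V} (c : ℂ)
    (h : IsOscAmp p F) : osc (fun w => c • F w) = c • osc F := by
  obtain ⟨C, hC⟩ := h (oscOrder d p)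
  exact osc_smul c hC

lemma IsOscAmp.const_smul {p : ℕ} {F : Phase d → V} (h : IsOscAmp p F) (c : ℂ) :
    IsOscAmp p (fun w => c • F w) := by
  simpa using h.clm ((c • ContinuousLinearMap.id ℂ V).restrictScalars ℝ)

lemma isOscAmp_zero (p : ℕ) : IsOscAmp p (fun _ : Phase d => (0 : V)) := fun N =>
  ⟨0, (derivBound_const N (0 : V)).mono fun w => by simp [growth]⟩

lemma osc_zero : osc (fun _ : Phase d => (0 : V)) = 0 := by
  simp [osc, oscConv]

lemma IsOscAmp.sum {ι : Type*} (s : Finset ι) {p : ℕ} {F : ι → Phase d → V}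
    (h : ∀ i ∈ s, IsOscAmp p (F i)) : IsOscAmp p (fun w => ∑ i ∈ s, F i w) := by
  classical
  induction s using Finset.induction_on with
  | empty => simpa using isOscAmp_zero p
  | insert a s ha ih =>
    simp only [Finset.sum_insert ha]
    exact (h a (by simp)).add (ih fun i hi => h i (by simp [hi]))

lemma osc_sum {ι : Type*} (s : Finset ι) {p : ℕ} {F : ι → Phase d → V}
    (h : ∀ i ∈ s, IsOscAmp p (F i)) : osc (fun w => ∑ i ∈ s, F i w) = ∑ i ∈ s, osc (F i) := by
  classical
  induction s using Finset.induction_on with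
  | empty => simpa using osc_zero
  | insert a s ha ih =>
    simp only [Finset.sum_insert ha]
    rw [osc_add' (h a (by simp)) (IsOscAmp.sum s fun i hi => h i (by simp [hi])),
      ih fun i hi => h i (by simp [hi])]

lemma DerivBound.growth_bilin {X : Type*} [NormedAddCommGroup X] [NormedSpace ℂ X]
    {N p q : ℕ} {C C' : ℝ} {f : Phase d → W} {F : Phase d → V}
    (B : W →L[ℝ] V →L[ℝ] X)
    (h : DerivBound N (growth p C) f) (h' : DerivBound N (growth q C') F) :
    DerivBound N (growth (p + q) (‖B‖ * (2 ^ N * (C * C')))) (fun w => B (f w) (F w)) :=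
  (h.bilin B h').mono fun w => by simp only [growth]; rw [pow_add]; apply le_of_eq; ring

lemma IsOscAmp.bilin {X : Type*} [NormedAddCommGroup X] [NormedSpace ℂ X] {p q : ℕ}
    {f : Phase d → W} {F : Phase d → V} (B : W →L[ℝ] V →L[ℝ] X)
    (h : IsOscAmp p f) (h' : IsOscAmp q F) : IsOscAmp (p + q) (fun w => B (f w) (F w)) :=
  fun N => let ⟨_, hC⟩ := h N; let ⟨_, hC'⟩ := h' N; ⟨_, hC.growth_bilin B hC'⟩

lemma IsOscAmp.smul {p q : ℕ} {f : Phase d → ℂ} {F : Phase d → V}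
    (h : IsOscAmp p f) (h' : IsOscAmp q F) : IsOscAmp (p + q) (fun w => f w • F w) :=
  h.bilin (ContinuousLinearMap.lsmul ℝ ℂ) h'

lemma isOscAmp_clm (L : Phase d →L[ℝ] V) : IsOscAmp 1 L := fun N =>
  ⟨‖L‖, (derivBound_clm N L).mono fun w => by simp [growth]⟩

lemma IsOscAmp.fderiv {p : ℕ} {F : Phase d → V} (h : IsOscAmp p F) :
    IsOscAmp p (fderiv ℝ F) := fun N => let ⟨C, hC⟩ := h (N + 1); ⟨C, hC.fderiv⟩

lemma IsOscAmp.fderiv_apply {p : ℕ} {F : Phase d → V} (h : IsOscAmp p F) (v : Phase d) :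
    IsOscAmp p (fun w => _root_.fderiv ℝ F w v) :=
  h.fderiv.clm (ContinuousLinearMap.apply ℝ V v)

/-- Dilating by ε ≤ 1 does not enlarge derivatives and translating does not change their bounds, so
the cut-offs form a bounded family of order 0. -/
lemma exists_derivBound_cutoff (χ : 𝓢(Phase d, ℂ)) (N : ℕ) : ∃ C, ∀ ε : ℝ, 0 ≤ ε → ε ≤ 1 →
    ∀ w₁ : Phase d, DerivBound N (growth 0 C) (fun w => χ (ε • (w + w₁))) := by
  have h := schwartz_derivBound 0 N χ
  simp only [pow_zero, one_mul, inv_one, mul_one] at h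
  refine ⟨(Finset.Iic (0, N)).sup (fun m => SchwartzMap.seminorm ℝ m.1 m.2) χ,
    fun ε h0 h1 w₁ => ?_⟩
  have h2 := h.comp_affine (ε • w₁) (ε • ContinuousLinearMap.id ℝ (Phase d)) (by
    rw [norm_smul, Real.norm_of_nonneg h0]
    exact mul_le_one₀ h1 (norm_nonneg _) ContinuousLinearMap.norm_id_le)
  have e : (fun w => χ (ε • (w + w₁))) =
      fun w => χ (ε • w₁ + (ε • ContinuousLinearMap.id ℝ (Phase d)) w) := by
    ext w; simp [smul_add, add_comm]
  rw [e]
  exact h2.mono fun w => by simp [growth]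

lemma integrable_cutoff_smul {p : ℕ} {F : Phase d → V} (hF : IsOscAmp p F) (χ : 𝓢(Phase d, ℂ))
    {ε : ℝ} (hε : 0 < ε) (w₁ : Phase d) : Integrable (fun w => χ (ε • (w + w₁)) • F w) := by
  obtain ⟨C, hC⟩ := hF 0
  have hχ := schwartz_derivBound (p + (2 * d + 1)) 0 χ
  set S := 2 ^ (p + (2 * d + 1)) * (Finset.Iic (p + (2 * d + 1), 0)).sup
    (fun m => SchwartzMap.seminorm ℝ m.1 m.2) χ with hS
  have hS0 : 0 ≤ S := by have := hχ.nonneg 0; simpa using this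
  have hC0 := hC.const_nonneg
  -- This k satisfies 1 + ‖w‖ ≤ k (1 + ‖ε(w + w₁)‖). It blows up as ε → 0, which is harmless since
  -- only integrability at fixed ε is claimed.
  obtain ⟨k, hk⟩ : ∃ k : ℝ, k = max 1 ε⁻¹ * (1 + ‖w₁‖) := ⟨_, rfl⟩
  have hk0 : 0 ≤ k := by rw [hk]; positivity
  have hle : ∀ w : Phase d, 1 + ‖w‖ ≤ k * (1 + ‖ε • (w + w₁)‖) := by
    intro w
    have h1 : 1 + ‖w‖ ≤ (1 + ‖w + w₁‖) * (1 + ‖w₁‖) := by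
      have := one_add_norm_add_le (w + w₁) (-w₁)
      simpa using this
    have h2 : 1 + ‖w + w₁‖ ≤ max 1 ε⁻¹ * (1 + ‖ε • (w + w₁)‖) := by
      rw [norm_smul, Real.norm_of_nonneg hε.le, mul_add, mul_one]
      have h3 : ‖w + w₁‖ = ε⁻¹ * (ε * ‖w + w₁‖) := by field_simp
      have h4 : ε⁻¹ * (ε * ‖w + w₁‖) ≤ max 1 ε⁻¹ * (ε * ‖w + w₁‖) := by
        gcongr; exact le_max_right _ _
      linarith [le_max_left 1 ε⁻¹]
    calc _ ≤ _ := h1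
      _ ≤ max 1 ε⁻¹ * (1 + ‖ε • (w + w₁)‖) * (1 + ‖w₁‖) := by gcongr
      _ = _ := by rw [hk]; ring
  refine ((integrable_bracket (d := d)).const_mul (S * k ^ (p + (2 * d + 1)) * C)).mono' ?_ ?_
  · refine Continuous.aestronglyMeasurable ?_
    exact ((χ.continuous.comp (by fun_prop)).smul hC.1.continuous)
  · refine Eventually.of_forall fun w => ?_
    rw [norm_smul]
    have hpos : 0 < 1 + ‖ε • (w + w₁)‖ := by positivity
    have a1 : ((1 + ‖ε • (w + w₁)‖) ^ (p + (2 * d + 1)))⁻¹ ≤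
        k ^ (p + (2 * d + 1)) * ((1 + ‖w‖) ^ (p + (2 * d + 1)))⁻¹ := by
      rw [← div_eq_mul_inv, le_div_iff₀ (by positivity), inv_mul_le_iff₀ (by positivity),
        ← mul_pow, mul_comm]
      gcongr
      exact (hle w).trans_eq (mul_comm _ _)
    calc ‖χ (ε • (w + w₁))‖ * ‖F w‖
        ≤ (S * ((1 + ‖ε • (w + w₁)‖) ^ (p + (2 * d + 1)))⁻¹) * (C * (1 + ‖w‖) ^ p) := by
          gcongr
          · exact hχ.norm_le _
          · exact hC.norm_le w
      _ ≤ (S * (k ^ (p + (2 * d + 1)) * ((1 + ‖w‖) ^ (p + (2 * d + 1)))⁻¹)) *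
          (C * (1 + ‖w‖) ^ p) := by gcongr
      _ = _ := by
          rw [pow_add (1 + ‖w‖)]
          have : (1 + ‖w‖) ^ p ≠ 0 := by positivity
          field_simp

lemma integrable_cutoff_phase_smul {p : ℕ} {F : Phase d → V} (hF : IsOscAmp p F)
    (χ : 𝓢(Phase d, ℂ)) {ε : ℝ} (hε : 0 < ε) (w₁ : Phase d) :
    Integrable (fun w => χ (ε • (w + w₁)) • (phase w • F w)) := by
  have := (integrable_cutoff_smul hF χ hε w₁).bdd_smul 1
    (phase_continuous (d := d)).aestronglyMeasurable
    (Eventually.of_forall fun w => (norm_phase w).le)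
  refine this.congr (Eventually.of_forall fun w => ?_)
  exact smul_comm _ _ _

/-- Regularization of oscillatory integrals by Schwartz cut-offs. -/
lemma tendsto_integral_cutoff [CompleteSpace V] {p : ℕ} {F : Phase d → V} (hF : IsOscAmp p F)
    (χ : 𝓢(Phase d, ℂ)) (w₁ : Phase d) :
    Tendsto (fun ε : ℝ => ∫ w, χ (ε • (w + w₁)) • (phase w • F w)) (𝓝[>] 0)
      (𝓝 (χ 0 • osc F)) := by
  obtain ⟨C, hC⟩ := exists_derivBound_cutoff χ (oscOrder d p)
  obtain ⟨C', hC'⟩ := hF (oscOrder d p)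
  have hev : ∀ᶠ ε : ℝ in 𝓝[>] 0, 0 < ε ∧ ε ≤ 1 := by
    have := Ioc_mem_nhdsGT (zero_lt_one (α := ℝ))
    filter_upwards [this] with ε hε using hε
  -- The regularized amplitudes obey uniform bounds and converge pointwise to χ(0) F, so the limit
  -- passes through `osc`; for ε > 0 they are integrable and `osc` is the ordinary integral.
  have h1 : Tendsto (fun ε : ℝ => osc (fun w => χ (ε • (w + w₁)) • F w)) (𝓝[>] 0)
      (𝓝 (osc (fun w => χ 0 • F w))) := by
    refine tendsto_osc (p := 0 + p) (C := ‖(ContinuousLinearMap.lsmul ℝ ℂ : ℂ →L[ℝ] V →L[ℝ] V)‖ *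
      (2 ^ (oscOrder d p) * (C * C'))) ?_ ?_
    · filter_upwards [hev] with ε hε
      have := (hC ε hε.1.le hε.2 w₁).growth_bilin (ContinuousLinearMap.lsmul ℝ ℂ) hC'
      simpa using! this
    · intro w
      refine Tendsto.smul ?_ tendsto_const_nhds
      have hc : Continuous fun ε : ℝ => χ (ε • (w + w₁)) := χ.continuous.comp (by fun_prop)
      have := hc.tendsto 0
      simp only [zero_smul] at this
      exact this.mono_left nhdsWithin_le_nhds
  rw [osc_smul _ hC'] at h1
  refine h1.congr' ?_
  filter_upwards [hev] with ε hε
  rw [osc_eq_integral (integrable_cutoff_smul hF χ hε.1 w₁)]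
  congr 1 with w
  exact smul_comm _ _ _

/-- A Schwartz cut-off equal to one at the origin. -/
def cutoff (d : ℕ) : 𝓢(Phase d, ℂ) :=
  HasCompactSupport.toSchwartzMap (f := fun w : Phase d => ((bump d w : ℝ) : ℂ))
    ((bump d).hasCompactSupport.comp_left Complex.ofReal_zero)
    (Complex.ofRealCLM.contDiff.comp (bump d).contDiff)

lemma cutoff_zero : cutoff d 0 = 1 := by
  change ((bump d 0 : ℝ) : ℂ) = 1
  rw [(bump d).one_of_mem_closedBall (Metric.mem_closedBall_self (bump d).rIn_pos.le)]
  simp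

lemma fderiv_phase (w v : Phase d) : fderiv ℝ phase w v =
    -(Complex.I * ((inner ℝ w.1 v.2 + inner ℝ v.1 w.2 : ℝ) : ℂ)) * phase w := by
  have h1 : HasFDerivAt (fun w : Phase d => (inner ℝ w.1 w.2 : ℝ)) _ w :=
    (hasFDerivAt_fst (𝕜 := ℝ) (p := w)).inner ℝ (hasFDerivAt_snd (𝕜 := ℝ) (p := w))
  have h2 := ((Complex.ofRealCLM.hasFDerivAt.comp w h1).const_mul Complex.I).neg.cexp
  have h3 : fderiv ℝ phase w v = _ := congrArg (fun L => L v) h2.fderiv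
  rw [h3]
  simp [phase, mul_comm]

/-- Integration by parts in an oscillatory integral. -/
lemma osc_phase_smul [CompleteSpace V] {p : ℕ} {F : Phase d → V} (hF : IsOscAmp p F)
    (v : Phase d) :
    osc (fun w => (Complex.I * ((inner ℝ w.1 v.2 + inner ℝ v.1 w.2 : ℝ) : ℂ)) • F w) =
      osc (fun w => fderiv ℝ F w v) := by
  set ℓ : Phase d → ℂ := fun w => Complex.I * ((inner ℝ w.1 v.2 + inner ℝ v.1 w.2 : ℝ) : ℂ) with hℓ
  have hℓamp : IsOscAmp 1 ℓ := by
    have := isOscAmp_clm (V := ℂ) ((Complex.I • ContinuousLinearMap.id ℝ ℂ) ∘L Complex.ofRealCLM ∘L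
      ((innerSL ℝ v.2) ∘L (ContinuousLinearMap.fst ℝ (Conf d) (Conf d)) +
        (innerSL ℝ v.1) ∘L (ContinuousLinearMap.snd ℝ (Conf d) (Conf d))))
    refine (congrArg (IsOscAmp 1) ?_).mp this
    ext w
    simp [hℓ, real_inner_comm, mul_add]
  have hℓF : IsOscAmp (1 + p) (fun w => ℓ w • F w) := hℓamp.smul hF
  have hDF : IsOscAmp p (fun w => fderiv ℝ F w v) := hF.fderiv_apply v
  obtain ⟨χ, hχ0⟩ : ∃ χ : 𝓢(Phase d, ℂ), χ 0 = 1 := ⟨cutoff d, cutoff_zero⟩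
  have t1 := tendsto_integral_cutoff hℓF χ 0
  have t2 := tendsto_integral_cutoff hDF χ 0
  -- The term in which the derivative falls on the cut-off carries a factor ε. Its integral
  -- converges, whatever the derivative of χ is at 0, so the term vanishes in the limit.
  have t3 := tendsto_integral_cutoff hF (LineDeriv.lineDerivOp v χ) 0
  have t4 : Tendsto (fun ε : ℝ => (ε : ℂ)) (𝓝[>] 0) (𝓝 0) := by
    have := Complex.continuous_ofReal.tendsto 0
    simp only [Complex.ofReal_zero] at this
    exact this.mono_left nhdsWithin_le_nhds
  have t5 := t2.add (t4.smul t3)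
  simp only [hχ0, one_smul, zero_smul, add_zero] at t1 t5
  refine tendsto_nhds_unique t1 (t5.congr' ?_)
  filter_upwards [self_mem_nhdsWithin] with ε hε
  have hε : 0 < ε := hε
  have hχd : ∀ w, HasFDerivAt (fun w => χ (ε • w)) (ε • fderiv ℝ χ (ε • w)) w := by
    intro w
    have := (χ.hasFDerivAt (ε • w)).comp w
      ((ε • ContinuousLinearMap.id ℝ (Phase d)).hasFDerivAt (x := w))
    refine (this.congr_fderiv ?_)
    ext <;> simp
  have hFd : ∀ w, HasFDerivAt F (fderiv ℝ F w) w := fun w =>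
    (hF.contDiff.differentiable (by simp) w).hasFDerivAt
  have hG : ∀ w, fderiv ℝ (fun w => χ (ε • w) • F w) w v =
      χ (ε • w) • fderiv ℝ F w v + (ε : ℂ) • ((LineDeriv.lineDerivOp v χ) (ε • w) • F w) := by
    intro w
    have := ((hχd w).smul (hFd w)).fderiv
    have h2 : fderiv ℝ (fun w => χ (ε • w) • F w) w v = _ := congrArg (fun L => L v) this
    rw [h2]
    simp [SchwartzMap.lineDerivOp_apply_eq_fderiv, smul_smul]
  have i1 := integrable_cutoff_phase_smul hℓF χ hε 0
  have i2 := integrable_cutoff_phase_smul hDF χ hε 0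
  have i3 := integrable_cutoff_phase_smul hF (LineDeriv.lineDerivOp v χ) hε 0
  have i4 := integrable_cutoff_phase_smul hF χ hε 0
  simp only [add_zero] at i1 i2 i3 i4 ⊢
  have i5 := i2.add (i3.smul (ε : ℂ))
  -- For fixed ε everything is integrable, so ordinary integration by parts applies to the phase
  -- against the cut-off amplitude.
  have parts := integral_smul_fderiv_eq_neg_fderiv_smul_of_integrable (𝕜 := ℂ) (μ := volume)
    (f := phase) (g := fun w => χ (ε • w) • F w) (v := v)
    (i1.neg.congr (Eventually.of_forall fun w => by
      simp only [Pi.neg_apply, fderiv_phase, smul_smul, hℓ]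
      rw [← neg_smul]; congr 1; ring))
    (i5.congr (Eventually.of_forall fun w => by
      simp only [Pi.add_apply, Pi.smul_apply, hG, smul_add, smul_smul]
      congr 2 <;> ring))
    (i4.congr (Eventually.of_forall fun w => smul_comm _ _ _))
    (fun w _ => phase_contDiff.differentiable (by simp) w)
    (fun w _ => ((hχd w).smul (hFd w)).differentiableAt)
  have e := integral_add i2 (i3.smul (ε : ℂ))
  simp only [Pi.smul_apply] at e
  rw [← integral_smul, ← e]
  calc _ = ∫ w, phase w • fderiv ℝ (fun w => χ (ε • w) • F w) w v := by
        congr 1 with w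
        simp only [hG, smul_add, smul_smul]
        congr 2 <;> ring
    _ = _ := parts
    _ = _ := by
        rw [← integral_neg]
        congr 1 with w
        simp only [fderiv_phase, smul_smul, hℓ]
        rw [← neg_smul]; congr 1; ring

end MagneticPsiDO
end

/-! ### Fourier inversion as an oscillatory integral -/

noncomputable section
namespace MagneticPsiDO

open MeasureTheory Filter Topology

variable {d : ℕ} {V W : Type*} [NormedAddCommGroup V] [NormedSpace ℂ V] [NormedAddCommGroup W]
  [NormedSpace ℂ W]

/-- A bump function on configuration space centred at the origin. -/
def confBump (d : ℕ) : ContDiffBump (0 : Conf d) := ⟨1, 2, one_pos, one_lt_two⟩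

/-- A Schwartz function on configuration space equal to one at the origin. -/
def confCutoff (d : ℕ) : 𝓢(Conf d, ℂ) :=
  HasCompactSupport.toSchwartzMap (f := fun z : Conf d => ((confBump d z : ℝ) : ℂ))
    ((confBump d).hasCompactSupport.comp_left Complex.ofReal_zero)
    (Complex.ofRealCLM.contDiff.comp (confBump d).contDiff)

lemma confCutoff_zero : confCutoff d 0 = 1 := by
  change ((confBump d 0 : ℝ) : ℂ) = 1
  rw [(confBump d).one_of_mem_closedBall (Metric.mem_closedBall_self (confBump d).rIn_pos.le)]
  simp

lemma confCutoff_hasCompactSupport : HasCompactSupport (confCutoff d) :=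
  (confBump d).hasCompactSupport.comp_left Complex.ofReal_zero

/-- The tensor product of two cut-offs. -/
def prodCutoff (d : ℕ) : 𝓢(Phase d, ℂ) :=
  HasCompactSupport.toSchwartzMap (f := fun w : Phase d => confCutoff d w.1 * confCutoff d w.2)
    (by
      refine HasCompactSupport.of_support_subset_isCompact
        (K := tsupport (confCutoff d) ×ˢ tsupport (confCutoff d))
        (confCutoff_hasCompactSupport.isCompact.prod confCutoff_hasCompactSupport.isCompact) ?_
      intro w hw
      simp only [Function.mem_support, ne_eq, mul_eq_zero, not_or] at hw
      exact ⟨subset_tsupport _ hw.1, subset_tsupport _ hw.2⟩)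
    ((((confCutoff d).smooth ⊤).comp contDiff_fst).mul
      (((confCutoff d).smooth ⊤).comp contDiff_snd))

lemma prodCutoff_apply (w : Phase d) :
    prodCutoff d w = confCutoff d w.1 * confCutoff d w.2 := rfl

open FourierTransform in
/-- The integral `∫ χ(z) exp (-i ⟨z, ζ⟩) dz` as a Schwartz function of `ζ`. -/
def cutoffHat (d : ℕ) : 𝓢(Conf d, ℂ) :=
  SchwartzMap.compCLMOfContinuousLinearEquiv ℂ
    (ContinuousLinearEquiv.smulLeft (Units.mk0 ((2 * Real.pi)⁻¹ : ℝ) (by positivity)))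
    (𝓕 (confCutoff d))

open FourierTransform in
lemma cutoffHat_apply (ζ : Conf d) :
    cutoffHat d ζ = 𝓕 (confCutoff d : Conf d → ℂ) ((2 * Real.pi)⁻¹ • ζ) := rfl

lemma cutoffHat_eq_integral (ζ : Conf d) :
    cutoffHat d ζ = ∫ z, confCutoff d z * phase (z, ζ) := by
  rw [cutoffHat_apply, Real.fourier_eq]
  congr 1 with z
  rw [Circle.smul_def, Real.fourierChar_apply, phase, inner_smul_right, smul_eq_mul, mul_comm]
  congr 2
  have hpi : (Real.pi : ℂ) ≠ 0 := by exact_mod_cast Real.pi_ne_zero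
  push_cast
  field_simp

open FourierTransform in
-- Fourier inversion at the origin, where the cut-off equals one; the power of 2π is the Jacobian of
-- the rescaling in `cutoffHat`.
lemma integral_cutoffHat : ∫ ζ, cutoffHat d ζ = (2 * Real.pi : ℂ) ^ d := by
  simp only [cutoffHat_apply]
  rw [Measure.integral_comp_smul]
  have h1 : ∫ ζ, 𝓕 (confCutoff d : Conf d → ℂ) ζ = 1 := by
    have h2 : 𝓕⁻ (𝓕 (confCutoff d)) = confCutoff d := FourierTransform.fourierInv_fourier_eq _
    have h3 := congrArg (fun f : 𝓢(Conf d, ℂ) => f 0) h2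
    simp only [confCutoff_zero] at h3
    rw [SchwartzMap.fourierInv_coe, Real.fourierInv_eq] at h3
    have h4 : ∫ v : Conf d, (𝓕 (confCutoff d)) v = 1 := by simpa using h3
    exact h4
  rw [h1]
  simp only [finrank_euclideanSpace, Fintype.card_fin]
  rw [abs_of_nonneg (by positivity), inv_pow, inv_inv]
  simp

lemma cutoffHat_scaled {ε : ℝ} (hε : 0 < ε) (ζ : Conf d) :
    ∫ z, confCutoff d (ε • z) * phase (z, ζ) = ((ε ^ d)⁻¹ : ℝ) • cutoffHat d (ε⁻¹ • ζ) := by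
  rw [cutoffHat_eq_integral]
  have := Measure.integral_comp_smul (volume : Measure (Conf d))
    (fun z => confCutoff d z * phase (z, ε⁻¹ • ζ)) ε
  rw [finrank_euclideanSpace, Fintype.card_fin, abs_of_nonneg (by positivity)] at this
  rw [← this]
  congr 1 with z
  congr 1
  simp only [phase, inner_smul_left, inner_smul_right]
  congr 4
  simp only [conj_trivial]
  field_simp

/-- The z-integral is done first and gives ε^{-d} times `cutoffHat` at ζ/ε, an approximate identity
up to its mass. Substituting εζ for ζ removes the singular factor and leaves an integrand with an
evident limit. -/
lemma integral_prodCutoff_scaled [CompleteSpace V] {p : ℕ} {f : Conf d → V}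
    (hf : IsOscAmp p (fun w : Phase d => f w.2)) {ε : ℝ} (hε : 0 < ε) :
    ∫ w, prodCutoff d (ε • (w + 0)) • (phase w • f w.2) =
      ∫ ζ, (cutoffHat d ζ * confCutoff d (ε ^ 2 • ζ)) • f (ε • ζ) := by
  have hint := integrable_cutoff_phase_smul hf (prodCutoff d) hε 0
  have h1 := integral_prod_symm (μ := (volume : Measure (Conf d)))
    (ν := (volume : Measure (Conf d))) _ hint
  refine h1.trans ?_
  have h2 : ∀ ζ : Conf d, ∫ z : Conf d, prodCutoff d (ε • ((z, ζ) + 0)) •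
      (phase (z, ζ) • f ζ) = ((ε ^ d)⁻¹ : ℝ) • ((cutoffHat d (ε⁻¹ • ζ) *
        confCutoff d (ε ^ 2 • (ε⁻¹ • ζ))) • f (ε • (ε⁻¹ • ζ))) := by
    intro ζ
    have e : ∀ z : Conf d, prodCutoff d (ε • ((z, ζ) + 0)) • (phase (z, ζ) • f ζ) =
        (confCutoff d (ε • z) * phase (z, ζ)) • (confCutoff d (ε • ζ) • f ζ) := by
      intro z
      simp only [add_zero, prodCutoff_apply, smul_smul]
      congr 1
      simp only [Prod.smul_mk]
      ring
    simp only [e]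
    rw [integral_smul_const, cutoffHat_scaled hε]
    have e1 : ε • (ε⁻¹ • ζ) = ζ := by rw [smul_smul, mul_inv_cancel₀ hε.ne', one_smul]
    have e2 : ε ^ 2 • (ε⁻¹ • ζ) = ε • ζ := by rw [pow_two, mul_smul, e1]
    rw [e1, e2, smul_assoc, smul_smul]
  simp only [h2]
  rw [integral_smul, Measure.integral_comp_smul (volume : Measure (Conf d))
    (fun ζ => (cutoffHat d ζ * confCutoff d (ε ^ 2 • ζ)) • f (ε • ζ)) ε⁻¹,
    finrank_euclideanSpace, Fintype.card_fin, smul_smul, abs_of_nonneg (by positivity)]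
  have : (ε ^ d)⁻¹ * (ε⁻¹ ^ d)⁻¹ = 1 := by
    rw [inv_pow, inv_inv, inv_mul_cancel₀ (by positivity)]
  rw [this, one_smul]

/-- The inversion formula: an oscillatory integral of a function of the second variable alone. -/
lemma osc_snd [CompleteSpace V] {p : ℕ} {f : Conf d → V}
    (hf : IsOscAmp p (fun w : Phase d => f w.2)) :
    osc (fun w : Phase d => f w.2) = (2 * Real.pi : ℂ) ^ d • f 0 := by
  have t1 := tendsto_integral_cutoff hf (prodCutoff d) 0
  have hχ0 : prodCutoff d 0 = 1 := by
    simp [prodCutoff_apply, confCutoff_zero]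
  rw [hχ0, one_smul] at t1
  obtain ⟨C, hC⟩ := hf 0
  have hfc : Continuous f := by
    have := hf.contDiff.continuous.comp (by fun_prop : Continuous fun ζ : Conf d => ((0 : Conf d), ζ))
    exact this
  have hfb : ∀ ζ, ‖f ζ‖ ≤ C * (1 + ‖ζ‖) ^ p := by
    intro ζ
    have := hC.norm_le ((0 : Conf d), ζ)
    simpa [growth, Prod.norm_def] using this
  have hC0 := hC.const_nonneg
  have hh := schwartz_derivBound (p + (d + 1)) 0 (cutoffHat d)
  have hc := schwartz_derivBound 0 0 (confCutoff d)
  set S := 2 ^ (p + (d + 1)) * (Finset.Iic (p + (d + 1), 0)).sup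
    (fun m => SchwartzMap.seminorm ℝ m.1 m.2) (cutoffHat d)
  set S' := 2 ^ 0 * (Finset.Iic (0, 0)).sup
    (fun m => SchwartzMap.seminorm ℝ m.1 m.2) (confCutoff d)
  have hS0 : 0 ≤ S := by have := hh.nonneg 0; simpa using this
  have hS'0 : 0 ≤ S' := by have := hc.nonneg 0; simpa using this
  have hev : ∀ᶠ ε : ℝ in 𝓝[>] 0, 0 < ε ∧ ε ≤ 1 := by
    filter_upwards [Ioc_mem_nhdsGT (zero_lt_one (α := ℝ))] with ε hε using hε
  have hint : Integrable (fun ζ : Conf d => ((1 + ‖ζ‖) ^ (d + 1))⁻¹) := by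
    have := integrable_one_add_norm (E := Conf d) (μ := volume) (r := (d + 1 : ℕ))
      (by simp)
    refine this.congr (Eventually.of_forall fun v => ?_)
    simp only [Real.rpow_neg (by positivity : 0 ≤ 1 + ‖v‖), Real.rpow_natCast]
  -- The decay of `cutoffHat` of order p + d + 1 absorbs the growth of f and is integrable on ℝ^d,
  -- which dominates the integrands for ε ≤ 1.
  have t2 : Tendsto (fun ε : ℝ => ∫ ζ, (cutoffHat d ζ * confCutoff d (ε ^ 2 • ζ)) • f (ε • ζ))
      (𝓝[>] 0) (𝓝 (∫ ζ, cutoffHat d ζ • f 0)) := by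
    refine tendsto_integral_filter_of_dominated_convergence
      (fun ζ => S * S' * C * ((1 + ‖ζ‖) ^ (d + 1))⁻¹) ?_ ?_ (hint.const_mul _) ?_
    · refine Eventually.of_forall fun ε => Continuous.aestronglyMeasurable ?_
      have c1 : Continuous (cutoffHat d) := (cutoffHat d).continuous
      have c2 : Continuous (confCutoff d) := (confCutoff d).continuous
      fun_prop
    · filter_upwards [hev] with ε hε
      refine Eventually.of_forall fun ζ => ?_
      rw [norm_smul, norm_mul]
      have b1 := hh.norm_le ζ
      have b2 : ‖confCutoff d (ε ^ 2 • ζ)‖ ≤ S' := by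
        have := hc.norm_le (ε ^ 2 • ζ)
        simpa using this
      have b3 : ‖f (ε • ζ)‖ ≤ C * (1 + ‖ζ‖) ^ p := by
        refine (hfb _).trans ?_
        gcongr
        rw [norm_smul, Real.norm_of_nonneg hε.1.le]
        exact mul_le_of_le_one_left (norm_nonneg _) hε.2
      calc _ ≤ (S * ((1 + ‖ζ‖) ^ (p + (d + 1)))⁻¹ * S') * (C * (1 + ‖ζ‖) ^ p) := by gcongr
        _ = _ := by
          rw [pow_add]
          have : (1 + ‖ζ‖) ^ p ≠ 0 := by positivity
          field_simp
    · refine Eventually.of_forall fun ζ => ?_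
      have c : Continuous fun ε : ℝ => (cutoffHat d ζ * confCutoff d (ε ^ 2 • ζ)) • f (ε • ζ) := by
        have c2 : Continuous (confCutoff d) := (confCutoff d).continuous
        fun_prop
      have := (c.tendsto 0).mono_left (nhdsWithin_le_nhds (s := Set.Ioi 0))
      simpa [confCutoff_zero] using this
  rw [integral_smul_const, integral_cutoffHat] at t2
  refine tendsto_nhds_unique t1 (t2.congr' ?_)
  filter_upwards [hev] with ε hε
  exact (integral_prodCutoff_scaled hf hε.1).symm

end MagneticPsiDO
end

noncomputable section
namespace MagneticPsiDO

open MeasureTheory Filter Topology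

variable {d : ℕ} {V W : Type*} [NormedAddCommGroup V] [NormedSpace ℂ V] [NormedAddCommGroup W]
  [NormedSpace ℂ W]

/-! ### Symbols with uniformly bounded derivatives -/

lemma one_le_bracket (ξ : Conf d) : 1 ≤ bracket ξ := by
  rw [bracket, Real.one_le_sqrt]
  linarith [sq_nonneg ‖ξ‖]

lemma bracket_pos (ξ : Conf d) : 0 < bracket ξ := zero_lt_one.trans_le (one_le_bracket ξ)

lemma bracket_add_le (η ζ : Conf d) : bracket (η + ζ) ≤ bracket η * (1 + ‖ζ‖) := by
  have h1 := one_le_bracket η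
  have h0 : bracket η ^ 2 = 1 + ‖η‖ ^ 2 := Real.sq_sqrt (by positivity)
  have h2 : ‖η‖ ≤ bracket η := by
    refine abs_le_of_sq_le_sq' ?_ (bracket_pos η).le |>.2
    rw [h0]; linarith
  have h3 : bracket (η + ζ) ≤ bracket η + ‖ζ‖ := by
    refine Real.sqrt_le_iff.mpr ⟨by positivity, ?_⟩
    have h4 := norm_add_le η ζ
    have h5 : ‖η + ζ‖ ^ 2 ≤ (‖η‖ + ‖ζ‖) ^ 2 := by gcongr
    nlinarith [mul_le_mul_of_nonneg_right h2 (norm_nonneg ζ)]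
  nlinarith [norm_nonneg ζ]

/-- An integer exponent at least `|m|`. -/
def peetreOrder (m : ℝ) : ℕ := ⌈|m|⌉₊

/-- Peetre's inequality. -/
lemma bracket_add_rpow_le (m : ℝ) (η ζ : Conf d) :
    bracket (η + ζ) ^ m ≤ bracket η ^ m * (1 + ‖ζ‖) ^ peetreOrder m := by
  have hp : |m| ≤ (peetreOrder m : ℝ) := Nat.le_ceil _
  have h1 : (1 : ℝ) ≤ 1 + ‖ζ‖ := by linarith [norm_nonneg ζ]
  have h2 : (1 + ‖ζ‖) ^ |m| ≤ (1 + ‖ζ‖) ^ peetreOrder m := by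
    rw [← Real.rpow_natCast]
    exact Real.rpow_le_rpow_of_exponent_le h1 hp
  refine le_trans ?_ (mul_le_mul_of_nonneg_left h2 (Real.rpow_nonneg (bracket_pos η).le m))
  rcases le_total 0 m with hm | hm
  · rw [abs_of_nonneg hm, ← Real.mul_rpow (bracket_pos η).le (by positivity)]
    exact Real.rpow_le_rpow (bracket_pos _).le (bracket_add_le η ζ) hm
  · rw [abs_of_nonpos hm]
    have h3 : bracket η ≤ bracket (η + ζ) * (1 + ‖ζ‖) := by
      have := bracket_add_le (η + ζ) (-ζ)
      simpa using this
    have h4 := Real.rpow_le_rpow_of_nonpos (bracket_pos η) h3 hm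
    rw [Real.mul_rpow (bracket_pos _).le (by positivity)] at h4
    rw [Real.rpow_neg (by positivity), ← div_eq_mul_inv,
      le_div_iff₀ (Real.rpow_pos_of_pos (by positivity) m)]
    exact h4

/-- Functions all of whose derivatives are bounded by multiples of `⟨ξ⟩ ^ m`. -/
def IsUnifSymbol (m : ℝ) (a : Phase d → V) : Prop :=
  ∀ N, ∃ C, DerivBound N (fun p => C * bracket p.2 ^ m) a

lemma IsUnifSymbol.contDiff {m : ℝ} {a : Phase d → V} (h : IsUnifSymbol m a) : ContDiff ℝ ∞ a :=
  let ⟨_, hC⟩ := h 0; hC.1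

lemma IsUnifSymbol.fderiv {m : ℝ} {a : Phase d → V} (h : IsUnifSymbol m a) :
    IsUnifSymbol m (fderiv ℝ a) := fun N => let ⟨C, hC⟩ := h (N + 1); ⟨C, hC.fderiv⟩

lemma IsUnifSymbol.clm {m : ℝ} {a : Phase d → V} (h : IsUnifSymbol m a) (L : V →L[ℝ] W) :
    IsUnifSymbol m (fun p => L (a p)) := fun N => by
  obtain ⟨C, hC⟩ := h N
  exact ⟨‖L‖ * C, (hC.clm L).mono fun w => by rw [mul_assoc]⟩

lemma IsUnifSymbol.fderiv_apply {m : ℝ} {a : Phase d → V} (h : IsUnifSymbol m a) (v : Phase d) :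
    IsUnifSymbol m (fun p => _root_.fderiv ℝ a p v) :=
  h.fderiv.clm (ContinuousLinearMap.apply ℝ V v)

lemma IsUnifSymbol.const_smul {m : ℝ} {a : Phase d → V} (h : IsUnifSymbol m a) (c : ℂ) :
    IsUnifSymbol m (fun p => c • a p) := by
  simpa using h.clm ((c • ContinuousLinearMap.id ℂ V).restrictScalars ℝ)

lemma IsUnifSymbol.sum {ι : Type*} (s : Finset ι) {m : ℝ} {a : ι → Phase d → V}
    (h : ∀ i ∈ s, IsUnifSymbol m (a i)) : IsUnifSymbol m (fun p => ∑ i ∈ s, a i p) := fun N => by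
  choose! C hC using fun i hi => h i hi N
  exact ⟨∑ i ∈ s, C i, (DerivBound.sum s hC).mono fun p => by rw [Finset.sum_mul]⟩

/-- Evaluation of real linear maps at a vector, as a complex linear map. -/
def evalCLM {H : Type*} [NormedAddCommGroup H] [NormedSpace ℝ H] (V : Type*)
    [NormedAddCommGroup V] [NormedSpace ℂ V] (h : H) : (H →L[ℝ] V) →L[ℂ] V :=
  LinearMap.mkContinuous
    { toFun := fun L => L h
      map_add' := fun _ _ => rfl
      map_smul' := fun _ _ => rfl } ‖h‖ fun L => by
    rw [mul_comm]; exact L.le_opNorm h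

lemma evalCLM_apply {H : Type*} [NormedAddCommGroup H] [NormedSpace ℝ H] (h : H)
    (L : H →L[ℝ] V) : evalCLM V h L = L h := rfl

/-- The map `(z, ζ) ↦ (s z, ζ)`. -/
def dilate (s : ℝ) : Phase d →L[ℝ] Phase d :=
  (s • ContinuousLinearMap.fst ℝ (Conf d) (Conf d)).prod (ContinuousLinearMap.snd ℝ (Conf d) (Conf d))

lemma dilate_apply (s : ℝ) (w : Phase d) : dilate s w = (s • w.1, w.2) := rfl

lemma norm_dilate_le {s : ℝ} (hs : |s| ≤ 1) : ‖(dilate s : Phase d →L[ℝ] Phase d)‖ ≤ 1 := by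
  refine ContinuousLinearMap.opNorm_le_bound _ zero_le_one fun w => ?_
  rw [one_mul, dilate_apply, Prod.norm_def, Prod.norm_def, norm_smul]
  refine max_le_max ?_ le_rfl
  exact mul_le_of_le_one_left (norm_nonneg _) hs

/-- Peetre's inequality turns a symbol bound into an amplitude bound of growth `peetreOrder m` whose
constant keeps the weight ⟨ξ⟩^m at the base point, uniformly in |s| ≤ 1. -/
lemma DerivBound.comp_dilate {N : ℕ} {m C s : ℝ} {a : Phase d → V}
    (h : DerivBound N (fun p => C * bracket p.2 ^ m) a) (hs : |s| ≤ 1) (p : Phase d) :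
    DerivBound N (growth (peetreOrder m) (C * bracket p.2 ^ m)) (fun w => a (p + dilate s w)) := by
  have hC : 0 ≤ C := by
    have := h.nonneg 0
    exact nonneg_of_mul_nonneg_left this (Real.rpow_pos_of_pos (bracket_pos _) _)
  refine (h.comp_affine p (dilate s) (norm_dilate_le hs)).mono fun w => ?_
  simp only [growth, mul_assoc]
  refine mul_le_mul_of_nonneg_left ?_ hC
  refine (bracket_add_rpow_le m p.2 w.2).trans ?_
  have : 0 ≤ bracket p.2 ^ m := Real.rpow_nonneg (bracket_pos _).le _
  gcongr
  exact norm_snd_le w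

lemma IsUnifSymbol.comp_dilate {m s : ℝ} {a : Phase d → V} (h : IsUnifSymbol m a)
    (hs : |s| ≤ 1) (p : Phase d) : IsOscAmp (peetreOrder m) (fun w => a (p + dilate s w)) :=
  fun N => let ⟨_, hC⟩ := h N; ⟨_, hC.comp_dilate hs p⟩

/-- The Fourier multiplier `exp (s D_x · ∂_ξ)` acting on symbols. -/
def shear (s : ℝ) (a : Phase d → V) (p : Phase d) : V :=
  ((2 * Real.pi : ℂ) ^ d)⁻¹ • osc (fun w => a (p + dilate s w))

lemma exists_norm_shear_le (d : ℕ) (m : ℝ) (V : Type*) [NormedAddCommGroup V] [NormedSpace ℂ V] :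
    ∃ C₀ : ℝ, 0 ≤ C₀ ∧ ∀ (C : ℝ) (a : Phase d → V),
      DerivBound (oscOrder d (peetreOrder m)) (fun p => C * bracket p.2 ^ m) a →
      ∀ (s : ℝ), |s| ≤ 1 → ∀ p, ‖shear s a p‖ ≤ C₀ * C * bracket p.2 ^ m := by
  obtain ⟨C₀, hC₀, h⟩ := exists_norm_osc_le d (peetreOrder m) V
  refine ⟨‖((2 * Real.pi : ℂ) ^ d)⁻¹‖ * C₀, by positivity, fun C a ha s hs p => ?_⟩
  rw [shear, norm_smul, mul_assoc, mul_assoc]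
  gcongr
  exact h _ _ (ha.comp_dilate hs p)

/-- At s = 0 the amplitude no longer depends on z, so the inversion formula evaluates the integral.
-/
lemma shear_zero [CompleteSpace V] {m : ℝ} {a : Phase d → V} (ha : IsUnifSymbol m a) :
    shear 0 a = a := by
  ext p
  have h0 := ha.comp_dilate (s := 0) (by simp) p
  have e : (fun w : Phase d => a (p + dilate 0 w)) =
      fun w => (fun ζ => a (p.1, p.2 + ζ)) w.2 := by
    ext w; congr 1; ext1 <;> simp [dilate_apply]
  rw [e] at h0
  rw [shear, e, osc_snd (f := fun ζ => a (p.1, p.2 + ζ)) h0, smul_smul, inv_mul_cancel₀, one_smul]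
  · simp
  · have : (Real.pi : ℂ) ≠ 0 := by exact_mod_cast Real.pi_ne_zero
    exact pow_ne_zero _ (mul_ne_zero two_ne_zero this)

lemma bracket_rpow_le_of_near (m : ℝ) {p q : Phase d} (h : ‖q - p‖ ≤ 1) :
    bracket q.2 ^ m ≤ bracket p.2 ^ m * 2 ^ peetreOrder m := by
  have := bracket_add_rpow_le m p.2 (q.2 - p.2)
  rw [add_sub_cancel] at this
  refine this.trans ?_
  have h0 : 0 ≤ bracket p.2 ^ m := Real.rpow_nonneg (bracket_pos _).le _
  have h1 : ‖q.2 - p.2‖ ≤ 1 := (norm_snd_le (q - p)).trans h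
  gcongr
  linarith

/-- Differentiating under `osc` in the base point needs one constant on a whole neighbourhood; on
the unit ball ⟨ξ⟩^m varies by a bounded factor. -/
lemma IsUnifSymbol.exists_derivBound_near {m : ℝ} {a : Phase d → V} (ha : IsUnifSymbol m a)
    (N : ℕ) (p : Phase d) : ∃ C, 0 ≤ C ∧ ∀ s : ℝ, |s| ≤ 1 → ∀ q ∈ Metric.closedBall p 1,
      DerivBound N (growth (peetreOrder m) C) (fun w => a (q + dilate s w)) := by
  obtain ⟨C, hC⟩ := ha N
  have hC0 : 0 ≤ C := by
    have := hC.nonneg 0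
    exact nonneg_of_mul_nonneg_left this (Real.rpow_pos_of_pos (bracket_pos _) _)
  have h0 : 0 ≤ bracket p.2 ^ m := Real.rpow_nonneg (bracket_pos _).le _
  refine ⟨C * (bracket p.2 ^ m * 2 ^ peetreOrder m), by positivity, fun s hs q hq => ?_⟩
  refine (hC.comp_dilate hs q).mono fun w => ?_
  unfold growth
  gcongr
  exact bracket_rpow_le_of_near m (by rwa [← dist_eq_norm])

/-- The shear has constant coefficients, so translations, and hence derivatives, pass through the
oscillatory integral. -/
lemma hasFDerivAt_shear [CompleteSpace V] {m s : ℝ} {a : Phase d → V} (ha : IsUnifSymbol m a)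
    (hs : |s| ≤ 1) (p : Phase d) :
    HasFDerivAt (shear s a) (shear s (fderiv ℝ a) p) p := by
  obtain ⟨C, hC0, hC⟩ := ha.exists_derivBound_near (oscOrder d (peetreOrder m)) p
  obtain ⟨C', hC0', hC'⟩ := ha.fderiv.exists_derivBound_near (oscOrder d (peetreOrder m)) p
  have := hasFDerivAt_osc (p := peetreOrder m) (C := max C C') (θ := p)
    (F := fun q w => a (q + dilate s w)) (F' := fun q w => fderiv ℝ a (q + dilate s w))
    (Metric.closedBall_mem_nhds p one_pos)
    (fun q hq => (hC s hs q hq).mono fun w => by unfold growth; gcongr; exact le_max_left _ _)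
    (fun q hq => (hC' s hs q hq).mono fun w => by unfold growth; gcongr; exact le_max_right _ _)
    (fun q hq w => by
      have h1 := (ha.contDiff.differentiable (by simp) (q + dilate s w)).hasFDerivAt
      exact (hasFDerivAt_comp_add_right (dilate s w)).mpr h1)
  exact this.const_smul _

lemma fderiv_shear [CompleteSpace V] {m s : ℝ} {a : Phase d → V} (ha : IsUnifSymbol m a)
    (hs : |s| ≤ 1) : fderiv ℝ (shear s a) = shear s (fderiv ℝ a) :=
  funext fun p => (hasFDerivAt_shear ha hs p).fderiv

lemma shear_clm [CompleteSpace V] [CompleteSpace W] {m s : ℝ} {a : Phase d → V}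
    (ha : IsUnifSymbol m a) (hs : |s| ≤ 1) (L : V →L[ℂ] W) (p : Phase d) :
    shear s (fun q => L (a q)) p = L (shear s a p) := by
  rw [shear, shear, map_smul, osc_clm' L (ha.comp_dilate hs p)]

lemma fderiv_shear_apply [CompleteSpace V] {m s : ℝ} {a : Phase d → V} (ha : IsUnifSymbol m a)
    (hs : |s| ≤ 1) (v p : Phase d) :
    fderiv ℝ (shear s a) p v = shear s (fun q => fderiv ℝ a q v) p := by
  rw [fderiv_shear ha hs]
  exact (shear_clm ha.fderiv hs (evalCLM V v) p).symm

/-- The derivative of a shear is the shear of the derivative, with values in a space of linear maps.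
For this reason the induction quantifies over the target space. -/
lemma contDiff_nat_shear (n : ℕ) : ∀ (V : Type) [NormedAddCommGroup V] [NormedSpace ℂ V]
    [CompleteSpace V] (m s : ℝ) (a : Phase d → V), IsUnifSymbol m a → |s| ≤ 1 →
    ContDiff ℝ n (shear s a) := by
  induction n with
  | zero =>
    intro V _ _ _ m s a ha hs
    rw [Nat.cast_zero, contDiff_zero, continuous_iff_continuousAt]
    exact fun p => (hasFDerivAt_shear ha hs p).continuousAt
  | succ n ih =>
    intro V _ _ _ m s a ha hs
    rw [Nat.cast_succ, contDiff_succ_iff_fderiv]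
    refine ⟨fun p => (hasFDerivAt_shear ha hs p).differentiableAt, by simp, ?_⟩
    rw [fderiv_shear ha hs]
    exact ih _ m s _ ha.fderiv hs

lemma contDiff_shear {V : Type} [NormedAddCommGroup V] [NormedSpace ℂ V]
    [CompleteSpace V] {m s : ℝ} {a : Phase d → V} (ha : IsUnifSymbol m a) (hs : |s| ≤ 1) :
    ContDiff ℝ ∞ (shear s a) :=
  contDiff_infty.mpr fun n => contDiff_nat_shear n V m s a ha hs

lemma exists_norm_iteratedFDeriv_shear_le (n : ℕ) : ∀ (V : Type) [NormedAddCommGroup V]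
    [NormedSpace ℂ V] [CompleteSpace V] (m : ℝ) (a : Phase d → V), IsUnifSymbol m a →
    ∃ C, ∀ s : ℝ, |s| ≤ 1 → ∀ p, ‖iteratedFDeriv ℝ n (shear s a) p‖ ≤ C * bracket p.2 ^ m := by
  induction n with
  | zero =>
    intro V _ _ _ m a ha
    obtain ⟨C₀, -, h⟩ := exists_norm_shear_le d m V
    obtain ⟨C, hC⟩ := ha (oscOrder d (peetreOrder m))
    exact ⟨C₀ * C, fun s hs p => by rw [norm_iteratedFDeriv_zero]; exact h C a hC s hs p⟩
  | succ n ih =>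
    intro V _ _ _ m a ha
    obtain ⟨C, hC⟩ := ih _ m _ ha.fderiv
    refine ⟨C, fun s hs p => ?_⟩
    rw [← norm_iteratedFDeriv_fderiv, fderiv_shear ha hs]
    exact hC s hs p

/-- The symbols `shear s a`, `|s| ≤ 1`, are uniformly bounded. -/
lemma IsUnifSymbol.exists_derivBound_shear {V : Type} [NormedAddCommGroup V] [NormedSpace ℂ V]
    [CompleteSpace V] {m : ℝ} {a : Phase d → V} (ha : IsUnifSymbol m a) (N : ℕ) :
    ∃ C, ∀ s : ℝ, |s| ≤ 1 → DerivBound N (fun p => C * bracket p.2 ^ m) (shear s a) := by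
  choose C hC using fun n => exists_norm_iteratedFDeriv_shear_le n V m a ha
  refine ⟨∑ n ∈ Finset.range (N + 1), |C n|, fun s hs => ⟨contDiff_shear ha hs, fun n hn p => ?_⟩⟩
  refine (hC n s hs p).trans ?_
  have h0 : 0 ≤ bracket p.2 ^ m := Real.rpow_nonneg (bracket_pos _).le _
  refine mul_le_mul_of_nonneg_right ((le_abs_self _).trans ?_) h0
  exact Finset.single_le_sum (f := fun n => |C n|) (fun _ _ => abs_nonneg _)
    (Finset.mem_range.mpr (by omega))

lemma IsUnifSymbol.shear {V : Type} [NormedAddCommGroup V] [NormedSpace ℂ V]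
    [CompleteSpace V] {m s : ℝ} {a : Phase d → V} (ha : IsUnifSymbol m a) (hs : |s| ≤ 1) :
    IsUnifSymbol m (shear s a) := fun N =>
  let ⟨C, hC⟩ := ha.exists_derivBound_shear N; ⟨C, hC s hs⟩

end MagneticPsiDO
end

/-! ### The generator of the shear and Taylor remainders -/

noncomputable section
namespace MagneticPsiDO

open MeasureTheory Filter Topology

variable {d : ℕ} {V W : Type*} [NormedAddCommGroup V] [NormedSpace ℂ V] [NormedAddCommGroup W]
  [NormedSpace ℂ W]

/-- The unit vector `e_j` in the position variable. -/
def dirX (j : Fin d) : Phase d := (EuclideanSpace.single j 1, 0)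

/-- The unit vector `e_j` in the momentum variable. -/
def dirXi (j : Fin d) : Phase d := (0, EuclideanSpace.single j 1)

/-- The operator `∑_j D_{x_j} ∂_{ξ_j}`. -/
def mixedOp (a : Phase d → ℂ) (p : Phase d) : ℂ :=
  ∑ j, -Complex.I * partialXi j (partialX j a) p

lemma IsUnifSymbol.partialX {m : ℝ} {a : Phase d → ℂ} (h : IsUnifSymbol m a) (j : Fin d) :
    IsUnifSymbol m (partialX j a) := h.fderiv_apply _

lemma IsUnifSymbol.partialXi {m : ℝ} {a : Phase d → ℂ} (h : IsUnifSymbol m a) (j : Fin d) :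
    IsUnifSymbol m (partialXi j a) := h.fderiv_apply _

lemma IsUnifSymbol.mixedOp {m : ℝ} {a : Phase d → ℂ} (h : IsUnifSymbol m a) :
    IsUnifSymbol m (mixedOp a) :=
  IsUnifSymbol.sum _ fun j _ => ((h.partialX j).partialXi j).const_smul (-Complex.I)

lemma conf_eq_sum_single (z : Conf d) : z = ∑ j, z j • EuclideanSpace.single j (1 : ℝ) := by
  have := (EuclideanSpace.basisFun (Fin d) ℝ).sum_repr z
  simpa using this.symm

lemma pair_zero_eq_sum (z : Conf d) : ((z, 0) : Phase d) = ∑ j, z j • dirX j := by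
  conv_lhs => rw [conf_eq_sum_single z]
  simp only [dirX, Prod.smul_mk, smul_zero]
  ext1
  · simp [Prod.fst_sum]
  · simp [Prod.snd_sum]

/-- Multiplication by `z_j` inside an oscillatory integral. -/
lemma osc_coord_mul {p : ℕ} {F : Phase d → ℂ} (hF : IsOscAmp p F) (j : Fin d) :
    osc (fun w => ((w.1 j : ℝ) : ℂ) * F w) = osc (fun w => -Complex.I * fderiv ℝ F w (dirXi j)) := by
  have h1 := osc_phase_smul hF (dirXi j)
  have hDF := hF.fderiv_apply (dirXi j)
  have h2 := osc_smul' (-Complex.I) hDF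
  simp only [smul_eq_mul] at h2
  rw [h2, ← h1]
  have hx : IsOscAmp (1 + p) (fun w : Phase d => ((w.1 j : ℝ) : ℂ) * F w) := by
    have := isOscAmp_clm (V := ℂ) (Complex.ofRealCLM ∘L (EuclideanSpace.proj j) ∘L
      (ContinuousLinearMap.fst ℝ (Conf d) (Conf d)))
    exact this.smul hF
  have h3 := osc_smul' Complex.I hx
  simp only [smul_eq_mul] at h3
  have e : (fun w : Phase d => (Complex.I * ((inner ℝ w.1 (dirXi j).2 + inner ℝ (dirXi j).1 w.2 : ℝ)
      : ℂ)) • F w) = fun w => Complex.I * (((w.1 j : ℝ) : ℂ) * F w) := by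
    ext w
    simp [dirXi, mul_assoc, EuclideanSpace.inner_single_right]
  rw [e, h3, ← mul_assoc]
  simp

lemma isOscAmp_coord_mul {p : ℕ} {F : Phase d → ℂ} (hF : IsOscAmp p F) (j : Fin d) :
    IsOscAmp (1 + p) (fun w : Phase d => ((w.1 j : ℝ) : ℂ) * F w) := by
  have := isOscAmp_clm (V := ℂ) (Complex.ofRealCLM ∘L (EuclideanSpace.proj j) ∘L
    (ContinuousLinearMap.fst ℝ (Conf d) (Conf d)))
  exact this.smul hF

lemma fderiv_comp_dilate {a : Phase d → ℂ} (ha : Differentiable ℝ a) (s : ℝ) (p w : Phase d)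
    (j : Fin d) :
    fderiv ℝ (fun w => a (p + dilate s w)) w (dirXi j) = partialXi j a (p + dilate s w) := by
  have h1 : HasFDerivAt (fun w => p + dilate s w) (dilate s) w :=
    (dilate s).hasFDerivAt.const_add p
  have h2 := ((ha (p + dilate s w)).hasFDerivAt.comp w h1).fderiv
  have h3 : fderiv ℝ (fun w => a (p + dilate s w)) w (dirXi j) = _ :=
    congrArg (fun L => L (dirXi j)) h2
  rw [h3]
  simp [partialXi, dilate_apply, dirXi]

lemma fderiv_fst_eq_sum (a : Phase d → ℂ) (q : Phase d) (z : Conf d) :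
    fderiv ℝ a q (z, 0) = ∑ j, ((z j : ℝ) : ℂ) * partialX j a q := by
  rw [pair_zero_eq_sum, map_sum]
  refine Finset.sum_congr rfl fun j _ => ?_
  rw [map_smul, Complex.real_smul]
  rfl

lemma isOscAmp_fderiv_fst {m s : ℝ} {a : Phase d → ℂ} (ha : IsUnifSymbol m a)
    (hs : |s| ≤ 1) (p : Phase d) :
    IsOscAmp (1 + peetreOrder m) (fun w => fderiv ℝ a (p + dilate s w) (w.1, 0)) := by
  simp only [fderiv_fst_eq_sum]
  exact IsOscAmp.sum _ fun j _ => isOscAmp_coord_mul ((ha.partialX j).comp_dilate hs p) j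

/-- The left amplitude is the s-derivative of the sheared amplitude, ∑ z_j ∂_{x_j} a. Each z_j
becomes -i∂_{ζ_j}, and since ζ is not dilated this is exactly -i∂_{ξ_j}, with no factor s. -/
lemma osc_fderiv_fst {m s : ℝ} {a : Phase d → ℂ} (ha : IsUnifSymbol m a)
    (hs : |s| ≤ 1) (p : Phase d) :
    osc (fun w => fderiv ℝ a (p + dilate s w) (w.1, 0)) =
      osc (fun w => mixedOp a (p + dilate s w)) := by
  have hX : ∀ j, IsOscAmp (peetreOrder m) (fun w => partialX j a (p + dilate s w)) :=
    fun j => (ha.partialX j).comp_dilate hs p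
  simp only [fderiv_fst_eq_sum]
  rw [osc_sum _ fun j _ => isOscAmp_coord_mul (hX j) j]
  unfold mixedOp
  have h := osc_sum Finset.univ fun j _ =>
    (((ha.partialX j).partialXi j).comp_dilate hs p).const_smul (-Complex.I)
  simp only [smul_eq_mul] at h
  rw [h]
  refine Finset.sum_congr rfl fun j _ => ?_
  rw [osc_coord_mul (hX j) j]
  congr 1 with w
  rw [fderiv_comp_dilate ((ha.partialX j).contDiff.differentiable (by simp))]

/-- The derivative of `(s, p) ↦ p + dilate s w`. -/
def shearDir (w : Phase d) : ℝ × Phase d →L[ℝ] Phase d :=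
  ContinuousLinearMap.snd ℝ ℝ (Phase d) +
    (ContinuousLinearMap.fst ℝ ℝ (Phase d)).smulRight ((w.1, 0) : Phase d)

lemma shearDir_apply (w : Phase d) (q : ℝ × Phase d) :
    shearDir w q = q.2 + q.1 • ((w.1, 0) : Phase d) := by
  simp [shearDir]

lemma hasFDerivAt_add_dilate (w : Phase d) (q : ℝ × Phase d) :
    HasFDerivAt (fun q : ℝ × Phase d => q.2 + dilate q.1 w) (shearDir w) q := by
  have h1 : HasFDerivAt (fun q : ℝ × Phase d => q.2 + (q.1 • ((w.1, 0) : Phase d) + (0, w.2)))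
      (shearDir w) q := by
    refine HasFDerivAt.add hasFDerivAt_snd (HasFDerivAt.add_const _ ?_)
    exact hasFDerivAt_fst.smul_const _
  refine h1.congr_of_eventuallyEq (Eventually.of_forall fun q => ?_)
  simp [dilate_apply]

lemma derivBound_shearDir (d N : ℕ) : ∃ C, 0 ≤ C ∧ ∀ n ≤ N, ∀ w,
    ContDiff ℝ ∞ (shearDir : Phase d → _) ∧
    ‖iteratedFDeriv ℝ n (shearDir : Phase d → _) w‖ ≤ growth 1 C w := by
  set Λ : Phase d →L[ℝ] (ℝ × Phase d →L[ℝ] Phase d) :=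
    (ContinuousLinearMap.smulRightL ℝ (ℝ × Phase d) (Phase d)
      (ContinuousLinearMap.fst ℝ ℝ (Phase d))) ∘L
      ((ContinuousLinearMap.fst ℝ (Conf d) (Conf d)).prod 0) with hΛ
  have h := (derivBound_const (E := Phase d) N (ContinuousLinearMap.snd ℝ ℝ (Phase d))).add
    (derivBound_clm N Λ)
  have e : (shearDir : Phase d → _) = fun w => ContinuousLinearMap.snd ℝ ℝ (Phase d) + Λ w := by
    ext1 w
    rfl
  refine ⟨‖ContinuousLinearMap.snd ℝ ℝ (Phase d)‖ + ‖Λ‖, by positivity, fun n hn w => ?_⟩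
  rw [e]
  refine ⟨h.1, (h.2 n hn w).trans ?_⟩
  simp only [growth, pow_one]
  nlinarith [norm_nonneg w, norm_nonneg (ContinuousLinearMap.snd ℝ ℝ (Phase d)),
    mul_nonneg (norm_nonneg w) (norm_nonneg (ContinuousLinearMap.snd ℝ ℝ (Phase d)))]

lemma exists_derivBound_comp {E V W X : Type*} [NormedAddCommGroup E] [NormedSpace ℝ E]
    [NormedAddCommGroup V] [NormedSpace ℝ V] [NormedAddCommGroup W] [NormedSpace ℝ W]
    [NormedAddCommGroup X] [NormedSpace ℝ X] (N : ℕ) : ∃ K : ℝ, 0 ≤ K ∧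
    ∀ (ρ ρ' : E → ℝ) (F : E → V →L[ℝ] W) (G : E → X →L[ℝ] V), DerivBound N ρ F →
      DerivBound N ρ' G →
      DerivBound N (fun w => K * (ρ w * ρ' w)) (fun w => (F w).comp (G w)) := by
  refine ⟨2 ^ N, by positivity, fun ρ ρ' F G hF hG => ?_⟩
  refine (hF.bilin (ContinuousLinearMap.compL ℝ X V W) hG).mono fun w => ?_
  have h0 : 0 ≤ 2 ^ N * (ρ w * ρ' w) := mul_nonneg (by positivity)
    (mul_nonneg (hF.nonneg w) (hG.nonneg w))
  exact mul_le_of_le_one_left h0 (ContinuousLinearMap.norm_compL_le ℝ X V W)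

/-- Joint differentiability of `(s, p) ↦ shear s a p`. -/
lemma hasFDerivAt_shear_joint {m s : ℝ} {a : Phase d → ℂ} (ha : IsUnifSymbol m a)
    (hs : |s| < 1) (p : Phase d) :
    HasFDerivAt (fun q : ℝ × Phase d => shear q.1 a q.2)
      ((fderiv ℝ (shear s a) p).comp (ContinuousLinearMap.snd ℝ ℝ (Phase d)) +
        (ContinuousLinearMap.fst ℝ ℝ (Phase d)).smulRight (shear s (mixedOp a) p)) (s, p) := by
  -- The extra order of growth comes from the factor z that differentiation in s produces.
  set k := 1 + peetreOrder m with hk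
  obtain ⟨C, hC0, hC⟩ := ha.exists_derivBound_near (oscOrder d k) p
  obtain ⟨C', hC0', hC'⟩ := ha.fderiv.exists_derivBound_near (oscOrder d k) p
  obtain ⟨C₁, hC₁, hΛ⟩ := derivBound_shearDir d (oscOrder d k)
  have hΛ' : DerivBound (oscOrder d k) (growth 1 C₁) (shearDir : Phase d → _) :=
    ⟨(hΛ 0 (Nat.zero_le _) 0).1, fun n hn w => (hΛ n hn w).2⟩
  obtain ⟨K, hK, hcomp⟩ := exists_derivBound_comp (E := Phase d) (V := Phase d) (W := ℂ)
    (X := ℝ × Phase d) (oscOrder d k)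
  set C₂ := K * (C' * C₁) with hC₂
  have hnear : {q : ℝ × Phase d | |q.1| < 1} ∩ {q | q.2 ∈ Metric.ball p 1} ∈ 𝓝 (s, p) := by
    refine IsOpen.mem_nhds (IsOpen.inter ?_ ?_) ⟨hs, Metric.mem_ball_self one_pos⟩
    · exact isOpen_lt (by fun_prop) continuous_const
    · exact Metric.isOpen_ball.preimage continuous_snd
  have hbound : ∀ q ∈ {q : ℝ × Phase d | |q.1| < 1} ∩ {q | q.2 ∈ Metric.ball p 1},
      DerivBound (oscOrder d k) (growth k (max C C₂))
        (fun w => (fderiv ℝ a (q.2 + dilate q.1 w)).comp (shearDir w)) := fun q hq => by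
    have h1 := hC' q.1 hq.1.le q.2 (Metric.ball_subset_closedBall hq.2)
    refine (hcomp _ _ _ _ h1 hΛ').mono fun w => by
      simp only [growth]
      calc _ = C₂ * (1 + ‖w‖) ^ k := by rw [hC₂, hk, pow_add]; ring
        _ ≤ _ := by gcongr; exact le_max_right _ _
  have key := hasFDerivAt_osc (p := k) (C := max C C₂) (θ := (s, p))
    (F := fun (q : ℝ × Phase d) w => a (q.2 + dilate q.1 w))
    (F' := fun (q : ℝ × Phase d) w => (fderiv ℝ a (q.2 + dilate q.1 w)).comp (shearDir w))
    hnear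
    (fun q hq => by
      refine ((hC q.1 hq.1.le q.2 (Metric.ball_subset_closedBall hq.2)).growth_mono
        (by omega : peetreOrder m ≤ k)).mono fun w => ?_
      unfold growth; gcongr; exact le_max_left _ _)
    hbound
    (fun q _ w => by
      have h1 := (ha.contDiff.differentiable (by simp) (q.2 + dilate q.1 w)).hasFDerivAt
      exact h1.comp q (hasFDerivAt_add_dilate w q))
  have key2 := key.const_smul (((2 * Real.pi : ℂ) ^ d)⁻¹)
  refine key2.congr_fderiv ?_
  refine ContinuousLinearMap.ext fun r => ?_
  have e1 := osc_clm (evalCLM ℂ r) (hbound (s, p) (mem_of_mem_nhds hnear))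
  simp only [evalCLM_apply] at e1
  -- Evaluated on r = (r.1, r.2), the derivative splits into a base-point part, which is the
  -- derivative of the shear, and an s-part, which `osc_fderiv_fst` converts into `mixedOp`.
  have e2 : (fun w => ((fderiv ℝ a (p + dilate s w)).comp (shearDir w)) r) =
      fun w => fderiv ℝ a (p + dilate s w) r.2 +
        (r.1 : ℂ) • fderiv ℝ a (p + dilate s w) (w.1, 0) := by
    ext w
    rw [ContinuousLinearMap.comp_apply, shearDir_apply, map_add, map_smul, Complex.coe_smul]
  have h1 : IsOscAmp k (fun w => fderiv ℝ a (p + dilate s w) r.2) :=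
    ((ha.fderiv_apply r.2).comp_dilate hs.le p).mono (by omega)
  have h2 := isOscAmp_fderiv_fst ha hs.le p
  rw [e2, osc_add' h1 (h2.const_smul _), osc_smul' _ h2, osc_fderiv_fst ha hs.le p] at e1
  rw [smul_apply, ← e1, add_apply,
    ContinuousLinearMap.comp_apply, ContinuousLinearMap.smulRight_apply,
    ContinuousLinearMap.coe_snd', ContinuousLinearMap.coe_fst', fderiv_shear_apply ha hs.le,
    shear, shear, smul_add, ← Complex.coe_smul, smul_comm (r.1 : ℂ)]

lemma hasDerivAt_shear {m s : ℝ} {a : Phase d → ℂ} (ha : IsUnifSymbol m a)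
    (hs : |s| < 1) (p : Phase d) :
    HasDerivAt (fun s => shear s a p) (shear s (mixedOp a) p) s := by
  have h1 : HasDerivAt (fun s : ℝ => (s, p)) ((1 : ℝ), (0 : Phase d)) s :=
    (hasDerivAt_id s).prodMk (hasDerivAt_const s p)
  have := (hasFDerivAt_shear_joint ha hs p).comp_hasDerivAt s h1
  refine this.congr_deriv ?_
  simp

/-- The Taylor remainder of `s ↦ shear s a`. -/
def shearRem (k : ℕ) (s : ℝ) (a : Phase d → ℂ) (p : Phase d) : ℂ :=
  shear s a p - ∑ j ∈ Finset.range k, (s ^ j / (j.factorial : ℝ) : ℝ) • (mixedOp^[j] a) p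

/-- Differentiating lowers the order of the remainder by one and replaces a by `mixedOp a`; this is
the recursion behind Taylor's estimate. -/
lemma hasDerivAt_shearRem {m s : ℝ} {a : Phase d → ℂ} (ha : IsUnifSymbol m a)
    (hs : |s| < 1) (k : ℕ) (p : Phase d) :
    HasDerivAt (fun s => shearRem (k + 1) s a p) (shearRem k s (mixedOp a) p) s := by
  unfold shearRem
  refine (hasDerivAt_shear ha hs p).sub ?_
  have h1 : ∀ j ∈ Finset.range (k + 1), HasDerivAt
      (fun s : ℝ => (s ^ j / (j.factorial : ℝ) : ℝ) • (mixedOp^[j] a) p)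
      ((j * s ^ (j - 1) / (j.factorial : ℝ) : ℝ) • (mixedOp^[j] a) p) s := fun j _ =>
    ((hasDerivAt_pow j s).div_const _).smul_const _
  refine (HasDerivAt.fun_sum h1).congr_deriv ?_
  -- The j = 0 term is constant in s. Shifting the index turns (j + 1)/(j + 1)! into 1/j!.
  rw [Finset.sum_range_succ']
  simp only [Nat.cast_zero, zero_mul, zero_div, zero_smul, add_zero, Nat.add_sub_cancel]
  refine Finset.sum_congr rfl fun j _ => ?_
  rw [Function.iterate_succ_apply]
  congr 1
  rw [Nat.factorial_succ]
  have : (j.factorial : ℝ) ≠ 0 := by positivity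
  push_cast
  field_simp

lemma shearRem_zero {m : ℝ} {a : Phase d → ℂ} (ha : IsUnifSymbol m a) (k : ℕ) (p : Phase d) :
    shearRem (k + 1) 0 a p = 0 := by
  unfold shearRem
  rw [Finset.sum_range_succ', shear_zero ha]
  simp

end MagneticPsiDO
end

/-! ### Taylor estimate and change of quantization -/

noncomputable section
namespace MagneticPsiDO

open MeasureTheory Filter Topology

variable {d : ℕ} {V W : Type*} [NormedAddCommGroup V] [NormedSpace ℂ V] [NormedAddCommGroup W]
  [NormedSpace ℂ W]

/-- The Taylor remainder of order `k` gains `k` powers of `⟨ξ⟩`. -/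
lemma exists_norm_shearRem_le (k : ℕ) : ∀ (m : ℝ) (a : Phase d → ℂ),
    (∀ j : ℕ, j ≤ k → IsUnifSymbol (m - j) (mixedOp^[j] a)) →
    ∃ C, ∀ s : ℝ, |s| < 1 → ∀ p, ‖shearRem k s a p‖ ≤ C * bracket p.2 ^ (m - k) := by
  induction k with
  | zero =>
    intro m a h
    have ha := h 0 le_rfl
    simp only [Nat.cast_zero, sub_zero, Function.iterate_zero, id_eq] at ha
    obtain ⟨C, hC⟩ := ha.exists_derivBound_shear 0
    refine ⟨C, fun s hs p => ?_⟩
    simpa [shearRem] using (hC s hs.le).norm_le p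
  | succ k ih =>
    intro m a h
    have ha := h 0 (Nat.zero_le _)
    simp only [Nat.cast_zero, sub_zero, Function.iterate_zero, id_eq] at ha
    -- The generator lowers the order by one, so the induction hypothesis applies to `mixedOp a` at
    -- order m - 1.
    obtain ⟨C, hC⟩ := ih (m - 1) (mixedOp a) fun j hj => by
      have := h (j + 1) (by omega)
      rw [Function.iterate_succ_apply] at this
      convert this using 1
      push_cast; ring
    refine ⟨C, fun s hs p => ?_⟩
    have hmem : ∀ t : ℝ, t ∈ Set.Ioo (-1 : ℝ) 1 → |t| < 1 := fun t ht => abs_lt.mpr ht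
    -- The remainder vanishes at s = 0, so the mean value inequality bounds it by |s| < 1 times the
    -- bound on its derivative.
    have key := (convex_Ioo (-1 : ℝ) 1).norm_image_sub_le_of_norm_hasDerivWithin_le
      (f := fun s => shearRem (k + 1) s a p) (f' := fun s => shearRem k s (mixedOp a) p)
      (C := C * bracket p.2 ^ (m - 1 - k))
      (fun t ht => (hasDerivAt_shearRem ha (hmem t ht) k p).hasDerivWithinAt)
      (fun t ht => hC t (hmem t ht) p) (x := 0) (y := s) (by constructor <;> norm_num)
      (abs_lt.mp hs)
    simp only [shearRem_zero ha, sub_zero] at key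
    refine key.trans ?_
    have h0 : 0 ≤ C * bracket p.2 ^ (m - 1 - k) := (norm_nonneg _).trans (hC s hs p)
    have e : m - ((k + 1 : ℕ) : ℝ) = m - 1 - k := by push_cast; ring
    rw [e]
    exact mul_le_of_le_one_right h0 hs.le

/-- Differentiation of an oscillatory integral with respect to a real parameter. -/
lemma hasDerivAt_osc [CompleteSpace V] {p : ℕ} {C : ℝ}
    {F F' : ℝ → Phase d → V} {s : Set ℝ} {θ : ℝ} (hs : s ∈ 𝓝 θ)
    (hF : ∀ t ∈ s, DerivBound (oscOrder d p) (growth p C) (F t))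
    (hF' : ∀ t ∈ s, DerivBound (oscOrder d p) (growth p C) (F' t))
    (hd : ∀ t ∈ s, ∀ w, HasDerivAt (fun t => F t w) (F' t w) t) :
    HasDerivAt (fun t => osc (F t)) (osc (F' θ)) θ := by
  -- Identifies a vector with the linear map sending 1 to it, to pass between `HasDerivAt` and
  -- `HasFDerivAt`.
  set Λ : V →L[ℝ] (ℝ →L[ℝ] V) :=
    ContinuousLinearMap.smulRightL ℝ ℝ V (ContinuousLinearMap.id ℝ ℝ) with hΛ
  have hC : 0 ≤ C := (hF θ (mem_of_mem_nhds hs)).const_nonneg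
  have hΛF : ∀ t ∈ s, DerivBound (oscOrder d p) (growth p (max C (‖Λ‖ * C)))
      (fun w => Λ (F' t w)) := fun t ht => by
    refine ((hF' t ht).clm Λ).mono fun w => ?_
    unfold growth
    rw [← mul_assoc]
    gcongr
    exact le_max_right _ _
  have key := hasFDerivAt_osc (F := F) (F' := fun t w => Λ (F' t w)) hs
    (fun t ht => (hF t ht).mono (ρ' := growth p (max C (‖Λ‖ * C))) fun w => by
      unfold growth; gcongr; exact le_max_left _ _)
    hΛF (fun t ht w => by
      refine (hd t ht w).hasFDerivAt.congr_fderiv ?_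
      ext; simp [hΛ])
  refine key.hasDerivAt.congr_deriv ?_
  have e := osc_clm (evalCLM V (1 : ℝ)) (hΛF θ (mem_of_mem_nhds hs))
  rw [evalCLM_apply] at e
  rw [← e]
  congr 1 with w
  simp [hΛ, evalCLM_apply]

lemma exists_derivBound_schwartz_fst (v : 𝓢(Conf d, ℂ)) (x : Conf d) (N : ℕ) :
    ∃ C, DerivBound N (growth 0 C) (fun w : Phase d => v (x + w.1)) := by
  have h := (schwartz_derivBound 0 N v).comp_affine x (ContinuousLinearMap.fst ℝ (Conf d) (Conf d))
    (ContinuousLinearMap.norm_fst_le ℝ _ _)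
  exact ⟨_, h.mono fun w => by simp only [growth, pow_zero, inv_one, mul_one]; exact le_rfl⟩

/-- The amplitude `a (x + t z, ζ) v (x + z)`. -/
def quantAmp (x : Conf d) (v : 𝓢(Conf d, ℂ)) (t : ℝ) (a : Phase d → ℂ) (w : Phase d) : ℂ :=
  a (((x, 0) : Phase d) + dilate t w) * v (x + w.1)

lemma derivBound_quantAmp (x : Conf d) (v : 𝓢(Conf d, ℂ)) (m : ℝ) (N : ℕ) :
    ∃ K, 0 ≤ K ∧ ∀ (C : ℝ) (a : Phase d → ℂ), DerivBound N (fun p => C * bracket p.2 ^ m) a →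
      ∀ t : ℝ, |t| ≤ 1 → DerivBound N (growth (peetreOrder m) (K * C)) (quantAmp x v t a) := by
  obtain ⟨C', hC'⟩ := exists_derivBound_schwartz_fst v x N
  have hC'0 := hC'.const_nonneg
  have h0 : 0 ≤ bracket (0 : Conf d) ^ m := Real.rpow_nonneg (bracket_pos _).le _
  refine ⟨‖ContinuousLinearMap.mul ℝ ℂ‖ * (2 ^ N * (bracket (0 : Conf d) ^ m * C')),
    by positivity, fun C a ha t ht => ?_⟩
  have h1 := ha.comp_dilate ht ((x, 0) : Phase d)
  have h2 := h1.growth_bilin (ContinuousLinearMap.mul ℝ ℂ) hC'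
  exact h2.mono fun w => by simp only [growth, add_zero]; apply le_of_eq; ring

lemma IsUnifSymbol.quantAmp {m : ℝ} {a : Phase d → ℂ} (ha : IsUnifSymbol m a) (x : Conf d)
    (v : 𝓢(Conf d, ℂ)) {t : ℝ} (ht : |t| ≤ 1) : IsOscAmp (peetreOrder m) (quantAmp x v t a) :=
  fun N => by
    obtain ⟨C, hC⟩ := ha N
    obtain ⟨K, -, hK⟩ := derivBound_quantAmp x v m N
    exact ⟨_, hK C a hC t ht⟩

lemma fderiv_quantAmp {a : Phase d → ℂ} (ha : Differentiable ℝ a) (x : Conf d)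
    (v : 𝓢(Conf d, ℂ)) (t : ℝ) (j : Fin d) (w : Phase d) :
    fderiv ℝ (quantAmp x v t a) w (dirXi j) = quantAmp x v t (partialXi j a) w := by
  have h1 : HasFDerivAt (fun w => a (((x, 0) : Phase d) + dilate t w)) _ w :=
    (ha _).hasFDerivAt.comp w ((dilate t).hasFDerivAt.const_add ((x, 0) : Phase d))
  have h2 : HasFDerivAt (fun w : Phase d => v (x + w.1)) _ w :=
    (v.hasFDerivAt (x + w.1)).comp w (hasFDerivAt_fst.const_add x)
  have h3 := (h1.mul h2).fderiv
  have h4 : fderiv ℝ (quantAmp x v t a) w (dirXi j) = _ := congrArg (fun L => L (dirXi j)) h3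
  rw [h4]
  simp [quantAmp, partialXi, dirXi, dilate_apply, mul_comm]

lemma partialX_shear {m s : ℝ} {a : Phase d → ℂ} (ha : IsUnifSymbol m a) (hs : |s| ≤ 1)
    (j : Fin d) : partialX j (shear s a) = shear s (partialX j a) :=
  funext fun p => fderiv_shear_apply ha hs _ p

lemma partialXi_shear {m s : ℝ} {a : Phase d → ℂ} (ha : IsUnifSymbol m a) (hs : |s| ≤ 1)
    (j : Fin d) : partialXi j (shear s a) = shear s (partialXi j a) :=
  funext fun p => fderiv_shear_apply ha hs _ p

lemma shear_mixedOp {m s : ℝ} {a : Phase d → ℂ} (ha : IsUnifSymbol m a) (hs : |s| ≤ 1)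
    (p : Phase d) :
    shear s (mixedOp a) p = ∑ j, -Complex.I * shear s (partialXi j (partialX j a)) p := by
  have hamp := fun j => ((ha.partialX j).partialXi j).comp_dilate hs p
  unfold shear mixedOp
  have h := osc_sum Finset.univ fun j _ => (hamp j).const_smul (-Complex.I)
  simp only [smul_eq_mul] at h ⊢
  rw [h, Finset.mul_sum]
  refine Finset.sum_congr rfl fun j _ => ?_
  have h2 := osc_smul' (-Complex.I) (hamp j)
  simp only [smul_eq_mul] at h2
  rw [h2]
  ring

/-- The derivative in `s` of `quantAmp x v (τ - s) (shear s a)`. -/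
def quantAmpDeriv (x : Conf d) (v : 𝓢(Conf d, ℂ)) (τ : ℝ) (a : Phase d → ℂ) (s : ℝ)
    (w : Phase d) : ℂ :=
  quantAmp x v (τ - s) (shear s (mixedOp a)) w +
    ∑ j, -1 * (((w.1 j : ℝ) : ℂ) * quantAmp x v (τ - s) (shear s (partialX j a)) w)

lemma hasDerivAt_quantAmp {m : ℝ} {a : Phase d → ℂ} (ha : IsUnifSymbol m a) (x : Conf d)
    (v : 𝓢(Conf d, ℂ)) (τ : ℝ) {s : ℝ} (hs : |s| < 1) (w : Phase d) :
    HasDerivAt (fun s => quantAmp x v (τ - s) (shear s a) w) (quantAmpDeriv x v τ a s w) s := by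
  have h1 : HasDerivAt (fun s : ℝ => ((x, 0) : Phase d) + dilate (τ - s) w)
      ((-w.1, 0) : Phase d) s := by
    have h2 : HasDerivAt (fun s : ℝ => (x + (τ - s) • w.1, w.2))
        (((-1 : ℝ) • w.1, (0 : Conf d))) s := by
      refine HasDerivAt.prodMk ?_ (hasDerivAt_const _ _)
      refine HasDerivAt.const_add x (HasDerivAt.smul_const ?_ _)
      exact (hasDerivAt_id s).const_sub τ
    refine (h2.congr_deriv (by simp)).congr_of_eventuallyEq (Eventually.of_forall fun s => ?_)
    simp [dilate_apply]
  have h2 := (hasFDerivAt_shear_joint ha hs (((x, 0) : Phase d) + dilate (τ - s) w)).comp_hasDerivAt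
    s ((hasDerivAt_id s).prodMk h1)
  have h3 := h2.mul_const (v (x + w.1))
  refine h3.congr_deriv ?_
  have e : ((-w.1, 0) : Phase d) = -(w.1, 0) := by simp
  simp only [add_apply, ContinuousLinearMap.comp_apply,
    ContinuousLinearMap.smulRight_apply, ContinuousLinearMap.coe_snd', ContinuousLinearMap.coe_fst',
    one_smul, e, map_neg, fderiv_fst_eq_sum, partialX_shear ha hs.le]
  simp only [quantAmpDeriv, quantAmp, add_mul, neg_mul, Finset.sum_mul, one_mul,
    Finset.sum_neg_distrib, mul_assoc]
  ring

/-- The function v(x + z) does not depend on ζ, so integrating z_j by parts differentiates the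
symbol alone. This gives minus the `mixedOp` term, and the two contributions cancel. -/
lemma osc_quantAmpDeriv {m : ℝ} {a : Phase d → ℂ} (ha : IsUnifSymbol m a) (x : Conf d)
    (v : 𝓢(Conf d, ℂ)) (τ : ℝ) {s : ℝ} (hs : |s| ≤ 1) (hτ : |τ - s| ≤ 1) :
    osc (quantAmpDeriv x v τ a s) = 0 := by
  have h1 := (ha.mixedOp.shear hs).quantAmp x v hτ
  have h2 := fun j => ((ha.partialX j).shear hs).quantAmp x v hτ
  have h3 := fun j => isOscAmp_coord_mul (h2 j) j
  have h4 : ∀ j, osc (fun w : Phase d => -1 * (((w.1 j : ℝ) : ℂ) *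
      quantAmp x v (τ - s) (shear s (partialX j a)) w)) =
      -osc (fun w => -Complex.I *
        quantAmp x v (τ - s) (shear s (partialXi j (partialX j a))) w) := by
    intro j
    have e := osc_smul' (-1) (h3 j)
    simp only [smul_eq_mul] at e
    rw [e, osc_coord_mul (h2 j) j, neg_one_mul]
    congr 2 with w
    rw [fderiv_quantAmp (((ha.partialX j).shear hs).contDiff.differentiable (by simp)),
      partialXi_shear (ha.partialX j) hs]
  unfold quantAmpDeriv
  have h3' := fun j => (h3 j).const_smul (-1)
  simp only [smul_eq_mul] at h3'
  rw [osc_add' (h1.mono (by omega : _ ≤ 1 + peetreOrder m)) (IsOscAmp.sum _ fun j _ => h3' j),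
    osc_sum _ fun j _ => h3' j]
  simp only [h4]
  rw [Finset.sum_neg_distrib, add_neg_eq_zero]
  have h5 := fun j => ((((ha.partialX j).partialXi j).shear hs).quantAmp x v hτ).const_smul (-Complex.I)
  simp only [smul_eq_mul] at h5
  rw [← osc_sum _ fun j _ => h5 j]
  congr 1 with w
  simp only [quantAmp, shear_mixedOp ha hs, Finset.sum_mul, mul_assoc]

lemma exists_derivBound_quantAmp_shear {m : ℝ} {a : Phase d → ℂ} (ha : IsUnifSymbol m a)
    (x : Conf d) (v : 𝓢(Conf d, ℂ)) (N : ℕ) : ∃ C, ∀ s t : ℝ, |s| ≤ 1 → |t| ≤ 1 →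
      DerivBound N (growth (peetreOrder m) C) (quantAmp x v t (shear s a)) := by
  obtain ⟨C, hC⟩ := ha.exists_derivBound_shear N
  obtain ⟨K, -, hK⟩ := derivBound_quantAmp x v m N
  exact ⟨K * C, fun s t hs ht => hK C _ (hC s hs) t ht⟩

lemma derivBound_coord (N : ℕ) (j : Fin d) : ∃ C, DerivBound N (growth 1 C)
    (fun w : Phase d => ((w.1 j : ℝ) : ℂ)) :=
  isOscAmp_clm (V := ℂ) (Complex.ofRealCLM ∘L (EuclideanSpace.proj j) ∘L
    (ContinuousLinearMap.fst ℝ (Conf d) (Conf d))) N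

lemma exists_derivBound_quantAmpDeriv {m : ℝ} {a : Phase d → ℂ} (ha : IsUnifSymbol m a)
    (x : Conf d) (v : 𝓢(Conf d, ℂ)) (τ : ℝ) (N : ℕ) : ∃ C, ∀ s : ℝ, |s| ≤ 1 → |τ - s| ≤ 1 →
      DerivBound N (growth (1 + peetreOrder m) C) (quantAmpDeriv x v τ a s) := by
  obtain ⟨C, hC⟩ := exists_derivBound_quantAmp_shear ha.mixedOp x v N
  choose C₁ hC₁ using fun j => exists_derivBound_quantAmp_shear (ha.partialX j) x v N
  choose C₂ hC₂ using fun j : Fin d => derivBound_coord (d := d) N j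
  set M := ContinuousLinearMap.mul ℝ ℂ
  refine ⟨C + ∑ j, ‖M (-1)‖ * (‖M‖ * (2 ^ N * (C₂ j * C₁ j))), fun s hs hτ => ?_⟩
  have h1 := (hC s (τ - s) hs hτ).growth_mono (by omega : _ ≤ 1 + peetreOrder m)
  have h2 := DerivBound.sum Finset.univ fun j (_ : j ∈ Finset.univ) =>
    ((hC₂ j).growth_bilin M (hC₁ j s (τ - s) hs hτ)).clm (M (-1))
  refine (h1.add h2).mono fun w => ?_
  simp only [growth, ← mul_assoc]
  rw [← Finset.sum_mul, ← add_mul]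

/-- Change of quantization: the operator with amplitude `a((1 - τ) x + τ y, η)` is also the one
with amplitude `(shear c a)((1 - τ') x + τ' y, η)`, where `τ' = τ - c`. -/
lemma osc_quantAmp_shear {m : ℝ} {a : Phase d → ℂ} (ha : IsUnifSymbol m a) (x : Conf d)
    (v : 𝓢(Conf d, ℂ)) {τ c : ℝ} (hτ : |τ| < 1) (hc : |c| < 1) (hτc : |τ - c| < 1) :
    osc (quantAmp x v (τ - c) (shear c a)) = osc (quantAmp x v τ a) := by
  -- An interval containing 0 and c on which both the shear parameter t and the quantization
  -- parameter τ - t stay below 1 in absolute value.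
  set S : Set ℝ := Set.Ioo (-1) 1 ∩ Set.Ioo (τ - 1) (τ + 1) with hS
  have hSo : IsOpen S := isOpen_Ioo.inter isOpen_Ioo
  have hSc : Convex ℝ S := (convex_Ioo _ _).inter (convex_Ioo _ _)
  have hmem : ∀ t : ℝ, t ∈ S ↔ |t| < 1 ∧ |τ - t| < 1 := by
    intro t
    simp only [hS, Set.mem_inter_iff, Set.mem_Ioo, abs_lt]
    constructor <;> rintro ⟨⟨h1, h2⟩, h3, h4⟩ <;> refine ⟨⟨h1, h2⟩, by linarith, by linarith⟩
  set N := oscOrder d (1 + peetreOrder m)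
  obtain ⟨C, hC⟩ := exists_derivBound_quantAmp_shear ha x v N
  obtain ⟨C', hC'⟩ := exists_derivBound_quantAmpDeriv ha x v τ N
  have hder : ∀ s ∈ S, HasDerivAt (fun s => osc (quantAmp x v (τ - s) (shear s a))) 0 s := by
    intro s hs
    have := hasDerivAt_osc (p := 1 + peetreOrder m) (C := max C C')
      (F := fun s => quantAmp x v (τ - s) (shear s a)) (F' := quantAmpDeriv x v τ a)
      (hSo.mem_nhds hs)
      (fun t ht => by
        have ht' := (hmem t).mp ht
        refine ((hC t (τ - t) ht'.1.le ht'.2.le).growth_mono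
          (by omega : _ ≤ 1 + peetreOrder m)).mono fun w => ?_
        unfold growth; gcongr; exact le_max_left _ _)
      (fun t ht => by
        have ht' := (hmem t).mp ht
        refine (hC' t ht'.1.le ht'.2.le).mono fun w => ?_
        unfold growth; gcongr; exact le_max_right _ _)
      (fun t ht w => hasDerivAt_quantAmp ha x v τ ((hmem t).mp ht).1 w)
    rwa [osc_quantAmpDeriv ha x v τ ((hmem s).mp hs).1.le ((hmem s).mp hs).2.le] at this
  have key := hSc.norm_image_sub_le_of_norm_hasDerivWithin_le
    (f := fun s => osc (quantAmp x v (τ - s) (shear s a))) (f' := fun _ => 0) (C := 0)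
    (fun t ht => (hder t ht).hasDerivWithinAt) (fun t ht => by simp)
    (x := 0) (y := c) ((hmem 0).mpr ⟨by simp, by simpa using hτ⟩) ((hmem c).mpr ⟨hc, hτc⟩)
  rw [zero_mul] at key
  have := sub_eq_zero.mp (norm_le_zero_iff.mp key)
  simpa [shear_zero ha] using this

end MagneticPsiDO
end

noncomputable section
namespace MagneticPsiDO

open MeasureTheory Filter Topology

variable {d : ℕ}

/-! ### Left quantization on the Schwartz space -/

lemma DerivBound.comp_clm {E E' V : Type*} [NormedAddCommGroup E] [NormedSpace ℝ E]
    [NormedAddCommGroup E'] [NormedSpace ℝ E'] [NormedAddCommGroup V] [NormedSpace ℝ V]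
    {N : ℕ} {ρ : E → ℝ} {F : E → V} (h : DerivBound N ρ F) (L : E' →L[ℝ] E) :
    DerivBound N (fun w => max 1 ‖L‖ ^ N * ρ (L w)) (fun w => F (L w)) := by
  refine ⟨h.1.comp L.contDiff, fun n hn w => ?_⟩
  have e := L.iteratedFDeriv_comp_right (f := F) h.1 w (i := n) (mod_cast le_top)
  change ‖iteratedFDeriv ℝ n (F ∘ L) w‖ ≤ _
  rw [e]
  refine (ContinuousMultilinearMap.norm_compContinuousLinearMap_le _ _).trans ?_
  rw [Finset.prod_const, Finset.card_univ, Fintype.card_fin, mul_comm]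
  beta_reduce
  gcongr
  · calc ‖L‖ ^ n ≤ max 1 ‖L‖ ^ n := by gcongr; exact le_max_right _ _
      _ ≤ _ := pow_le_pow_right₀ (le_max_left _ _) hn
  · exact h.2 n hn _

/-- The amplitude `k(x, z) b(x, ζ) u(x + z)` of a left quantization. -/
def leftAmp (k : Phase d → ℂ) (b : Phase d → ℂ) (u : 𝓢(Conf d, ℂ)) (q : Conf d × Phase d) : ℂ :=
  k (q.1, q.2.1) * (b (q.1, q.2.2) * u (q.1 + q.2.1))

/-- The left quantization of `b` with kernel factor `k`. -/
def leftOp (k : Phase d → ℂ) (b : Phase d → ℂ) (u : 𝓢(Conf d, ℂ)) (x : Conf d) : ℂ :=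
  osc (fun w => leftAmp k b u (x, w))

lemma one_add_norm_pair_le (x z : Conf d) :
    1 + ‖((x, z) : Phase d)‖ ≤ 2 * ((1 + ‖x‖) * (1 + ‖x + z‖)) := by
  have h1 : ‖((x, z) : Phase d)‖ ≤ ‖x‖ + ‖z‖ := by
    rw [Prod.norm_def]
    exact max_le (by linarith [norm_nonneg z]) (by linarith [norm_nonneg x])
  have h2 : ‖z‖ ≤ ‖x + z‖ + ‖x‖ := by
    have := norm_sub_le (x + z) x
    simpa using this
  nlinarith [norm_nonneg x, norm_nonneg (x + z), mul_nonneg (norm_nonneg x) (norm_nonneg (x + z))]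

/-- The Schwartz seminorm controlling `P` powers and `N` derivatives. -/
def confSeminorm (d P N : ℕ) : Seminorm ℝ 𝓢(Conf d, ℂ) :=
  2 ^ P • (Finset.Iic (P, N)).sup (fun m => SchwartzMap.seminorm ℝ m.1 m.2)

lemma derivBound_confSeminorm (P N : ℕ) (u : 𝓢(Conf d, ℂ)) :
    DerivBound N (fun y => confSeminorm d P N u * ((1 + ‖y‖) ^ P)⁻¹) u := by
  refine (schwartz_derivBound P N u).mono fun y => ?_
  rw [confSeminorm, smul_apply]
  simp

/-- Growth of k in z is traded for decay of u(x + z), at the price of a power of 1 + ‖x‖. The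
exponent P is chosen before b and u; the later decay induction changes both and needs it fixed. -/
lemma exists_derivBound_leftAmp {k : Phase d → ℂ} (hk : k.HasTemperateGrowth) (m : ℝ) (N : ℕ) :
    ∃ P : ℕ, ∀ b : Phase d → ℂ, IsUnifSymbol m b → ∃ C, 0 ≤ C ∧ ∀ u : 𝓢(Conf d, ℂ),
      DerivBound N (fun q : Conf d × Phase d =>
        C * confSeminorm d P N u * (1 + ‖q.1‖) ^ P * (1 + ‖q.2‖) ^ peetreOrder m)
        (leftAmp k b u) := by
  obtain ⟨P, Ck, hCk, hkb⟩ := hk.norm_iteratedFDeriv_le_uniform N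
  have hk' : DerivBound N (fun w => Ck * (1 + ‖w‖) ^ P) k := ⟨hk.1, hkb⟩
  refine ⟨P, fun b hb => ?_⟩
  obtain ⟨Cb, hCb⟩ := hb N
  have hCb0 : 0 ≤ Cb :=
    nonneg_of_mul_nonneg_left (hCb.nonneg 0) (Real.rpow_pos_of_pos (bracket_pos _) _)
  set fx := ContinuousLinearMap.fst ℝ (Conf d) (Phase d)
  set fw := ContinuousLinearMap.snd ℝ (Conf d) (Phase d)
  set fz := (ContinuousLinearMap.fst ℝ (Conf d) (Conf d)).comp fw
  set fζ := (ContinuousLinearMap.snd ℝ (Conf d) (Conf d)).comp fw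
  set M := ContinuousLinearMap.mul ℝ ℂ
  set c₁ := max 1 ‖fx.prod fz‖ ^ N
  set c₂ := max 1 ‖fx.prod fζ‖ ^ N
  set c₃ := max 1 ‖fx + fz‖ ^ N
  have h0 : 0 ≤ bracket (0 : Conf d) ^ m := Real.rpow_nonneg (bracket_pos _).le _
  refine ⟨‖M‖ * (2 ^ N * (c₁ * (Ck * 2 ^ P) * (‖M‖ * (2 ^ N * (c₂ * (Cb * bracket (0 : Conf d) ^ m) *
    c₃))))), by positivity, fun u => ?_⟩
  have hu := derivBound_confSeminorm P N u
  have h := (hk'.comp_clm (fx.prod fz)).bilin M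
    ((hCb.comp_clm (fx.prod fζ)).bilin M (hu.comp_clm (fx + fz)))
  refine h.mono fun q => ?_
  have e1 : (1 + ‖(fx.prod fz) q‖) ^ P ≤ 2 ^ P * ((1 + ‖q.1‖) ^ P * (1 + ‖q.1 + q.2.1‖) ^ P) := by
    rw [← mul_pow, ← mul_pow]
    gcongr
    exact one_add_norm_pair_le _ _
  have e2 : bracket ((fx.prod fζ) q).2 ^ m ≤ bracket (0 : Conf d) ^ m *
      (1 + ‖q.2‖) ^ peetreOrder m := by
    have := bracket_add_rpow_le m 0 q.2.2
    rw [zero_add] at this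
    refine this.trans ?_
    gcongr
    exact norm_snd_le q.2
  have hS : 0 ≤ confSeminorm d P N u := apply_nonneg _ _
  have hbr : 0 ≤ bracket ((fx.prod fζ) q).2 ^ m := Real.rpow_nonneg (bracket_pos _).le _
  have e3 : (fx + fz) q = q.1 + q.2.1 := rfl
  have hpos : (1 + ‖q.1 + q.2.1‖) ^ P ≠ 0 := by positivity
  calc _ ≤ ‖M‖ * (2 ^ N * (c₁ * (Ck * (2 ^ P * ((1 + ‖q.1‖) ^ P * (1 + ‖q.1 + q.2.1‖) ^ P))) *
        (‖M‖ * (2 ^ N * (c₂ * (Cb * (bracket (0 : Conf d) ^ m * (1 + ‖q.2‖) ^ peetreOrder m)) *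
          (c₃ * (confSeminorm d P N u * ((1 + ‖(fx + fz) q‖) ^ P)⁻¹))))))) := by gcongr
    _ = _ := by
      rw [e3]
      field_simp

lemma DerivBound.slice {V : Type*} [NormedAddCommGroup V] [NormedSpace ℝ V] {N : ℕ}
    {ρ : Conf d × Phase d → ℝ} {G : Conf d × Phase d → V} (h : DerivBound N ρ G) (x : Conf d) :
    DerivBound N (fun w => ρ (x, w)) (fun w => G (x, w)) := by
  have := h.comp_affine (x, 0) (ContinuousLinearMap.inr ℝ (Conf d) (Phase d))
    (ContinuousLinearMap.norm_inr_le_one ℝ (Conf d) (Phase d))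
  simpa using this

lemma isOscAmp_leftAmp {k : Phase d → ℂ} (hk : k.HasTemperateGrowth) {m : ℝ} {b : Phase d → ℂ}
    (hb : IsUnifSymbol m b) (u : 𝓢(Conf d, ℂ)) (x : Conf d) :
    IsOscAmp (peetreOrder m) (fun w => leftAmp k b u (x, w)) := fun N => by
  obtain ⟨P, hP⟩ := exists_derivBound_leftAmp hk m N
  obtain ⟨C, -, hC⟩ := hP b hb
  exact ⟨C * confSeminorm d P N u * (1 + ‖x‖) ^ P, ((hC u).slice x).mono fun w => le_rfl⟩

lemma exists_norm_leftOp_le {k : Phase d → ℂ} (hk : k.HasTemperateGrowth) (m : ℝ) :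
    ∃ P N : ℕ, ∀ b : Phase d → ℂ, IsUnifSymbol m b → ∃ C, 0 ≤ C ∧ ∀ (u : 𝓢(Conf d, ℂ)) (x : Conf d),
      ‖leftOp k b u x‖ ≤ C * confSeminorm d P N u * (1 + ‖x‖) ^ P := by
  obtain ⟨C₀, hC₀, h₀⟩ := exists_norm_osc_le d (peetreOrder m) ℂ
  obtain ⟨P, hP⟩ := exists_derivBound_leftAmp hk m (oscOrder d (peetreOrder m))
  refine ⟨P, oscOrder d (peetreOrder m), fun b hb => ?_⟩
  obtain ⟨C, hC, h⟩ := hP b hb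
  refine ⟨C₀ * C, by positivity, fun u x => ?_⟩
  refine (h₀ (C * confSeminorm d P (oscOrder d (peetreOrder m)) u * (1 + ‖x‖) ^ P) _
    (((h u).slice x).mono fun w => le_rfl)).trans (le_of_eq ?_)
  ring

lemma hasFDerivAt_leftOp {k : Phase d → ℂ} (hk : k.HasTemperateGrowth) {m : ℝ} {b : Phase d → ℂ}
    (hb : IsUnifSymbol m b) (u : 𝓢(Conf d, ℂ)) (x : Conf d) :
    HasFDerivAt (leftOp k b u) (osc fun w => (fderiv ℝ (leftAmp k b u) (x, w)).comp
      (ContinuousLinearMap.inl ℝ (Conf d) (Phase d))) x := by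
  set N := oscOrder d (peetreOrder m)
  obtain ⟨P, hP⟩ := exists_derivBound_leftAmp hk m (N + 1)
  obtain ⟨C, hC, h⟩ := hP b hb
  set K := C * confSeminorm d P (N + 1) u with hK
  have hK0 : 0 ≤ K := mul_nonneg hC (apply_nonneg _ _)
  set pre : ((Conf d × Phase d) →L[ℝ] ℂ) →L[ℝ] (Conf d →L[ℝ] ℂ) :=
    (ContinuousLinearMap.compL ℝ (Conf d) (Conf d × Phase d) ℂ).flip
      (ContinuousLinearMap.inl ℝ (Conf d) (Phase d)) with hpre
  have hG := h u
  have hle : ∀ y ∈ Metric.closedBall x 1, (1 + ‖y‖) ^ P ≤ (2 + ‖x‖) ^ P := by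
    intro y hy
    have h1 : ‖y‖ ≤ ‖x‖ + 1 := by
      have h2 : ‖y - x‖ ≤ 1 := by rwa [← dist_eq_norm]
      have := norm_add_le x (y - x)
      rw [add_sub_cancel] at this
      linarith
    exact pow_le_pow_left₀ (by positivity) (by linarith) P
  refine hasFDerivAt_osc (p := peetreOrder m)
    (C := max (K * (2 + ‖x‖) ^ P) (‖pre‖ * (K * (2 + ‖x‖) ^ P))) (θ := x)
    (F := fun y w => leftAmp k b u (y, w))
    (F' := fun y w => (fderiv ℝ (leftAmp k b u) (y, w)).comp
      (ContinuousLinearMap.inl ℝ (Conf d) (Phase d)))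
    (Metric.closedBall_mem_nhds x one_pos) (fun y hy => ?_) (fun y hy => ?_) (fun y hy w => ?_)
  · refine ((hG.mono_order (Nat.le_succ N)).slice y).mono fun w => ?_
    unfold growth
    gcongr
    refine le_trans ?_ (le_max_left _ _)
    exact mul_le_mul_of_nonneg_left (hle y hy) hK0
  · refine ((hG.fderiv.slice y).clm pre).mono fun w => ?_
    unfold growth
    rw [← mul_assoc]
    gcongr
    refine le_trans ?_ (le_max_right _ _)
    exact mul_le_mul_of_nonneg_left (mul_le_mul_of_nonneg_left (hle y hy) hK0) (norm_nonneg _)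
  · have h1 := (hG.1.differentiable (by simp) (y, w)).hasFDerivAt
    exact HasFDerivAt.comp (g := leftAmp k b u) (f := fun y => (y, w)) y h1
      (hasFDerivAt_prodMk_left y w)

lemma hasTemperateGrowth_fderiv {E V : Type*} [NormedAddCommGroup E] [NormedSpace ℝ E]
    [NormedAddCommGroup V] [NormedSpace ℝ V] {f : E → V} (hf : f.HasTemperateGrowth) :
    (fderiv ℝ f).HasTemperateGrowth := by
  refine ⟨hf.1.fderiv_right (by simp), fun n => ?_⟩
  obtain ⟨P, C, h⟩ := hf.2 (n + 1)
  refine ⟨P, C, fun x => ?_⟩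
  rw [norm_iteratedFDeriv_fderiv]
  exact h x

lemma hasTemperateGrowth_partialX {k : Phase d → ℂ} (hk : k.HasTemperateGrowth) (j : Fin d) :
    (partialX j k).HasTemperateGrowth := by
  exact (ContinuousLinearMap.apply ℝ ℂ ((EuclideanSpace.single j 1, 0) : Phase d)).hasTemperateGrowth.comp
    (hasTemperateGrowth_fderiv hk)

/-- By Leibniz, an x-derivative yields amplitudes of the same form, with one of k, b, u
differentiated. All regularity of `leftOp` is obtained by induction on this closure. -/
lemma fderiv_leftAmp {k b : Phase d → ℂ} (hk : Differentiable ℝ k) (hb : Differentiable ℝ b)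
    (u : 𝓢(Conf d, ℂ)) (j : Fin d) (q : Conf d × Phase d) :
    fderiv ℝ (leftAmp k b u) q (EuclideanSpace.single j 1, 0) =
      leftAmp (partialX j k) b u q + (leftAmp k (partialX j b) u q +
        leftAmp k b (LineDeriv.lineDerivOp (EuclideanSpace.single j (1 : ℝ)) u) q) := by
  set fx := ContinuousLinearMap.fst ℝ (Conf d) (Phase d)
  set fw := ContinuousLinearMap.snd ℝ (Conf d) (Phase d)
  set fz := (ContinuousLinearMap.fst ℝ (Conf d) (Conf d)).comp fw
  set fζ := (ContinuousLinearMap.snd ℝ (Conf d) (Conf d)).comp fw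
  have h1 : HasFDerivAt (fun q => k ((fx.prod fz) q)) _ q :=
    (hk _).hasFDerivAt.comp q (fx.prod fz).hasFDerivAt
  have h2 : HasFDerivAt (fun q => b ((fx.prod fζ) q)) _ q :=
    (hb _).hasFDerivAt.comp q (fx.prod fζ).hasFDerivAt
  have h3 : HasFDerivAt (fun q => u ((fx + fz) q)) _ q :=
    (u.hasFDerivAt _).comp q (fx + fz).hasFDerivAt
  have h4 := (h1.mul (h2.mul h3)).fderiv
  have h5 : fderiv ℝ (leftAmp k b u) q (EuclideanSpace.single j 1, 0) = _ :=
    congrArg (fun L => L (EuclideanSpace.single j 1, 0)) h4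
  rw [h5]
  simp [leftAmp, partialX, fx, fw, fz, fζ, SchwartzMap.lineDerivOp_apply_eq_fderiv]
  ring

lemma fderiv_leftAmp_dirXi {k b : Phase d → ℂ} (hk : Differentiable ℝ k) (hb : Differentiable ℝ b)
    (u : 𝓢(Conf d, ℂ)) (j : Fin d) (x : Conf d) (w : Phase d) :
    fderiv ℝ (fun w => leftAmp k b u (x, w)) w (dirXi j) = leftAmp k (partialXi j b) u (x, w) := by
  set fz := ContinuousLinearMap.fst ℝ (Conf d) (Conf d)
  set fζ := ContinuousLinearMap.snd ℝ (Conf d) (Conf d)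
  have h1 : HasFDerivAt (fun w : Phase d => k (x, w.1)) _ w :=
    (hk _).hasFDerivAt.comp w ((hasFDerivAt_const x w).prodMk fz.hasFDerivAt)
  have h2 : HasFDerivAt (fun w : Phase d => b (x, w.2)) _ w :=
    (hb _).hasFDerivAt.comp w ((hasFDerivAt_const x w).prodMk fζ.hasFDerivAt)
  have h3 : HasFDerivAt (fun w : Phase d => u (x + w.1)) _ w :=
    (u.hasFDerivAt _).comp w (fz.hasFDerivAt.const_add x)
  have h4 := (h1.mul (h2.mul h3)).fderiv
  have h5 : fderiv ℝ (fun w => leftAmp k b u (x, w)) w (dirXi j) = _ :=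
    congrArg (fun L => L (dirXi j)) h4
  rw [h5]
  have e0 : fderiv ℝ k (x, w.1) ((0 : Conf d), (0 : Conf d)) = 0 := map_zero _
  simp [leftAmp, partialXi, dirXi, fz, fζ]
  linear_combination (b (x, w.2) * u (x + w.1)) * e0

end MagneticPsiDO
end

/-! ### Schwartz estimates for left quantizations -/

noncomputable section
namespace MagneticPsiDO

open MeasureTheory Filter Topology

variable {d : ℕ}

/-- `Φ u x` is bounded by a continuous Schwartz seminorm of `u` times the weight `g x`. -/
def SchwartzDom (g : Conf d → ℝ) (Φ : 𝓢(Conf d, ℂ) → Conf d → ℝ) : Prop :=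
  ∃ q : Seminorm ℝ 𝓢(Conf d, ℂ), Continuous q ∧ ∀ u x, Φ u x ≤ q u * g x

lemma SchwartzDom.mono {g : Conf d → ℝ} {Φ Ψ : 𝓢(Conf d, ℂ) → Conf d → ℝ}
    (h : SchwartzDom g Φ) (hle : ∀ u x, Ψ u x ≤ Φ u x) : SchwartzDom g Ψ := by
  obtain ⟨q, hq, hb⟩ := h
  exact ⟨q, hq, fun u x => (hle u x).trans (hb u x)⟩

lemma SchwartzDom.add {g : Conf d → ℝ} {Φ Ψ : 𝓢(Conf d, ℂ) → Conf d → ℝ}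
    (h₁ : SchwartzDom g Φ) (h₂ : SchwartzDom g Ψ) : SchwartzDom g (fun u x => Φ u x + Ψ u x) := by
  obtain ⟨q, hq, hb⟩ := h₁
  obtain ⟨r, hr, hc⟩ := h₂
  refine ⟨q + r, hq.add hr, fun u x => ?_⟩
  rw [add_apply, add_mul]
  exact add_le_add (hb u x) (hc u x)

lemma SchwartzDom.const_mul {g : Conf d → ℝ} {Φ : 𝓢(Conf d, ℂ) → Conf d → ℝ}
    (h : SchwartzDom g Φ) {c : ℝ} (hc : 0 ≤ c) : SchwartzDom g (fun u x => c * Φ u x) := by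
  obtain ⟨q, hq, hb⟩ := h
  refine ⟨c.toNNReal • q, ?_, fun u x => ?_⟩
  · change Continuous fun u => c.toNNReal • q u
    exact hq.const_smul _
  · have : (c.toNNReal • q) u = c * q u := by
      change (c.toNNReal : ℝ) * q u = _
      rw [Real.coe_toNNReal c hc]
    rw [this, mul_assoc]
    exact mul_le_mul_of_nonneg_left (hb u x) hc

lemma SchwartzDom.sum {ι : Type*} (s : Finset ι) {g : Conf d → ℝ}
    {Φ : ι → 𝓢(Conf d, ℂ) → Conf d → ℝ} (h : ∀ i ∈ s, SchwartzDom g (Φ i)) :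
    SchwartzDom g (fun u x => ∑ i ∈ s, Φ i u x) := by
  classical
  induction s using Finset.induction_on with
  | empty => exact ⟨0, continuous_const, fun u x => by simp⟩
  | insert a s ha ih =>
    simp only [Finset.sum_insert ha]
    exact (h a (by simp)).add (ih fun i hi => h i (by simp [hi]))

lemma SchwartzDom.comp {g : Conf d → ℝ} {Φ : 𝓢(Conf d, ℂ) → Conf d → ℝ}
    (h : SchwartzDom g Φ) (T : 𝓢(Conf d, ℂ) →L[ℝ] 𝓢(Conf d, ℂ)) :
    SchwartzDom g (fun u x => Φ (T u) x) := by
  obtain ⟨q, hq, hb⟩ := h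
  exact ⟨q.comp T.toLinearMap, hq.comp T.continuous, fun u x => hb (T u) x⟩

lemma continuous_confSeminorm (P N : ℕ) : Continuous (confSeminorm d P N) := by
  have h1 : Continuous ((Finset.Iic (P, N)).sup
      (fun m => SchwartzMap.seminorm ℝ m.1 m.2) : Seminorm ℝ 𝓢(Conf d, ℂ)) :=
    ((schwartz_withSeminorms ℝ (Conf d) ℂ).finset_sups.continuous_seminorm (Finset.Iic (P, N)))
  exact h1.const_smul ((2 : ℕ) ^ P)

/-! #### Derivatives and multiplication by coordinates -/

lemma fderiv_leftOp_single {k : Phase d → ℂ} (hk : k.HasTemperateGrowth) {m : ℝ} {b : Phase d → ℂ}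
    (hb : IsUnifSymbol m b) (u : 𝓢(Conf d, ℂ)) (x : Conf d) (j : Fin d) :
    fderiv ℝ (leftOp k b u) x (EuclideanSpace.single j 1) =
      leftOp (partialX j k) b u x + (leftOp k (partialX j b) u x +
        leftOp k b (LineDeriv.lineDerivOp (EuclideanSpace.single j (1 : ℝ)) u) x) := by
  have hb' := hb.partialX j
  have hk' := hasTemperateGrowth_partialX hk j
  set pre : ((Conf d × Phase d) →L[ℝ] ℂ) →L[ℝ] (Conf d →L[ℝ] ℂ) :=
    (ContinuousLinearMap.compL ℝ (Conf d) (Conf d × Phase d) ℂ).flip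
      (ContinuousLinearMap.inl ℝ (Conf d) (Phase d)) with hpre
  have hF : IsOscAmp (peetreOrder m) (fun w => (fderiv ℝ (leftAmp k b u) (x, w)).comp
      (ContinuousLinearMap.inl ℝ (Conf d) (Phase d))) := fun N => by
    obtain ⟨P, hP⟩ := exists_derivBound_leftAmp hk m (N + 1)
    obtain ⟨C, hC, h⟩ := hP b hb
    refine ⟨‖pre‖ * (C * confSeminorm d P (N + 1) u * (1 + ‖x‖) ^ P),
      (((h u).fderiv.slice x).clm pre).mono fun w => ?_⟩
    unfold growth
    rw [mul_assoc ‖pre‖]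
  rw [(hasFDerivAt_leftOp hk hb u x).fderiv]
  have e := osc_clm' (evalCLM ℂ (EuclideanSpace.single j (1 : ℝ))) hF
  rw [evalCLM_apply] at e
  rw [← e]
  have e2 : (fun w : Phase d => evalCLM ℂ (EuclideanSpace.single j (1 : ℝ))
      ((fderiv ℝ (leftAmp k b u) (x, w)).comp (ContinuousLinearMap.inl ℝ (Conf d) (Phase d)))) =
      fun w => leftAmp (partialX j k) b u (x, w) + (leftAmp k (partialX j b) u (x, w) +
        leftAmp k b (LineDeriv.lineDerivOp (EuclideanSpace.single j (1 : ℝ)) u) (x, w)) := by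
    funext w
    rw [← fderiv_leftAmp (hk.1.differentiable (by simp)) (hb.contDiff.differentiable (by simp))]
    rfl
  rw [e2, osc_add' (isOscAmp_leftAmp hk' hb u x)
    ((isOscAmp_leftAmp hk hb' u x).add (isOscAmp_leftAmp hk hb _ x)),
    osc_add' (isOscAmp_leftAmp hk hb' u x) (isOscAmp_leftAmp hk hb _ x)]
  rfl

/-- The functional `c ↦ c dx_j`. -/
def coordForm (j : Fin d) : ℂ →L[ℝ] (Conf d →L[ℝ] ℂ) :=
  ContinuousLinearMap.smulRightL ℝ (Conf d) ℂ (EuclideanSpace.proj j)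

lemma fderiv_leftOp {k : Phase d → ℂ} (hk : k.HasTemperateGrowth) {m : ℝ} {b : Phase d → ℂ}
    (hb : IsUnifSymbol m b) (u : 𝓢(Conf d, ℂ)) :
    fderiv ℝ (leftOp k b u) = fun x => ∑ j, coordForm j
      (leftOp (partialX j k) b u x + (leftOp k (partialX j b) u x +
        leftOp k b (LineDeriv.lineDerivOp (EuclideanSpace.single j (1 : ℝ)) u) x)) := by
  funext x
  ext z
  simp_rw [← fderiv_leftOp_single hk hb u x]
  conv_lhs => rw [conf_eq_sum_single z]
  simp [coordForm]

/-- Since `fderiv_leftOp` expresses the derivative through operators of the same kind, the induction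
runs over all k, b and u simultaneously. -/
lemma contDiff_leftOp_nat (n : ℕ) {m : ℝ} {k : Phase d → ℂ} (hk : k.HasTemperateGrowth)
    {b : Phase d → ℂ} (hb : IsUnifSymbol m b) (u : 𝓢(Conf d, ℂ)) :
    ContDiff ℝ n (leftOp k b u) := by
  induction n generalizing k b u with
  | zero =>
    exact contDiff_zero.2 (continuous_iff_continuousAt.2 fun x =>
      (hasFDerivAt_leftOp hk hb u x).continuousAt)
  | succ n ih =>
    push_cast
    refine contDiff_succ_iff_fderiv.2
      ⟨fun x => (hasFDerivAt_leftOp hk hb u x).differentiableAt, by simp, ?_⟩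
    rw [fderiv_leftOp hk hb u]
    exact ContDiff.sum fun j _ => (coordForm j).contDiff.comp
      ((ih (hasTemperateGrowth_partialX hk j) hb u).add
        ((ih hk (hb.partialX j) u).add (ih hk hb _)))

lemma contDiff_leftOp {m : ℝ} {k : Phase d → ℂ} (hk : k.HasTemperateGrowth)
    {b : Phase d → ℂ} (hb : IsUnifSymbol m b) (u : 𝓢(Conf d, ℂ)) :
    ContDiff ℝ ∞ (leftOp k b u) :=
  contDiff_infty.2 fun n => contDiff_leftOp_nat n hk hb u

lemma hasTemperateGrowth_coord (j : Fin d) : (fun y : Conf d => y j).HasTemperateGrowth :=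
  (EuclideanSpace.proj (𝕜 := ℝ) j : Conf d →L[ℝ] ℝ).hasTemperateGrowth

/-- Write x_j = (x_j + z_j) - z_j. The first term multiplies u by its coordinate; the second is
integrated by parts in ζ_j, which meets only b. -/
lemma coord_mul_leftOp {k : Phase d → ℂ} (hk : k.HasTemperateGrowth) {m : ℝ} {b : Phase d → ℂ}
    (hb : IsUnifSymbol m b) (u : 𝓢(Conf d, ℂ)) (x : Conf d) (j : Fin d) :
    ((x j : ℝ) : ℂ) * leftOp k b u x =
      leftOp k b (SchwartzMap.smulLeftCLM ℂ (fun y : Conf d => y j) u) x +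
        Complex.I * leftOp k (partialXi j b) u x := by
  have h0 := isOscAmp_leftAmp hk hb u x
  have h1 := isOscAmp_leftAmp hk (hb.partialXi j) u x
  have h2 := isOscAmp_coord_mul h0 j
  have e1 := osc_coord_mul h0 j
  simp_rw [fderiv_leftAmp_dirXi (hk.1.differentiable (by simp))
    (hb.contDiff.differentiable (by simp))] at e1
  have e2 := osc_smul' (-Complex.I) h1
  have e3 := osc_smul' ((x j : ℝ) : ℂ) h0
  simp only [smul_eq_mul] at e2 e3
  have e4 := osc_add' (h0.const_smul ((x j : ℝ) : ℂ) |>.mono (Nat.le_add_left _ 1)) h2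
  have e5 : (fun w => ((x j : ℝ) : ℂ) • leftAmp k b u (x, w) +
      ((w.1 j : ℝ) : ℂ) * leftAmp k b u (x, w)) =
      fun w => leftAmp k b (SchwartzMap.smulLeftCLM ℂ (fun y : Conf d => y j) u) (x, w) := by
    funext w
    simp only [leftAmp, SchwartzMap.smulLeftCLM_apply_apply (hasTemperateGrowth_coord j),
      PiLp.add_apply, Complex.real_smul, smul_eq_mul]
    push_cast
    ring
  rw [e5] at e4
  simp only [smul_eq_mul] at e4
  unfold leftOp
  rw [e4, e3, e1, e2]
  ring

/-! #### Decay and continuity -/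

lemma norm_le_sum_abs (x : Conf d) : ‖x‖ ≤ ∑ j, |x j| := by
  conv_lhs => rw [conf_eq_sum_single x]
  refine (norm_sum_le _ _).trans (Finset.sum_le_sum fun j _ => ?_)
  rw [norm_smul]
  simp

/-- Each power of ‖x‖ is moved onto u and b by `coord_mul_leftOp`. The polynomial loss P is
independent of n, and for this reason it can be removed afterwards. -/
lemma exists_schwartzDom_leftOp {k : Phase d → ℂ} (hk : k.HasTemperateGrowth) (m : ℝ) :
    ∃ P : ℕ, ∀ (n : ℕ) (b : Phase d → ℂ), IsUnifSymbol m b →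
      SchwartzDom (fun x => (1 + ‖x‖) ^ P) (fun u x => ‖x‖ ^ n * ‖leftOp k b u x‖) := by
  obtain ⟨P, N, hPN⟩ := exists_norm_leftOp_le hk m
  refine ⟨P, fun n => ?_⟩
  induction n with
  | zero =>
    intro b hb
    obtain ⟨C, hC, h⟩ := hPN b hb
    have h1 : SchwartzDom (fun x : Conf d => (1 + ‖x‖) ^ P)
        (fun u x => confSeminorm d P N u * (1 + ‖x‖) ^ P) :=
      ⟨_, continuous_confSeminorm P N, fun u x => le_rfl⟩
    refine (h1.const_mul hC).mono fun u x => ?_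
    rw [pow_zero, one_mul, ← mul_assoc]
    exact h u x
  | succ n ih =>
    intro b hb
    have key : ∀ j : Fin d, SchwartzDom (fun x => (1 + ‖x‖) ^ P)
        (fun u x => ‖x‖ ^ n * ‖leftOp k b (SchwartzMap.smulLeftCLM ℂ (fun y : Conf d => y j) u) x‖ +
          ‖x‖ ^ n * ‖leftOp k (partialXi j b) u x‖) := fun j =>
      ((ih b hb).comp (SchwartzMap.smulLeftCLM ℂ (fun y : Conf d => y j))).add (ih _ (hb.partialXi j))
    refine (SchwartzDom.sum Finset.univ fun j _ => key j).mono fun u x => ?_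
    calc ‖x‖ ^ (n + 1) * ‖leftOp k b u x‖ = ‖x‖ ^ n * (‖x‖ * ‖leftOp k b u x‖) := by ring
      _ ≤ ‖x‖ ^ n * ((∑ j, |x j|) * ‖leftOp k b u x‖) := by
        gcongr
        exact norm_le_sum_abs x
      _ = ∑ j, ‖x‖ ^ n * ‖((x j : ℝ) : ℂ) * leftOp k b u x‖ := by
        rw [Finset.sum_mul, Finset.mul_sum]
        simp
      _ ≤ _ := by
        refine Finset.sum_le_sum fun j _ => ?_
        rw [coord_mul_leftOp hk hb u x j, ← mul_add]
        gcongr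
        refine (norm_add_le _ _).trans ?_
        simp

/-- The loss (1 + ‖x‖)^P is compensated by using the preceding estimate with both n and n + P; the
factor 2^P comes from `one_add_pow_le`. -/
lemma schwartzDom_leftOp {k : Phase d → ℂ} (hk : k.HasTemperateGrowth) {m : ℝ} {b : Phase d → ℂ}
    (hb : IsUnifSymbol m b) (n : ℕ) :
    SchwartzDom (fun _ => 1) (fun u x => ‖x‖ ^ n * ‖leftOp k b u x‖) := by
  obtain ⟨P, hP⟩ := exists_schwartzDom_leftOp hk m
  obtain ⟨q, hq, h⟩ := ((hP n b hb).add (hP (n + P) b hb)).const_mul (c := 2 ^ P) (by positivity)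
  refine ⟨q, hq, fun u x => ?_⟩
  have hpos : 0 < (1 + ‖x‖) ^ P := by positivity
  rw [mul_one]
  refine le_of_mul_le_mul_right ?_ hpos
  refine le_trans ?_ (h u x)
  calc ‖x‖ ^ n * ‖leftOp k b u x‖ * (1 + ‖x‖) ^ P
      ≤ ‖x‖ ^ n * ‖leftOp k b u x‖ * (2 ^ P * (1 + ‖x‖ ^ P)) := by
        gcongr
        exact one_add_pow_le _ (norm_nonneg x) P
    _ = _ := by ring

lemma schwartzDom_iteratedFDeriv_leftOp (N : ℕ) {k : Phase d → ℂ} (hk : k.HasTemperateGrowth) {m : ℝ}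
    {b : Phase d → ℂ} (hb : IsUnifSymbol m b) (n : ℕ) :
    SchwartzDom (fun _ => 1) (fun u x => ‖x‖ ^ n * ‖iteratedFDeriv ℝ N (leftOp k b u) x‖) := by
  induction N generalizing k b with
  | zero => simpa only [norm_iteratedFDeriv_zero] using schwartzDom_leftOp hk hb n
  | succ N ih =>
    set D : Fin d → 𝓢(Conf d, ℂ) →L[ℝ] 𝓢(Conf d, ℂ) := fun j =>
      LineDeriv.lineDerivOpCLM ℝ 𝓢(Conf d, ℂ) (EuclideanSpace.single j (1 : ℝ)) with hD
    have key : ∀ j : Fin d, SchwartzDom (fun _ => 1) (fun u x => ‖coordForm j‖ *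
        (‖x‖ ^ n * ‖iteratedFDeriv ℝ N (leftOp (partialX j k) b u) x‖ +
          (‖x‖ ^ n * ‖iteratedFDeriv ℝ N (leftOp k (partialX j b) u) x‖ +
            ‖x‖ ^ n * ‖iteratedFDeriv ℝ N (leftOp k b (D j u)) x‖))) := fun j =>
      ((ih (hasTemperateGrowth_partialX hk j) hb).add
        ((ih hk (hb.partialX j)).add ((ih hk hb).comp (D j))))
          |>.const_mul (norm_nonneg (coordForm j : ℂ →L[ℝ] (Conf d →L[ℝ] ℂ)))
    refine (SchwartzDom.sum Finset.univ fun j _ => key j).mono fun u x => ?_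
    have c1 := fun j : Fin d => contDiff_leftOp_nat N (hasTemperateGrowth_partialX hk j) hb u
    have c2 := fun j : Fin d => contDiff_leftOp_nat N hk (hb.partialX j) u
    have c3 := fun j : Fin d => contDiff_leftOp_nat N hk hb (D j u)
    have e0 := iteratedFDeriv_fun_sum_apply (u := Finset.univ) (x := x) fun j _ =>
      ((coordForm j).contDiff.comp ((c1 j).add ((c2 j).add (c3 j)))).contDiffAt
    rw [← norm_iteratedFDeriv_fderiv, fderiv_leftOp hk hb u]
    refine (congrArg (fun t => ‖x‖ ^ n * ‖t‖) e0).le.trans ?_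
    refine (mul_le_mul_of_nonneg_left (norm_sum_le _ _) (by positivity)).trans ?_
    rw [Finset.mul_sum]
    refine Finset.sum_le_sum fun j _ => ?_
    rw [← mul_add, ← mul_add, mul_left_comm]
    refine mul_le_mul_of_nonneg_left ?_ (by positivity)
    refine ((coordForm j).norm_iteratedFDeriv_comp_left
      ((c1 j).add ((c2 j).add (c3 j))).contDiffAt le_rfl).trans ?_
    refine mul_le_mul_of_nonneg_left ?_ (norm_nonneg _)
    have e1 := iteratedFDeriv_add_apply (c1 j).contDiffAt (x := x) ((c2 j).add (c3 j)).contDiffAt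
    have e2 := iteratedFDeriv_add_apply (c2 j).contDiffAt (x := x) (c3 j).contDiffAt
    change ‖iteratedFDeriv ℝ N (leftOp (partialX j k) b u + (leftOp k (partialX j b) u +
      leftOp k b (D j u))) x‖ ≤ _
    refine (congrArg norm e1).le.trans ((norm_add_le _ _).trans (add_le_add le_rfl ?_))
    exact (congrArg norm e2).le.trans (norm_add_le _ _)

/-- The left quantization as a continuous operator on the Schwartz space. -/
def leftOpCLM {k : Phase d → ℂ} (hk : k.HasTemperateGrowth) {m : ℝ} {b : Phase d → ℂ}
    (hb : IsUnifSymbol m b) : 𝓢(Conf d, ℂ) →L[ℂ] 𝓢(Conf d, ℂ) :=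
  SchwartzMap.mkCLM (σ := RingHom.id ℂ) (leftOp k b)
    (fun u v x => by
      have := osc_add' (isOscAmp_leftAmp hk hb u x) (isOscAmp_leftAmp hk hb v x)
      unfold leftOp
      rw [← this]
      congr 1
      funext w
      simp only [leftAmp, add_apply]
      ring)
    (fun c u x => by
      have := osc_smul' c (isOscAmp_leftAmp hk hb u x)
      unfold leftOp
      rw [RingHom.id_apply, ← this]
      congr 1
      funext w
      simp only [leftAmp, smul_apply, smul_eq_mul]
      ring)
    (fun u => contDiff_leftOp hk hb u)
    (fun n => by
      obtain ⟨q, hq, h⟩ := schwartzDom_iteratedFDeriv_leftOp n.2 hk hb n.1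
      -- A continuous seminorm is dominated by finitely many Schwartz seminorms, the form
      -- `SchwartzMap.mkCLM` asks for. Real and complex seminorms have the same values.
      obtain ⟨s, C, -, hs⟩ := Seminorm.bound_of_continuous (schwartz_withSeminorms ℝ (Conf d) ℂ) q hq
      refine ⟨s, C, C.2, fun u x => (h u x).trans ?_⟩
      rw [mul_one]
      refine (hs u).trans (le_of_eq ?_)
      change (C : ℝ) * _ = _
      congr 1
      rw [Seminorm.finset_sup_apply, Seminorm.finset_sup_apply]
      rfl)

lemma leftOpCLM_apply {k : Phase d → ℂ} (hk : k.HasTemperateGrowth) {m : ℝ} {b : Phase d → ℂ}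
    (hb : IsUnifSymbol m b) (u : 𝓢(Conf d, ℂ)) (x : Conf d) :
    leftOpCLM hk hb u x = osc (fun w => leftAmp k b u (x, w)) := rfl

end MagneticPsiDO
end

noncomputable section
namespace MagneticPsiDO

open MeasureTheory Filter Topology

variable {d : ℕ}

/-! ### The magnetic phase factor -/

section ParametricIntegral

variable {Q V : Type} [NormedAddCommGroup Q] [NormedSpace ℝ Q] [NormedAddCommGroup V]
  [NormedSpace ℝ V]

/-- The derivative of `F : ℝ × Q → V` in the second variable. -/
def fderivSnd (F : ℝ × Q → V) (p : ℝ × Q) : Q →L[ℝ] V :=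
  (fderiv ℝ F p).comp (ContinuousLinearMap.inr ℝ ℝ Q)

lemma hasTemperateGrowth_fderivSnd {F : ℝ × Q → V} (hF : F.HasTemperateGrowth) :
    (fderivSnd F).HasTemperateGrowth :=
  ((ContinuousLinearMap.compL ℝ Q (ℝ × Q) V).flip
    (ContinuousLinearMap.inr ℝ ℝ Q)).hasTemperateGrowth.comp (hasTemperateGrowth_fderiv hF)

lemma exists_norm_le_of_mem_unitInterval {F : ℝ × Q → V} (hF : F.HasTemperateGrowth) :
    ∃ (P : ℕ) (C : ℝ), 0 ≤ C ∧ ∀ s ∈ Set.uIoc (0 : ℝ) 1, ∀ q, ‖F (s, q)‖ ≤ C * (1 + ‖q‖) ^ P := by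
  obtain ⟨P, C, hC, h⟩ := hF.norm_iteratedFDeriv_le_uniform 0
  refine ⟨P, C * 2 ^ P, by positivity, fun s hs q => ?_⟩
  have h1 := h 0 le_rfl (s, q)
  rw [norm_iteratedFDeriv_zero] at h1
  refine h1.trans ?_
  rw [mul_assoc, ← mul_pow]
  gcongr
  rw [Set.uIoc_of_le zero_le_one] at hs
  have h2 : ‖(s, q)‖ ≤ 1 + ‖q‖ := by
    rw [Prod.norm_def]
    refine max_le ?_ (by simp)
    rw [Real.norm_eq_abs, abs_of_pos hs.1]
    linarith [hs.2, norm_nonneg q]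
  linarith [norm_nonneg q]

lemma hasFDerivAt_integral_unitInterval {F : ℝ × Q → V} (hF : F.HasTemperateGrowth) (q : Q) :
    HasFDerivAt (fun q => ∫ s in (0 : ℝ)..1, F (s, q))
      (∫ s in (0 : ℝ)..1, fderivSnd F (s, q)) q := by
  have hF' := hasTemperateGrowth_fderivSnd hF
  obtain ⟨P, C, hC, h⟩ := exists_norm_le_of_mem_unitInterval hF'
  have c1 : ∀ y, Continuous fun s : ℝ => F (s, y) := fun y =>
    hF.1.continuous.comp (by fun_prop)
  have c2 : ∀ y, Continuous fun s : ℝ => fderivSnd F (s, y) := fun y =>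
    hF'.1.continuous.comp (by fun_prop)
  refine intervalIntegral.hasFDerivAt_integral_of_dominated_of_fderiv_le
    (s := Metric.ball q 1) (bound := fun _ => C * (2 + ‖q‖) ^ P)
    (F := fun y s => F (s, y)) (F' := fun y s => fderivSnd F (s, y))
    (Metric.ball_mem_nhds q one_pos) (Eventually.of_forall fun y => (c1 y).aestronglyMeasurable)
    ((c1 q).intervalIntegrable _ _) (c2 q).aestronglyMeasurable
    (Eventually.of_forall fun s hs y hy => ?_) (by simp) (Eventually.of_forall fun s hs y hy => ?_)
  · refine (h s hs y).trans ?_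
    have h1 : ‖y‖ ≤ ‖q‖ + 1 := by
      have h2 : ‖y - q‖ < 1 := by rwa [← dist_eq_norm]
      have := norm_add_le q (y - q)
      rw [add_sub_cancel] at this
      linarith
    exact mul_le_mul_of_nonneg_left (pow_le_pow_left₀ (by positivity) (by linarith) P) hC
  · exact HasFDerivAt.comp (g := F) (f := fun y => (s, y)) y
      (hF.1.differentiable (by simp) (s, y)).hasFDerivAt (hasFDerivAt_prodMk_right s y)

/-- Differentiation under the integral replaces F by `fderivSnd F`, again of temperate growth; the
target space changes, so the induction generalizes over it. -/
lemma contDiff_integral_unitInterval_nat (n : ℕ) {V : Type} [NormedAddCommGroup V]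
    [NormedSpace ℝ V] {F : ℝ × Q → V} (hF : F.HasTemperateGrowth) :
    ContDiff ℝ n (fun q => ∫ s in (0 : ℝ)..1, F (s, q)) ∧ ∃ (P : ℕ) (C : ℝ), ∀ q,
      ‖iteratedFDeriv ℝ n (fun q => ∫ s in (0 : ℝ)..1, F (s, q)) q‖ ≤ C * (1 + ‖q‖) ^ P := by
  induction n generalizing V with
  | zero =>
    refine ⟨contDiff_zero.2 (continuous_iff_continuousAt.2 fun q =>
      (hasFDerivAt_integral_unitInterval hF q).continuousAt), ?_⟩
    obtain ⟨P, C, hC, h⟩ := exists_norm_le_of_mem_unitInterval hF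
    refine ⟨P, C, fun q => ?_⟩
    rw [norm_iteratedFDeriv_zero]
    simpa using intervalIntegral.norm_integral_le_of_norm_le_const fun s hs => h s hs q
  | succ n ih =>
    have e : fderiv ℝ (fun q => ∫ s in (0 : ℝ)..1, F (s, q)) =
        fun q => ∫ s in (0 : ℝ)..1, fderivSnd F (s, q) :=
      funext fun q => (hasFDerivAt_integral_unitInterval hF q).fderiv
    obtain ⟨h1, P, C, h2⟩ := ih (hasTemperateGrowth_fderivSnd hF)
    refine ⟨?_, P, C, fun q => ?_⟩
    · push_cast
      refine contDiff_succ_iff_fderiv.2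
        ⟨fun q => (hasFDerivAt_integral_unitInterval hF q).differentiableAt, by simp, ?_⟩
      rw [e]
      exact h1
    · rw [← norm_iteratedFDeriv_fderiv, e]
      exact h2 q

lemma hasTemperateGrowth_integral_unitInterval {F : ℝ × Q → V} (hF : F.HasTemperateGrowth) :
    (fun q => ∫ s in (0 : ℝ)..1, F (s, q)).HasTemperateGrowth :=
  ⟨contDiff_infty.2 fun n => (contDiff_integral_unitInterval_nat n hF).1,
    fun n => (contDiff_integral_unitInterval_nat n hF).2⟩

end ParametricIntegral

/-- All derivatives have modulus one because the exponent is purely imaginary. -/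
lemma hasTemperateGrowth_cexp_neg_I_mul :
    (fun t : ℝ => Complex.exp (-Complex.I * t)).HasTemperateGrowth := by
  have hc : ContDiff ℝ ∞ (fun t : ℝ => Complex.exp (-Complex.I * t)) :=
    (contDiff_const.mul Complex.ofRealCLM.contDiff).cexp
  have hd : ∀ t : ℝ, HasDerivAt (fun t : ℝ => Complex.exp (-Complex.I * t))
      (-Complex.I * Complex.exp (-Complex.I * t)) t := fun t => by
    have h1 : HasDerivAt (fun t : ℝ => -Complex.I * (t : ℂ)) (-Complex.I * 1) t :=
      (Complex.ofRealCLM.hasDerivAt (x := t)).const_mul _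
    simpa [mul_comm] using h1.cexp
  have hi : ∀ n : ℕ, iteratedDeriv n (fun t : ℝ => Complex.exp (-Complex.I * t)) =
      fun t : ℝ => (-Complex.I) ^ n * Complex.exp (-Complex.I * t) := fun n => by
    induction n with
    | zero => simp
    | succ n ih =>
      rw [iteratedDeriv_succ, ih]
      funext t
      rw [((hd t).const_mul _).deriv]
      ring
  refine ⟨hc, fun n => ⟨0, 1, fun t => ?_⟩⟩
  rw [norm_iteratedFDeriv_eq_norm_iteratedDeriv, hi, norm_mul, norm_pow, norm_neg, Complex.norm_I,
    Complex.norm_exp]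
  simp

/-- `(x, z) ↦ ω^A(x, x + z)` is smooth with polynomially bounded derivatives. -/
lemma hasTemperateGrowth_omegaA {A : Conf d → Conf d} (hA : A.HasTemperateGrowth) :
    (fun p : Phase d => omegaA A p.1 (p.1 + p.2)).HasTemperateGrowth := by
  have h1 : (fun r : ℝ × Phase d => r.2.1 + r.1 • r.2.2).HasTemperateGrowth := by
    have f1 := (ContinuousLinearMap.fst ℝ ℝ (Phase d)).hasTemperateGrowth
    have f2 := ((ContinuousLinearMap.fst ℝ (Conf d) (Conf d)).comp
      (ContinuousLinearMap.snd ℝ ℝ (Phase d))).hasTemperateGrowth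
    have f3 := ((ContinuousLinearMap.snd ℝ (Conf d) (Conf d)).comp
      (ContinuousLinearMap.snd ℝ ℝ (Phase d))).hasTemperateGrowth
    exact f2.add (f1.smul f3)
  have h2 : (fun p : Phase d => gammaA A p.1 (p.1 + p.2)).HasTemperateGrowth := by
    have h3 := hasTemperateGrowth_integral_unitInterval
      (F := fun r : ℝ × Phase d => A (r.2.1 + r.1 • r.2.2)) (hA.comp h1)
    -- On the segment from x to x + z one has (1 - s)x + s(x + z) = x + sz.
    have e : (fun p : Phase d => gammaA A p.1 (p.1 + p.2)) =
        fun p => ∫ s in (0 : ℝ)..1, A (p.1 + s • p.2) := by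
      funext p
      unfold gammaA
      congr 1
      funext s
      congr 1
      module
    rw [e]
    exact h3
  have h3 : (fun p : Phase d => circulation A p.1 (p.1 + p.2)).HasTemperateGrowth := by
    have h4 := (innerSL ℝ).bilinear_hasTemperateGrowth (𝕜 := ℝ)
      (ContinuousLinearMap.snd ℝ (Conf d) (Conf d)).hasTemperateGrowth h2
    have e : (fun p : Phase d => circulation A p.1 (p.1 + p.2)) =
        fun p => inner ℝ p.2 (gammaA A p.1 (p.1 + p.2)) := by
      funext p
      unfold circulation
      rw [← inner_neg_left]
      congr 1
      abel
    rw [e]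
    exact h4
  exact hasTemperateGrowth_cexp_neg_I_mul.comp h3

lemma hasTemperateGrowth_omegaA_right {A : Conf d → Conf d} (hA : A.HasTemperateGrowth)
    (x : Conf d) : (omegaA A x).HasTemperateGrowth := by
  have h1 : (fun y : Conf d => ((x, y - x) : Phase d)).HasTemperateGrowth := by
    have h2 : (fun y : Conf d => ((x, -x) : Phase d) +
        ContinuousLinearMap.inr ℝ (Conf d) (Conf d) y).HasTemperateGrowth :=
      (Function.HasTemperateGrowth.const _).add (ContinuousLinearMap.hasTemperateGrowth _)
    convert h2 using 2 with y
    simp [sub_eq_neg_add]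
  convert (hasTemperateGrowth_omegaA hA).comp h1 using 1
  funext y
  simp

end MagneticPsiDO
end

noncomputable section
namespace MagneticPsiDO

open MeasureTheory Filter Topology

variable {d : ℕ}

/-! ### Monomials in commuting operators -/

section Monomials

variable {M : Type*} [Monoid M]

/-- The monomial `g_1^{α_1} ⋯ g_d^{α_d}`. -/
def monomialOp (g : Fin d → M) (α : Fin d → ℕ) : M :=
  ((List.finRange d).map fun j => g j ^ α j).prod

lemma list_prod_pow_add_single (g : Fin d → M) (hg : ∀ i j, Commute (g i) (g j)) (α : Fin d → ℕ)
    (i : Fin d) (l : List (Fin d)) (hl : l.Nodup) (hi : i ∈ l) :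
    (l.map fun j => g j ^ (α + Pi.single i 1 : Fin d → ℕ) j).prod = (l.map fun j => g j ^ α j).prod * g i := by
  induction l with
  | nil => simp at hi
  | cons a l ih =>
    rw [List.nodup_cons] at hl
    simp only [List.map_cons, List.prod_cons]
    have hcomm : Commute (l.map fun j => g j ^ α j).prod (g i) :=
      Commute.list_prod_left _ _ fun x hx => by
        obtain ⟨j, -, rfl⟩ := List.mem_map.1 hx
        exact (hg j i).pow_left _
    by_cases h : i = a
    · subst h
      have e : (l.map fun j => g j ^ (α + Pi.single i 1 : Fin d → ℕ) j) = l.map fun j => g j ^ α j := by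
        refine List.map_congr_left fun j hj => ?_
        have : j ≠ i := fun h => hl.1 (h ▸ hj)
        simp [this]
      rw [e]
      simp only [Pi.add_apply, Pi.single_eq_same, pow_succ]
      rw [mul_assoc, mul_assoc, hcomm.eq]
    · have hi' : i ∈ l := by simpa [h] using hi
      rw [ih hl.2 hi', ← mul_assoc]
      simp [Ne.symm h]

lemma monomialOp_add_single (g : Fin d → M) (hg : ∀ i j, Commute (g i) (g j)) (α : Fin d → ℕ)
    (i : Fin d) : monomialOp g (α + Pi.single i 1) = monomialOp g α * g i :=
  list_prod_pow_add_single g hg α i _ (List.nodup_finRange d) (List.mem_finRange i)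

lemma commute_monomialOp (g : Fin d → M) {x : M} (hx : ∀ i, Commute (g i) x) (α : Fin d → ℕ) :
    Commute (monomialOp g α) x :=
  Commute.list_prod_left _ _ fun y hy => by
    obtain ⟨j, -, rfl⟩ := List.mem_map.1 hy
    exact (hx j).pow_left _

lemma monomialOp_mul (g h : Fin d → M) (hgh : ∀ i j, Commute (g i) (h j)) (α : Fin d → ℕ) :
    monomialOp (fun j => g j * h j) α = monomialOp g α * monomialOp h α := by
  unfold monomialOp
  induction List.finRange d with
  | nil => simp
  | cons a l ih =>
    simp only [List.map_cons, List.prod_cons]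
    rw [ih, (hgh a a).mul_pow]
    have hcomm : Commute (l.map fun j => g j ^ α j).prod (h a ^ α a) :=
      Commute.list_prod_left _ _ fun x hx => by
        obtain ⟨j, -, rfl⟩ := List.mem_map.1 hx
        exact (hgh j a).pow_pow _ _
    simp only [mul_assoc]
    rw [← mul_assoc (h a ^ α a), ← hcomm.eq, mul_assoc]

lemma monomialOp_add (g : Fin d → M) (hg : ∀ i j, Commute (g i) (g j)) (α β : Fin d → ℕ) :
    monomialOp g (α + β) = monomialOp g α * monomialOp g β := by
  unfold monomialOp
  induction List.finRange d with
  | nil => simp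
  | cons a l ih =>
    simp only [List.map_cons, List.prod_cons]
    rw [ih, Pi.add_apply, pow_add]
    have hcomm : Commute (l.map fun j => g j ^ α j).prod (g a ^ β a) :=
      Commute.list_prod_left _ _ fun x hx => by
        obtain ⟨j, -, rfl⟩ := List.mem_map.1 hx
        exact (hg j a).pow_pow _ _
    simp only [mul_assoc]
    rw [← mul_assoc (g a ^ β a), ← hcomm.eq, mul_assoc]

/-- The multinomial theorem for commuting elements, with the unordered product identified with the
ordered one used by `monomialOp`. -/
lemma sum_pow_eq_sum_monomialOp {R : Type*} [Semiring R] (g : Fin d → R)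
    (hg : ∀ i j, Commute (g i) (g j)) (n : ℕ) :
    (∑ j, g j) ^ n = ∑ α ∈ Finset.piAntidiag (Finset.univ : Finset (Fin d)) n,
      (Nat.multinomial Finset.univ α : R) * monomialOp g α := by
  rw [Finset.sum_pow_eq_sum_piAntidiag_of_commute _ _ fun i _ j _ _ => hg i j]
  refine Finset.sum_congr rfl fun α _ => ?_
  congr 1
  have h := Finset.noncommProd_toFinset (List.finRange d) (fun i => g i ^ α i)
    (fun i _ j _ _ => (hg i j).pow_pow _ _) (List.nodup_finRange d)
  rw [monomialOp, ← h]
  congr 1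
  exact (List.toFinset_finRange d).symm

end Monomials

/-! ### Smooth functions on phase space -/

/-- The space of smooth functions on phase space. -/
def Smooth (d : ℕ) : Submodule ℂ (Phase d → ℂ) where
  carrier := {f | ContDiff ℝ ∞ f}
  add_mem' {f g} hf hg := show ContDiff ℝ ∞ (f + g) from
    ContDiff.add (show ContDiff ℝ ∞ f from hf) (show ContDiff ℝ ∞ g from hg)
  zero_mem' := show ContDiff ℝ ∞ (fun _ => 0) from contDiff_const
  smul_mem' c f hf := show ContDiff ℝ ∞ (fun p => c • f p) from
    ContDiff.const_smul c (show ContDiff ℝ ∞ f from hf)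

lemma contDiff_coe (F : Smooth d) : ContDiff ℝ ∞ (F : Phase d → ℂ) := F.2

lemma differentiableAt_coe (F : Smooth d) (p : Phase d) :
    DifferentiableAt ℝ (F : Phase d → ℂ) p := (contDiff_coe F).differentiable (by simp) p

/-- The directional derivative as an operator on smooth functions. -/
def dirDeriv (v : Phase d) : Module.End ℂ (Smooth d) where
  toFun F := ⟨fun p => fderiv ℝ (F : Phase d → ℂ) p v,
    show ContDiff ℝ ∞ (fun p => fderiv ℝ (F : Phase d → ℂ) p v) from
      ((contDiff_coe F).fderiv_right (by simp)).clm_apply contDiff_const⟩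
  map_add' F G := by
    ext p
    change fderiv ℝ ((F : Phase d → ℂ) + (G : Phase d → ℂ)) p v = _
    rw [fderiv_add (differentiableAt_coe F p) (differentiableAt_coe G p)]
    rfl
  map_smul' c F := by
    ext p
    change fderiv ℝ (c • (F : Phase d → ℂ)) p v = _
    rw [fderiv_const_smul (differentiableAt_coe F p)]
    rfl

/-- Symmetry of second derivatives. On `Smooth d` the partial derivatives thus become commuting
elements of a ring, so multi-index manipulations reduce to monomial algebra. -/
lemma commute_dirDeriv (v w : Phase d) : Commute (dirDeriv v) (dirDeriv w) := by
  refine LinearMap.ext fun F => Subtype.ext (funext fun p => ?_)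
  have h1 : ∀ v w : Phase d, fderiv ℝ (fun p => fderiv ℝ (F : Phase d → ℂ) p v) p w =
      fderiv ℝ (fderiv ℝ (F : Phase d → ℂ)) p w v := fun v w => by
    have h2 : DifferentiableAt ℝ (fderiv ℝ (F : Phase d → ℂ)) p :=
      ((contDiff_coe F).fderiv_right (m := ∞) (by simp)).differentiable (by simp) p
    rw [fderiv_clm_apply h2 (differentiableAt_const v)]
    simp
  change fderiv ℝ (fun p => fderiv ℝ (F : Phase d → ℂ) p w) p v =
    fderiv ℝ (fun p => fderiv ℝ (F : Phase d → ℂ) p v) p w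
  rw [h1, h1]
  exact ((contDiff_coe F).contDiffAt.isSymmSndFDerivAt (by
    rw [minSmoothness_of_isRCLikeNormedField]
    exact WithTop.coe_le_coe.2 (le_top (a := (2 : ℕ∞))))) v w

/-- `∂_{x_j}` on smooth functions. -/
abbrev opX (j : Fin d) : Module.End ℂ (Smooth d) := dirDeriv (dirX j)

/-- `∂_{ξ_j}` on smooth functions. -/
abbrev opXi (j : Fin d) : Module.End ℂ (Smooth d) := dirDeriv (dirXi j)

/-- `-i ∑_j ∂_{ξ_j} ∂_{x_j}` on smooth functions. -/
def opMixed (d : ℕ) : Module.End ℂ (Smooth d) := ∑ j, (-Complex.I) • (opX j * opXi j)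

lemma coe_opMixed (F : Smooth d) : (opMixed d F : Phase d → ℂ) = mixedOp (F : Phase d → ℂ) := by
  funext p
  have h : opMixed d F = ∑ j, (-Complex.I) • opXi j (opX j F) := by
    rw [opMixed, LinearMap.sum_apply]
    refine Finset.sum_congr rfl fun j _ => ?_
    rw [commute_dirDeriv]
    rfl
  rw [h, AddSubmonoidClass.coe_finsetSum, Finset.sum_apply]
  rfl

lemma coe_opMixed_pow (n : ℕ) (F : Smooth d) :
    ((opMixed d ^ n) F : Phase d → ℂ) = mixedOp^[n] (F : Phase d → ℂ) := by
  induction n with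
  | zero => rfl
  | succ n ih => rw [pow_succ', Module.End.mul_apply, coe_opMixed, ih, Function.iterate_succ_apply']

lemma commute_opMixed (v : Phase d) : Commute (dirDeriv v) (opMixed d) :=
  Commute.sum_right _ _ _ fun _ _ =>
    ((commute_dirDeriv v _).mul_right (commute_dirDeriv v _)).smul_right _

lemma multiPow_coe (P : Fin d → (Phase d → ℂ) → Phase d → ℂ) (g : Fin d → Module.End ℂ (Smooth d))
    (h : ∀ j (F : Smooth d), P j F = g j F) (α : Fin d → ℕ) (F : Smooth d) :
    multiPow P α (F : Phase d → ℂ) = monomialOp g α F := by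
  have h1 : ∀ (n : ℕ) j (F : Smooth d), (P j)^[n] F = (g j ^ n) F := fun n j => by
    induction n with
    | zero => intro F; rfl
    | succ n ih =>
      intro F
      rw [pow_succ', Function.iterate_succ_apply', ih, h]
      rfl
  unfold multiPow monomialOp
  induction List.finRange d with
  | nil => rfl
  | cons a l ih =>
    rw [List.foldr_cons, ih, h1, List.map_cons, List.prod_cons]
    rfl

/-- `∂_x^α ∂_ξ^β` on smooth functions. -/
def opMulti (α β : Fin d → ℕ) : Module.End ℂ (Smooth d) := monomialOp opX α * monomialOp opXi β

lemma multiPow_multiPow_coe (α β : Fin d → ℕ) (F : Smooth d) :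
    multiPow partialX α (multiPow partialXi β (F : Phase d → ℂ)) = opMulti α β F := by
  rw [multiPow_coe partialXi opXi (fun _ _ => rfl), multiPow_coe partialX opX (fun _ _ => rfl)]
  rfl

lemma commute_opMulti (α β : Fin d → ℕ) {x : Module.End ℂ (Smooth d)}
    (h : ∀ v, Commute (dirDeriv v) x) : Commute (opMulti α β) x :=
  (commute_monomialOp opX (fun _ => h _) α).mul_left (commute_monomialOp opXi (fun _ => h _) β)

lemma opMulti_zero : opMulti (0 : Fin d → ℕ) 0 = 1 := by
  simp [opMulti, monomialOp]

lemma opMulti_mul_opX (α β : Fin d → ℕ) (j : Fin d) :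
    opMulti α β * opX j = opMulti (α + Pi.single j 1) β := by
  unfold opMulti
  rw [monomialOp_add_single _ (fun _ _ => commute_dirDeriv _ _), mul_assoc, mul_assoc,
    (commute_monomialOp opXi (fun _ => commute_dirDeriv _ _) β).eq]

lemma opMulti_mul_opXi (α β : Fin d → ℕ) (j : Fin d) :
    opMulti α β * opXi j = opMulti α (β + Pi.single j 1) := by
  unfold opMulti
  rw [monomialOp_add_single _ (fun _ _ => commute_dirDeriv _ _), mul_assoc]

lemma opMulti_mul_opMulti (α β α' β' : Fin d → ℕ) :
    opMulti α β * opMulti α' β' = opMulti (α + α') (β + β') := by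
  have h : Commute (monomialOp (opXi (d := d)) β) (monomialOp opX α') :=
    commute_monomialOp _ (fun _ =>
      (commute_monomialOp _ (fun _ => commute_dirDeriv _ _) α').symm) β
  unfold opMulti
  rw [monomialOp_add _ (fun _ _ => commute_dirDeriv _ _),
    monomialOp_add _ (fun _ _ => commute_dirDeriv _ _)]
  simp only [mul_assoc]
  rw [← mul_assoc (monomialOp opXi β), h.eq, mul_assoc]

/-! ### Symbols -/

/-- The symbol estimates for a smooth function. -/
def SymbolBound (m : ℝ) (F : Smooth d) : Prop :=
  ∀ α β : Fin d → ℕ, ∃ C : ℝ, ∀ p : Phase d,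
    ‖(opMulti α β F : Phase d → ℂ) p‖ ≤ C * bracket p.2 ^ (m - len β)

/-- Moves the weight to the other side of the estimate and passes from iterated partial derivatives
to operator monomials. -/
lemma symbolBound_iff {m : ℝ} {F : Smooth d} :
    SymbolBound m F ↔ IsSymbol m (F : Phase d → ℂ) := by
  have key : ∀ (C t : ℝ) (r : ℝ) (ξ : Conf d), bracket ξ ^ (-r) * t ≤ C ↔ t ≤ C * bracket ξ ^ r := by
    intro C t r ξ
    have hp := Real.rpow_pos_of_pos (bracket_pos ξ) r
    rw [Real.rpow_neg (bracket_pos ξ).le, inv_mul_le_iff₀ hp, mul_comm]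
  constructor
  · refine fun h => ⟨(contDiff_coe F), fun α β => ?_⟩
    obtain ⟨C, hC⟩ := h α β
    refine ⟨C, fun x ξ => ?_⟩
    rw [multiPow_multiPow_coe, ← neg_sub, key]
    exact hC (x, ξ)
  · intro h α β
    obtain ⟨C, hC⟩ := h.2 α β
    refine ⟨C, fun p => ?_⟩
    have := hC p.1 p.2
    rw [multiPow_multiPow_coe, ← neg_sub, key] at this
    exact this

lemma SymbolBound.mono {m m' : ℝ} {F : Smooth d} (h : SymbolBound m F) (hm : m ≤ m') :
    SymbolBound m' F := fun α β => by
  obtain ⟨C, hC⟩ := h α β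
  refine ⟨|C|, fun p => (hC p).trans ?_⟩
  have h1 : 0 ≤ bracket p.2 ^ (m - len β) := Real.rpow_nonneg (bracket_pos _).le _
  gcongr
  · exact le_abs_self C
  · exact one_le_bracket _

lemma SymbolBound.add {m : ℝ} {F G : Smooth d} (hF : SymbolBound m F) (hG : SymbolBound m G) :
    SymbolBound m (F + G) := fun α β => by
  obtain ⟨C, hC⟩ := hF α β
  obtain ⟨C', hC'⟩ := hG α β
  refine ⟨C + C', fun p => ?_⟩
  rw [map_add, add_mul]
  exact (norm_add_le _ _).trans (add_le_add (hC p) (hC' p))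

lemma SymbolBound.smul {m : ℝ} {F : Smooth d} (hF : SymbolBound m F) (c : ℂ) :
    SymbolBound m (c • F) := fun α β => by
  obtain ⟨C, hC⟩ := hF α β
  refine ⟨‖c‖ * C, fun p => ?_⟩
  rw [map_smul, mul_assoc]
  exact (norm_smul_le _ _).trans (mul_le_mul_of_nonneg_left (hC p) (norm_nonneg c))

lemma SymbolBound.zero (m : ℝ) : SymbolBound m (0 : Smooth d) := fun α β => ⟨0, fun p => by simp⟩

lemma SymbolBound.sum {ι : Type*} (s : Finset ι) {m : ℝ} {F : ι → Smooth d}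
    (h : ∀ i ∈ s, SymbolBound m (F i)) : SymbolBound m (∑ i ∈ s, F i) := by
  classical
  induction s using Finset.induction_on with
  | empty => exact SymbolBound.zero m
  | insert a s ha ih =>
    rw [Finset.sum_insert ha]
    exact (h a (by simp)).add (ih fun i hi => h i (by simp [hi]))

lemma len_add_single (β : Fin d → ℕ) (j : Fin d) : len (β + Pi.single j 1) = len β + 1 := by
  simp [len, Finset.sum_add_distrib]

lemma SymbolBound.opX {m : ℝ} {F : Smooth d} (hF : SymbolBound m F) (j : Fin d) :
    SymbolBound m (opX j F) := fun α β => by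
  rw [← Module.End.mul_apply, opMulti_mul_opX]
  exact hF _ _

lemma SymbolBound.opXi {m : ℝ} {F : Smooth d} (hF : SymbolBound m F) (j : Fin d) :
    SymbolBound (m - 1) (opXi j F) := fun α β => by
  rw [← Module.End.mul_apply, opMulti_mul_opXi]
  obtain ⟨C, hC⟩ := hF α (β + Pi.single j 1)
  refine ⟨C, fun p => (hC p).trans (le_of_eq ?_)⟩
  rw [len_add_single]
  push_cast
  ring_nf

lemma SymbolBound.opMulti {m : ℝ} {F : Smooth d} (hF : SymbolBound m F) (α β : Fin d → ℕ) :
    SymbolBound (m - len β) (opMulti α β F) := fun α' β' => by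
  rw [← Module.End.mul_apply, opMulti_mul_opMulti]
  obtain ⟨C, hC⟩ := hF (α' + α) (β' + β)
  refine ⟨C, fun p => (hC p).trans (le_of_eq ?_)⟩
  have : len (β' + β) = len β' + len β := Finset.sum_add_distrib
  rw [this]
  push_cast
  ring_nf

lemma SymbolBound.opMixed {m : ℝ} {F : Smooth d} (hF : SymbolBound m F) :
    SymbolBound (m - 1) (opMixed d F) := by
  rw [MagneticPsiDO.opMixed, LinearMap.sum_apply]
  refine SymbolBound.sum _ fun j _ => SymbolBound.smul ?_ _
  exact (hF.opXi j).opX j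

lemma SymbolBound.opMixed_pow {m : ℝ} {F : Smooth d} (hF : SymbolBound m F) (n : ℕ) :
    SymbolBound (m - n) ((MagneticPsiDO.opMixed d ^ n) F) := by
  induction n with
  | zero => simpa using hF
  | succ n ih =>
    rw [pow_succ', Module.End.mul_apply]
    have := ih.opMixed
    push_cast
    rwa [← sub_sub]

end MagneticPsiDO
end

/-! ### From symbol estimates to Fréchet derivatives, and the asymptotic expansion -/

noncomputable section
namespace MagneticPsiDO

open MeasureTheory Filter Topology

variable {d : ℕ}

/-- The functional `c ↦ c dx_j` on phase space. -/
def formX (j : Fin d) : ℂ →L[ℝ] (Phase d →L[ℝ] ℂ) :=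
  ContinuousLinearMap.smulRightL ℝ (Phase d) ℂ
    ((EuclideanSpace.proj (𝕜 := ℝ) j).comp (ContinuousLinearMap.fst ℝ (Conf d) (Conf d)))

/-- The functional `c ↦ c dξ_j` on phase space. -/
def formXi (j : Fin d) : ℂ →L[ℝ] (Phase d →L[ℝ] ℂ) :=
  ContinuousLinearMap.smulRightL ℝ (Phase d) ℂ
    ((EuclideanSpace.proj (𝕜 := ℝ) j).comp (ContinuousLinearMap.snd ℝ (Conf d) (Conf d)))

lemma fderiv_coe (F : Smooth d) :
    fderiv ℝ (F : Phase d → ℂ) = fun p => ∑ j, (formX j ((opX j F : Phase d → ℂ) p) +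
      formXi j ((opXi j F : Phase d → ℂ) p)) := by
  funext p
  refine ContinuousLinearMap.ext fun v => ?_
  have h : v = ∑ j, (v.1 j • dirX j + v.2 j • dirXi j) := by
    rw [Finset.sum_add_distrib]
    refine Prod.ext ?_ ?_
    · conv_lhs => rw [conf_eq_sum_single v.1]
      simp [Prod.fst_sum, dirX, dirXi]
    · conv_lhs => rw [conf_eq_sum_single v.2]
      simp [Prod.snd_sum, dirX, dirXi]
  conv_lhs => rw [h]
  simp [formX, formXi, dirDeriv]

/-- The gain of ⟨ξ⟩^{-1} per ξ-derivative is deliberately discarded here. It is recovered later by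
applying the uniform theory to `opMulti α β F`, a symbol of order m - |β|. -/
lemma exists_norm_iteratedFDeriv_le (n : ℕ) {m : ℝ} {F : Smooth d} (hF : SymbolBound m F) :
    ∃ C : ℝ, ∀ p, ‖iteratedFDeriv ℝ n (F : Phase d → ℂ) p‖ ≤ C * bracket p.2 ^ m := by
  induction n generalizing F with
  | zero =>
    obtain ⟨C, hC⟩ := hF 0 0
    refine ⟨C, fun p => ?_⟩
    rw [norm_iteratedFDeriv_zero]
    simpa [opMulti_zero, len] using hC p
  | succ n ih =>
    choose C₁ h₁ using fun j => ih (hF.opX j)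
    choose C₂ h₂ using fun j => ih ((hF.opXi j).mono (sub_le_self m zero_le_one))
    refine ⟨∑ j, (‖formX (d := d) j‖ * C₁ j + ‖formXi (d := d) j‖ * C₂ j), fun p => ?_⟩
    have c1 : ∀ j, ContDiff ℝ n fun p => formX j ((opX j F : Phase d → ℂ) p) := fun j =>
      (formX j).contDiff.comp ((contDiff_coe (opX j F)).of_le (mod_cast le_top))
    have c2 : ∀ j, ContDiff ℝ n fun p => formXi j ((opXi j F : Phase d → ℂ) p) := fun j =>
      (formXi j).contDiff.comp ((contDiff_coe (opXi j F)).of_le (mod_cast le_top))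
    rw [← norm_iteratedFDeriv_fderiv, fderiv_coe,
      iteratedFDeriv_fun_sum_apply fun j _ => ((c1 j).add (c2 j)).contDiffAt, Finset.sum_mul]
    refine (norm_sum_le _ _).trans (Finset.sum_le_sum fun j _ => ?_)
    refine (congrArg norm (iteratedFDeriv_add_apply (c1 j).contDiffAt (c2 j).contDiffAt)).le.trans ?_
    rw [add_mul, mul_assoc, mul_assoc]
    refine (norm_add_le _ _).trans (add_le_add ?_ ?_)
    · exact ((formX j).norm_iteratedFDeriv_comp_left (contDiff_coe (opX j F)).contDiffAt
        (mod_cast le_top)).trans (mul_le_mul_of_nonneg_left (h₁ j p) (norm_nonneg _))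
    · exact ((formXi j).norm_iteratedFDeriv_comp_left (contDiff_coe (opXi j F)).contDiffAt
        (mod_cast le_top)).trans (mul_le_mul_of_nonneg_left (h₂ j p) (norm_nonneg _))

lemma SymbolBound.isUnifSymbol {m : ℝ} {F : Smooth d} (hF : SymbolBound m F) :
    IsUnifSymbol m (F : Phase d → ℂ) := fun N => by
  choose C hC using fun n => exists_norm_iteratedFDeriv_le n hF
  refine ⟨∑ n ∈ Finset.range (N + 1), |C n|, contDiff_coe F, fun n hn p => (hC n p).trans ?_⟩
  have h1 : 0 ≤ bracket p.2 ^ m := Real.rpow_nonneg (bracket_pos _).le _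
  refine mul_le_mul_of_nonneg_right ((le_abs_self _).trans ?_) h1
  exact Finset.single_le_sum (f := fun n => |C n|) (fun i _ => abs_nonneg _)
    (Finset.mem_range.2 (Nat.lt_succ_of_le hn))

/-! ### Symbol estimates for the shear and its expansion -/

/-- The shear of a symbol as a smooth function. -/
def smoothShear {m s : ℝ} (hs : |s| ≤ 1) {F : Smooth d} (hF : SymbolBound m F) : Smooth d :=
  ⟨shear s (F : Phase d → ℂ),
    show ContDiff ℝ ∞ (shear s (F : Phase d → ℂ)) from contDiff_shear hF.isUnifSymbol hs⟩

lemma opX_smoothShear {m s : ℝ} (hs : |s| ≤ 1) {F : Smooth d} (hF : SymbolBound m F) (j : Fin d) :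
    opX j (smoothShear hs hF) = smoothShear hs (hF.opX j) :=
  Subtype.ext (partialX_shear hF.isUnifSymbol hs j)

lemma opXi_smoothShear {m s : ℝ} (hs : |s| ≤ 1) {F : Smooth d} (hF : SymbolBound m F) (j : Fin d) :
    opXi j (smoothShear hs hF) = smoothShear hs (hF.opXi j) :=
  Subtype.ext (partialXi_shear hF.isUnifSymbol hs j)

/-- Commuting one more derivative past the shear requires the function reached so far to be a symbol
of some order, so membership and commutation are proved together, by induction over the list and the
exponents. -/
lemma monomialOp_shear (g : Fin d → Module.End ℂ (Smooth d)) (s : ℝ)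
    (hg : ∀ j m (F : Smooth d), SymbolBound m F → (∃ m', SymbolBound m' (g j F)) ∧
      ∀ G : Smooth d, (G : Phase d → ℂ) = shear s (F : Phase d → ℂ) →
        (g j G : Phase d → ℂ) = shear s (g j F : Phase d → ℂ))
    (α : Fin d → ℕ) {m : ℝ} {F : Smooth d} (hF : SymbolBound m F) {G : Smooth d}
    (hG : (G : Phase d → ℂ) = shear s (F : Phase d → ℂ)) :
    (∃ m', SymbolBound m' (monomialOp g α F)) ∧
      (monomialOp g α G : Phase d → ℂ) = shear s (monomialOp g α F : Phase d → ℂ) := by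
  unfold monomialOp
  induction List.finRange d with
  | nil => exact ⟨⟨m, hF⟩, hG⟩
  | cons a l ih =>
    simp only [List.map_cons, List.prod_cons]
    induction α a with
    | zero => simpa using ih
    | succ n ihn =>
      obtain ⟨⟨m', h1⟩, h2⟩ := ihn
      have := hg a m' _ h1
      simp only [pow_succ', mul_assoc, Module.End.mul_apply (g a)]
      exact ⟨this.1, this.2 _ h2⟩

lemma opMulti_smoothShear {m s : ℝ} (hs : |s| ≤ 1) {F : Smooth d} (hF : SymbolBound m F)
    (α β : Fin d → ℕ) :
    (opMulti α β (smoothShear hs hF) : Phase d → ℂ) = shear s (opMulti α β F : Phase d → ℂ) := by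
  obtain ⟨⟨m', h1⟩, h2⟩ := monomialOp_shear opXi s (fun j m F hF => ⟨⟨_, hF.opXi j⟩, fun G hG => by
    have : G = smoothShear hs hF := Subtype.ext hG
    rw [this, opXi_smoothShear]
    rfl⟩) β hF (G := smoothShear hs hF) rfl
  exact (monomialOp_shear opX s (fun j m F hF => ⟨⟨_, hF.opX j⟩, fun G hG => by
    have : G = smoothShear hs hF := Subtype.ext hG
    rw [this, opX_smoothShear]
    rfl⟩) α h1 h2).2

/-- The Taylor polynomial `∑_{j < k} (s^j / j!) (-i ∑ ∂_ξ ∂_x)^j F`. -/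
def taylorPart (k : ℕ) (s : ℝ) (F : Smooth d) : Smooth d :=
  ∑ j ∈ Finset.range k, ((s ^ j / j.factorial : ℝ) : ℂ) • (opMixed d ^ j) F

lemma coe_sub_taylorPart (k : ℕ) (s : ℝ) (F G : Smooth d)
    (hG : (G : Phase d → ℂ) = shear s (F : Phase d → ℂ)) :
    ((G - taylorPart k s F : Smooth d) : Phase d → ℂ) = shearRem k s (F : Phase d → ℂ) := by
  funext p
  have h : (taylorPart k s F : Phase d → ℂ) p = ∑ j ∈ Finset.range k,
      (s ^ j / j.factorial : ℝ) • (mixedOp^[j] (F : Phase d → ℂ)) p := by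
    rw [taylorPart, AddSubmonoidClass.coe_finsetSum, Finset.sum_apply]
    refine Finset.sum_congr rfl fun j _ => ?_
    rw [← coe_opMixed_pow, Complex.real_smul]
    rfl
  rw [shearRem, ← h, ← hG]
  rfl

lemma opMulti_taylorPart (k : ℕ) (s : ℝ) (F : Smooth d) (α β : Fin d → ℕ) :
    opMulti α β (taylorPart k s F) = taylorPart k s (opMulti α β F) := by
  unfold taylorPart
  rw [map_sum]
  refine Finset.sum_congr rfl fun j _ => ?_
  rw [map_smul, ← Module.End.mul_apply, ← Module.End.mul_apply,
    ((commute_opMulti α β commute_opMixed).pow_right j).eq]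

/-- Both the shear and the Taylor polynomial commute with ∂_x^α ∂_ξ^β. Every symbol seminorm of the
remainder is therefore a sup bound on the remainder of a differentiated symbol. The case k = 0 says
that the shear preserves the symbol class. -/
lemma symbolBound_shear_sub_taylorPart (k : ℕ) {m s : ℝ} (hs : |s| < 1) {F : Smooth d}
    (hF : SymbolBound m F) : SymbolBound (m - k) (smoothShear hs.le hF - taylorPart k s F) := by
  intro α β
  have h1 := hF.opMulti α β
  obtain ⟨C, hC⟩ := exists_norm_shearRem_le k (m - len β) (opMulti α β F : Phase d → ℂ)
    fun j _ => by
      rw [← coe_opMixed_pow]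
      exact (h1.opMixed_pow j).isUnifSymbol
  refine ⟨C, fun p => ?_⟩
  rw [map_sub, opMulti_taylorPart,
    coe_sub_taylorPart k s _ _ (opMulti_smoothShear hs.le hF α β), sub_right_comm]
  exact hC s hs p

lemma SymbolBound.smoothShear {m s : ℝ} (hs : |s| < 1) {F : Smooth d} (hF : SymbolBound m F) :
    SymbolBound m (smoothShear hs.le hF) := by
  simpa [taylorPart] using symbolBound_shear_sub_taylorPart 0 hs hF

/-! ### The terms of the expansion -/

/-- The multinomial coefficient is n!/α!, so c^n/n! times the n-th power of ∑ D_{x_j}∂_{ξ_j} is the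
sum of (c^n/α!) D_x^α ∂_ξ^α over |α| = n. -/
lemma seriesTerm_coe (c : ℝ) (F : Smooth d) (n : ℕ) :
    seriesTerm c (F : Phase d → ℂ) n =
      ((((c ^ n / n.factorial : ℝ) : ℂ) • (opMixed d ^ n) F : Smooth d) : Phase d → ℂ) := by
  have hg : ∀ i j : Fin d, Commute ((-Complex.I) • opX i * opXi i) ((-Complex.I) • opX j * opXi j) :=
    fun i j => by
      have h1 : ∀ v : Phase d, Commute (dirDeriv v) ((-Complex.I) • opX j * opXi j) := fun v =>
        ((commute_dirDeriv v _).smul_right _).mul_right (commute_dirDeriv v _)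
      exact ((h1 _).smul_left _).mul_left (h1 _)
  have e1 : opMixed d ^ n = ∑ α ∈ Finset.piAntidiag (Finset.univ : Finset (Fin d)) n,
      (Nat.multinomial Finset.univ α : Module.End ℂ (Smooth d)) *
        (monomialOp (fun j => (-Complex.I) • opX j) α * monomialOp opXi α) := by
    have : opMixed d = ∑ j, (-Complex.I) • opX j * opXi j := by
      simp only [opMixed, smul_mul_assoc]
    rw [this, sum_pow_eq_sum_monomialOp _ hg]
    refine Finset.sum_congr rfl fun α _ => ?_
    rw [monomialOp_mul _ _ fun i j => (commute_dirDeriv _ _).smul_left _]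
  have e2 : ∀ α : Fin d → ℕ, multiPow dX α (multiPow partialXi α (F : Phase d → ℂ)) =
      ((monomialOp (fun j => (-Complex.I) • opX j) α * monomialOp opXi α) F : Smooth d) := by
    intro α
    rw [multiPow_coe partialXi opXi (fun _ _ => rfl),
      multiPow_coe dX (fun j => (-Complex.I) • opX j) (fun _ _ => rfl)]
    rfl
  funext p
  unfold seriesTerm
  simp only [e2]
  rw [e1, LinearMap.sum_apply, Finset.smul_sum, AddSubmonoidClass.coe_finsetSum, Finset.sum_apply]
  refine Finset.sum_congr rfl fun α hα => ?_
  have hlen : len α = n := (Finset.mem_piAntidiag.1 hα).1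
  have hspec : ((multiFactorial α : ℕ) : ℂ) * (Nat.multinomial Finset.univ α : ℂ) =
      (n.factorial : ℂ) := by
    rw [← hlen]
    exact_mod_cast Nat.multinomial_spec Finset.univ α
  have hne : (multiFactorial α : ℂ) ≠ 0 := by
    unfold multiFactorial
    exact_mod_cast Finset.prod_ne_zero_iff.2 fun j _ => (Nat.factorial_ne_zero _)
  have hne' : (n.factorial : ℂ) ≠ 0 := by exact_mod_cast Nat.factorial_ne_zero n
  set H := (monomialOp (fun j => (-Complex.I) • opX j) α * monomialOp opXi α) with hH
  have e3 : ((Nat.multinomial Finset.univ α : Module.End ℂ (Smooth d)) * H) F =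
      (Nat.multinomial Finset.univ α : ℂ) • H F := by
    rw [Module.End.mul_apply, Module.End.natCast_apply, Nat.cast_smul_eq_nsmul]
  rw [e3, hlen]
  change _ = ((c ^ n / n.factorial : ℝ) : ℂ) * ((Nat.multinomial Finset.univ α : ℂ) *
    (H F : Phase d → ℂ) p)
  push_cast
  rw [← mul_assoc]
  congr 1
  field_simp
  linear_combination (-(c : ℂ) ^ n) * hspec

/-- The shear has the exponential of `-is ∑ ∂_ξ ∂_x` as its asymptotic expansion. -/
lemma isAsymptoticSum_shear {m s : ℝ} (hs : |s| < 1) {F : Smooth d} (hF : SymbolBound m F) :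
    IsAsymptoticSum (fun j => m - j) (seriesTerm s (F : Phase d → ℂ))
      (shear s (F : Phase d → ℂ)) := by
  refine ⟨fun i j hij => ?_, ?_, fun j => ?_, ?_, fun k _ => ?_⟩
  · have : (i : ℝ) ≤ j := by exact_mod_cast hij
    exact sub_le_sub_left this m
  · exact tendsto_atBot_add_const_left _ m
      (tendsto_neg_atTop_atBot.comp tendsto_natCast_atTop_atTop)
  · rw [seriesTerm_coe]
    exact symbolBound_iff.1 ((hF.opMixed_pow j).smul _)
  · beta_reduce
    rw [Nat.cast_zero, sub_zero]
    exact symbolBound_iff.1 (hF.smoothShear hs)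
  · convert symbolBound_iff.1 (symbolBound_shear_sub_taylorPart k hs hF) using 1
    funext p
    have h : ∑ j ∈ Finset.range k, seriesTerm s (F : Phase d → ℂ) j p =
        (taylorPart k s F : Phase d → ℂ) p := by
      rw [taylorPart, AddSubmonoidClass.coe_finsetSum, Finset.sum_apply]
      exact Finset.sum_congr rfl fun j _ => by rw [seriesTerm_coe]
    rw [h]
    rfl

end MagneticPsiDO
end

noncomputable section
namespace MagneticPsiDO

open MeasureTheory Filter Topology

variable {d : ℕ}

/-! ### Magnetic quantizations -/

/-- The substitution y = x + z translates the integrand but not the centre of the cut-off. This is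
why the regularization was proved for cut-offs with an arbitrary shift w₁. -/
lemma hasOscIntegral_of_isOscAmp {q : ℕ} {F : Phase d → ℂ} (hF : IsOscAmp q F) (w₁ : Phase d)
    {f : Phase d → ℂ} (hf : ∀ w, f (w + w₁) = phase w * F w) : HasOscIntegral f (osc F) := by
  have e : ∀ (χ : 𝓢(Phase d, ℂ)) (ε : ℝ), (fun w => χ (ε • (w + w₁)) • (phase w • F w)) =
      fun w => (fun p => χ (ε • p) * f p) (w + w₁) := fun χ ε => by
    funext w
    simp only [hf, smul_eq_mul]
  refine fun χ hχ => ⟨fun ε hε => ?_, ?_⟩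
  · have h := integrable_cutoff_phase_smul hF χ hε w₁
    rw [e] at h
    simpa using h.comp_sub_right w₁
  · have h := tendsto_integral_cutoff hF χ w₁
    have e' : (fun ε : ℝ => ∫ w, χ (ε • (w + w₁)) • (phase w • F w)) =
        fun ε => ∫ p, χ (ε • p) * f p := funext fun ε => by
      rw [e, integral_add_right_eq_self (fun p => χ (ε • p) * f p)]
    rwa [hχ, one_smul, e'] at h

/-- `y ↦ ω^A(x, y) u(y)` as a Schwartz function. -/
def magneticTwist (A : Conf d → Conf d) (x : Conf d) (u : 𝓢(Conf d, ℂ)) : 𝓢(Conf d, ℂ) :=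
  SchwartzMap.smulLeftCLM ℂ (omegaA A x) u

lemma magneticTwist_apply {A : Conf d → Conf d} (hA : A.HasTemperateGrowth) (x : Conf d)
    (u : 𝓢(Conf d, ℂ)) (y : Conf d) : magneticTwist A x u y = omegaA A x y * u y :=
  SchwartzMap.smulLeftCLM_apply_apply (hasTemperateGrowth_omegaA_right hA x) u y

/-- Treats all τ at once, τ = 0 and τ = 1/2 being the two quantizations. For fixed x the magnetic
factor is hidden in `magneticTwist`, since it does not depend on η. -/
lemma hasAmplitude_of_eq_osc {A : Conf d → Conf d} (hA : A.HasTemperateGrowth) {m : ℝ}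
    {a : Phase d → ℂ} (ha : IsUnifSymbol m a) {τ : ℝ} (hτ : |τ| ≤ 1)
    {T : 𝓢(Conf d, ℂ) →L[ℂ] 𝓢(Conf d, ℂ)}
    (hT : ∀ u x, T u x = ((((2 * Real.pi) ^ d)⁻¹ : ℝ) : ℂ) •
      osc (quantAmp x (magneticTwist A x u) τ a)) :
    HasAmplitude A (fun x y η => a (x + τ • (y - x), η)) T := by
  intro u x
  have hq := ha.quantAmp x (magneticTwist A x u) hτ
  rw [hT, ← osc_smul' _ hq]
  refine hasOscIntegral_of_isOscAmp (hq.const_smul _) (x, 0) fun w => ?_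
  have h1 : ((x, 0) + dilate τ w : Phase d) = (x + τ • w.1, w.2) := by
    simp [dilate]
  simp only [quantAmp, magneticTwist_apply hA, phase, smul_eq_mul, Prod.fst_add, Prod.snd_add,
    add_zero, h1, add_sub_cancel_right]
  rw [add_comm w.1 x, sub_add_cancel_left, inner_neg_left]
  push_cast
  rw [mul_neg]
  ring

/-- Every uniform symbol has a magnetic left quantization acting on the Schwartz space. -/
lemma exists_left_quantization {A : Conf d → Conf d} (hA : A.HasTemperateGrowth) {m : ℝ}
    {b : Phase d → ℂ} (hb : IsUnifSymbol m b) :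
    ∃ T : 𝓢(Conf d, ℂ) →L[ℂ] 𝓢(Conf d, ℂ), ∀ u x, T u x =
      ((((2 * Real.pi) ^ d)⁻¹ : ℝ) : ℂ) • osc (quantAmp x (magneticTwist A x u) 0 b) := by
  -- Continuity in u involves all x at once, so here ω^A and the constant form the temperate kernel
  -- factor k instead of being absorbed into u.
  have hk : (fun p : Phase d => ((((2 * Real.pi) ^ d)⁻¹ : ℝ) : ℂ) *
      omegaA A p.1 (p.1 + p.2)).HasTemperateGrowth :=
    (Function.HasTemperateGrowth.const _).mul (hasTemperateGrowth_omegaA hA)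
  refine ⟨leftOpCLM hk hb, fun u x => ?_⟩
  rw [leftOpCLM_apply, ← osc_smul' _ (hb.quantAmp x (magneticTwist A x u) (by simp))]
  congr 1
  funext w
  have h1 : ((x, 0) + dilate 0 w : Phase d) = (x, w.2) := by simp [dilate]
  simp only [leftAmp, quantAmp, magneticTwist_apply hA, smul_eq_mul, h1]
  ring

lemma isMagneticLeft_of_eq_osc {A : Conf d → Conf d} (hA : A.HasTemperateGrowth) {m : ℝ}
    {b : Phase d → ℂ} (hb : IsUnifSymbol m b) {T : 𝓢(Conf d, ℂ) →L[ℂ] 𝓢(Conf d, ℂ)}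
    (hT : ∀ u x, T u x = ((((2 * Real.pi) ^ d)⁻¹ : ℝ) : ℂ) •
      osc (quantAmp x (magneticTwist A x u) 0 b)) : IsMagneticLeft A b T := by
  simpa [IsMagneticLeft] using hasAmplitude_of_eq_osc hA hb (by simp) hT

lemma isMagneticWeyl_of_eq_osc {A : Conf d → Conf d} (hA : A.HasTemperateGrowth) {m : ℝ}
    {a : Phase d → ℂ} (ha : IsUnifSymbol m a) {T : 𝓢(Conf d, ℂ) →L[ℂ] 𝓢(Conf d, ℂ)}
    (hT : ∀ u x, T u x = ((((2 * Real.pi) ^ d)⁻¹ : ℝ) : ℂ) •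
      osc (quantAmp x (magneticTwist A x u) (1 / 2) a)) : IsMagneticWeyl A a T := by
  have h := hasAmplitude_of_eq_osc hA ha (by norm_num [abs_le]) hT
  have e : ∀ x y : Conf d, x + (1 / 2 : ℝ) • (y - x) = (1 / 2 : ℝ) • (x + y) := fun x y => by
    module
  simp only [e] at h
  exact h

end MagneticPsiDO
end

theorem proposition1p14 (d : ℕ)
    (B : Fin d → Fin d → MagneticPsiDO.Conf d → ℝ) (hB : MagneticPsiDO.IsMagneticField B)
    (A : MagneticPsiDO.Conf d → MagneticPsiDO.Conf d)
    (hA : MagneticPsiDO.IsVectorPotential A B) (m : ℝ) :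
    (∀ a : MagneticPsiDO.Phase d → ℂ, MagneticPsiDO.IsSymbol m a →
      ∃ b : MagneticPsiDO.Phase d → ℂ, MagneticPsiDO.IsSymbol m b ∧
        (∃ T : 𝓢(MagneticPsiDO.Conf d, ℂ) →L[ℂ] 𝓢(MagneticPsiDO.Conf d, ℂ),
          MagneticPsiDO.IsMagneticWeyl A a T ∧ MagneticPsiDO.IsMagneticLeft A b T) ∧
        MagneticPsiDO.IsAsymptoticSum (fun j => m - j)
          (MagneticPsiDO.seriesTerm (1 / 2) a) b) ∧
    (∀ b : MagneticPsiDO.Phase d → ℂ, MagneticPsiDO.IsSymbol m b →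
      ∃ a : MagneticPsiDO.Phase d → ℂ, MagneticPsiDO.IsSymbol m a ∧
        (∃ T : 𝓢(MagneticPsiDO.Conf d, ℂ) →L[ℂ] 𝓢(MagneticPsiDO.Conf d, ℂ),
          MagneticPsiDO.IsMagneticLeft A b T ∧ MagneticPsiDO.IsMagneticWeyl A a T) ∧
        MagneticPsiDO.IsAsymptoticSum (fun j => m - j)
          (MagneticPsiDO.seriesTerm (-(1 / 2)) b) a) := by
  have hs : |(1 / 2 : ℝ)| < 1 := by norm_num [abs_lt]
  have hs' : |(-(1 / 2) : ℝ)| < 1 := by norm_num [abs_lt]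
  refine ⟨fun a ha => ?_, fun b hb => ?_⟩
  · set F : MagneticPsiDO.Smooth d := ⟨a, ha.1⟩
    have hF : MagneticPsiDO.SymbolBound m F := MagneticPsiDO.symbolBound_iff.2 ha
    have hb := hF.smoothShear hs
    -- The operator is built as the left quantization of the sheared symbol and then recognized as
    -- the Weyl quantization of a.
    obtain ⟨T, hT⟩ := MagneticPsiDO.exists_left_quantization hA.temperate hb.isUnifSymbol
    refine ⟨MagneticPsiDO.shear (1 / 2) a, MagneticPsiDO.symbolBound_iff.1 hb,
      ⟨T, MagneticPsiDO.isMagneticWeyl_of_eq_osc hA.temperate hF.isUnifSymbol fun u x => ?_,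
        MagneticPsiDO.isMagneticLeft_of_eq_osc hA.temperate hb.isUnifSymbol hT⟩,
      MagneticPsiDO.isAsymptoticSum_shear hs hF⟩
    -- Here τ = c = 1/2, so τ - c = 0.
    rw [hT, ← MagneticPsiDO.osc_quantAmp_shear hF.isUnifSymbol x _ hs hs (by norm_num), sub_self]
    rfl
  · set F : MagneticPsiDO.Smooth d := ⟨b, hb.1⟩
    have hF : MagneticPsiDO.SymbolBound m F := MagneticPsiDO.symbolBound_iff.2 hb
    have ha := hF.smoothShear hs'
    obtain ⟨T, hT⟩ := MagneticPsiDO.exists_left_quantization hA.temperate hF.isUnifSymbol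
    refine ⟨MagneticPsiDO.shear (-(1 / 2)) b, MagneticPsiDO.symbolBound_iff.1 ha,
      ⟨T, MagneticPsiDO.isMagneticLeft_of_eq_osc hA.temperate hF.isUnifSymbol hT,
        MagneticPsiDO.isMagneticWeyl_of_eq_osc hA.temperate ha.isUnifSymbol fun u x => ?_⟩,
      MagneticPsiDO.isAsymptoticSum_shear hs' hF⟩
    -- Here τ = 0 and c = -1/2, so τ - c = 1/2: from left to Weyl.
    rw [hT, ← MagneticPsiDO.osc_quantAmp_shear hF.isUnifSymbol x _ (c := -(1 / 2)) (by simp) hs'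
      (by norm_num [abs_lt]), zero_sub, neg_neg]
    rfl
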